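/- Let $N\ge 0$, $m=N+1$, $q\in\mathbb C\setminus\{0\}$, $f(u,v)=\frac{qu-q^{-1}v}{u-v}$, $g(u,v)=\frac{q-q^{-1}}{u-v}$, and let $$R(u,v)=f(u,v)\sum_i E_{ii}\otimes E_{ii}+\sum_{i<j}\big(E_{ii}\otimes E_{jj}+E_{jj}\otimes E_{ii}\big)+\sum_{i<j}g(u,v)\big(u\,E_{ij}\otimes E_{ji}+v\,E_{ji}\otimes E_{ij}\big)$$ act in $\mathbb C^m\otimes\mathbb C^m$. A model consists of an $m\times m$ matrix $T(u)=(T_{i,j}(u))$ of operators in a complex vector space $\mathcal H$, defined for $u$ in some set $D\subseteq\mathbb C$, such that $R(u,v)(T(u)\otimes 1)(1\otimes T(v))=(1\otimes T(v))(T(u)\otimes 1)R(u,v)$ for $u\ne v$ in $D$; functions $\lambda_1,\dots,\lambda_m$; a vector $|0\rangle\in\mathcal H$ with $T_{i,i}(u)|0\rangle=\lambda_i(u)|0\rangle$ and $T_{i,j}(u)|0\rangle=0$ for $i>j$; and a linear form $\langle 0|$ on $\mathcal H$ with $\langle 0|T_{i,i}(u)=\lambda_i(u)\langle 0|$, $\langle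 0|T_{i,j}(u)=0$ for $i<j$, and $\langle 0|0\rangle=1$. Put $\alpha_k(u)=\lambda_k(u)/\lambda_{k+1}(u)$, $k=1,\dots,N$. A function applied to a finite set of parameters (or to two sets) denotes the product over the set(s). For $\bar t=(\bar t^1,\dots,\bar t^N)$ with $\bar t^k=\{t^k_1,\dots,t^k_{r_k}\}$ the Bethe vector is $$\mathbb B(\bar t)=\frac{\widehat{\mathbb B}(\bar t\,|\,T,|0\rangle)}{\prod_{k=1}^N\lambda_{k+1}(\bar t^k)\prod_{k=1}^{N-1}f(\bar t^{k+1},\bar t^k)},$$ where $\widehat{\mathbb B}$ is given by the nested algebraic Bethe ansatz: $\widehat{\mathbb B}(\,\cdot\,|T,v)=v$ if $N=0$, and for $N\ge1$ $$\widehat{\mathbb B}(\bar t|T,v)=\sum_{k_1,\dots,k_{r_1}=2}^{m}T_{1,k_1}(t^1_1)\cdots T_{1,k_{r_1}}(t^1_{r_1})\Big[\widehat{\mathbb B}\big(\bar t^2,\dots,\bar t^N\,\big|\,D(u)\,\mathsf r_{0,r_1}(u,t^1_{r_1})\cdots \mathsf r_{0,1}(u,t^1_1),\;v\otimes \mathsf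 e_2^{\otimes r_1}\big)\Big]_{k_1,\dots,k_{r_1}},$$ with $D=(T_{i,j})_{i,j=2}^m$, $\mathsf r$ the $R$-matrix of size $m-1$ (basis $\mathsf e_2,\dots,\mathsf e_m$), $\mathsf r_{0,j}$ acting in the auxiliary space and the $j$-th factor of $(\mathbb C^{m-1})^{\otimes r_1}$, and $[\,\cdot\,]_{k_1,\dots,k_{r_1}}$ the components in $(\mathbb C^{m-1})^{\otimes r_1}$. The dual Bethe vector $\mathbb C(\bar s)\in\mathcal H^*$ is the Bethe vector with parameters $1/s^k_j$, for the deformation parameter $q^{-1}$, built from the transposed operators $\widetilde T_{a,b}(u)=T_{b,a}(u^{-1})^{*}$ in $\mathcal H^*$, the vacuum $\langle0|$ and the eigenvalues $\lambda_i(u^{-1})$. Let $S(\bar s|\bar t)=\mathbb C(\bar s)\mathbb B(\bar t)$. A pair $(\bar s,\bar t)$ with $\#\bar s^k=\#\bar t^k=r_k$ for all $k$ is called generic if all the parameters $s^k_j,t^k_j$ are non-zero and pairwise distinct and all the $f(t^{k+1}_a,t^k_b)$ and $f(s^{k+1}_a,s^k_b)$ are non-zero. Claim. For given $N$ and $q$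 there are coefficients $W_{\rm part}(\bar s_{\rm I},\bar s_{\rm II}|\bar t_{\rm I},\bar t_{\rm II})$, functions of the $N$-tuples of finite sets $\bar s_{\rm I},\bar s_{\rm II},\bar t_{\rm I},\bar t_{\rm II}$ with $\#\bar s^k_{\rm I}=\#\bar t^k_{\rm I}$, such that (i) for fixed cardinalities of the sets, $W_{\rm part}$ is a rational function of the parameters, regular at all generic pairs; (ii) for every model (with the same $W_{\rm part}$ for all models, so that $W_{\rm part}$ is determined by the $R$-matrix and does not depend on $\mathcal H$, $T$ or the vacuum eigenvalues $\lambda_i$), all $r_1,\dots,r_N\ge0$ and every generic pair $(\bar s,\bar t)$ of parameters in $D$ with $\lambda_{k+1}(s^k_j)\ne0$ and $\lambda_{k+1}(t^k_j)\neq 0$, $$S(\bar s|\bar t)=\sum W_{\rm part}(\bar s_{\rm I},\bar s_{\rm II}|\bar t_{\rm I},\bar t_{\rm II})\prod_{k=1}^N\alpha_k(\bar s^k_{\rm I})\,\alpha_k(\bar t^k_{\rm II}),$$ where the sum is over all partitions $\bar s^k=\bar s^k_{\rm I}\sqcup\bar s^k_{\rm II}$, $\bar t^k=\bar t^k_{\rm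 I}\sqcup\bar t^k_{\rm II}$ with $\#\bar s^k_{\rm I}=\#\bar t^k_{\rm I}$ for all $k$. -/

import Mathlib

open scoped Kronecker

universe u

noncomputable section

namespace BetheAnsatz

/-- The rational function `f(u,v) = (q u - q⁻¹ v) / (u - v)`. -/
def f (q u v : ℂ) : ℂ := (q * u - q⁻¹ * v) / (u - v)

/-- The rational function `g(u,v) = (q - q⁻¹) / (u - v)`. -/
def g (q u v : ℂ) : ℂ := (q - q⁻¹) / (u - v)

/-- The elementary unit matrix `E_{ij}`. -/
def E {m : ℕ} (i j : Fin m) : Matrix (Fin m) (Fin m) ℂ := Matrix.single i j 1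

/-- The trigonometric `R`-matrix `R(u,v)` of `U_q(gl_m^)`, acting in `ℂ^m ⊗ ℂ^m`. -/
def Rmat (m : ℕ) (q u v : ℂ) : Matrix (Fin m × Fin m) (Fin m × Fin m) ℂ :=
  f q u v • ∑ i, (E i i ⊗ₖ E i i)
    + ∑ i, ∑ j ∈ Finset.Ioi i, (E i i ⊗ₖ E j j + E j j ⊗ₖ E i i)
    + ∑ i, ∑ j ∈ Finset.Ioi i,
        g q u v • (u • (E i j ⊗ₖ E j i) + v • (E j i ⊗ₖ E i j))

/-- A monodromy matrix: for every `u`, an `m × m` matrix of operators in `H`. -/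
abbrev Monodromy (m : ℕ) (H : Type u) [AddCommGroup H] [Module ℂ H] : Type u :=
  ℂ → Matrix (Fin m) (Fin m) (Module.End ℂ H)

/-- The `RTT`-relation at `(u,v)`:
`R(u,v) (T(u) ⊗ 1) (1 ⊗ T(v)) = (1 ⊗ T(v)) (T(u) ⊗ 1) R(u,v)`. -/
def RTT {m : ℕ} {H : Type u} [AddCommGroup H] [Module ℂ H] (q : ℂ) (T : Monodromy m H)
    (u v : ℂ) : Prop :=
  (Rmat m q u v).map (algebraMap ℂ (Module.End ℂ H)) * (T u ⊗ₖ 1) * (1 ⊗ₖ T v)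
    = (1 ⊗ₖ T v) * (T u ⊗ₖ 1) * (Rmat m q u v).map (algebraMap ℂ (Module.End ℂ H))

/-- A representative of the generalized `U_q(gl_m^)` based model: a monodromy matrix, defined for
spectral parameters in `dom` (it may have poles elsewhere), with a pseudovacuum vector `vac`, a dual
pseudovacuum `covac` normalized by `⟨0|0⟩ = 1`, and vacuum eigenvalues `lam i`. -/
structure Model (m : ℕ) (q : ℂ) (H : Type u) [AddCommGroup H] [Module ℂ H] where
  dom : Set ℂ
  T : Monodromy m H
  rtt : ∀ u ∈ dom, ∀ v ∈ dom, u ≠ v → RTT q T u v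
  vac : H
  covac : Module.Dual ℂ H
  lam : Fin m → ℂ → ℂ
  diag_vac : ∀ u ∈ dom, ∀ i, T u i i vac = lam i u • vac
  lower_vac : ∀ u ∈ dom, ∀ i j, j < i → T u i j vac = 0
  covac_diag : ∀ u ∈ dom, ∀ i, covac ∘ₗ T u i i = lam i u • covac
  covac_upper : ∀ u ∈ dom, ∀ i j, i < j → covac ∘ₗ T u i j = 0
  covac_vac : covac vac = 1

/-- Bethe parameters: for every colour `k`, an `r k`-tuple `t^k_1, …, t^k_{r_k}`. -/
abbrev Params {N : ℕ} (r : Fin N → ℕ) : Type := ∀ k : Fin N, Fin (r k) → ℂ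

/-! ### Nested algebraic Bethe ansatz -/

/-- The `R`-matrix `R_{0,j}(u,v)` acting in the auxiliary space and the `j`-th factor of
`(ℂ^n)^{⊗ r}`, as an `n × n` matrix of operators in `(ℂ^n)^{⊗ r}`. -/
def siteR (n r : ℕ) (q u v : ℂ) (j : Fin r) :
    Matrix (Fin n) (Fin n) (Matrix (Fin r → Fin n) (Fin r → Fin n) ℂ) :=
  fun a b κ κ' => if ∀ i, i ≠ j → κ i = κ' i then Rmat n q u v (a, κ j) (b, κ' j) else 0

/-- The inhomogeneous monodromy matrix `R_{0,r}(u,x_r) ⋯ R_{0,1}(u,x_1)`. -/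
def inhomogeneous (n : ℕ) {r : ℕ} (q : ℂ) (x : Fin r → ℂ) (u : ℂ) :
    Matrix (Fin n) (Fin n) (Matrix (Fin r → Fin n) (Fin r → Fin n) ℂ) :=
  (List.ofFn fun j => siteR n r q u (x j) j).reverse.prod

/-- The operator `X ⊗ A` in `H ⊗ ℂ^ι`, the latter being identified with `ι → H`. -/
def tensorOp {ι : Type} [Fintype ι] {H : Type u} [AddCommGroup H] [Module ℂ H]
    (X : Module.End ℂ H) (A : Matrix ι ι ℂ) : Module.End ℂ (ι → H) :=
  LinearMap.pi fun κ => ∑ κ', A κ κ' • (X ∘ₗ LinearMap.proj κ')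

/-- The nested monodromy matrix `D(u) R_{0,r}(u,x_r) ⋯ R_{0,1}(u,x_1)` in `H ⊗ (ℂ^n)^{⊗ r}`, where
`D` is the lower right `n × n` block of the `(n+1) × (n+1)` matrix `T`. -/
def nestedMonodromy {n r : ℕ} {H : Type u} [AddCommGroup H] [Module ℂ H] (q : ℂ)
    (T : Monodromy (n + 1) H) (x : Fin r → ℂ) : Monodromy n ((Fin r → Fin n) → H) :=
  fun u i j => ∑ l, tensorOp (T u i.succ l.succ) (inhomogeneous n q x u l j)

/-- The Bethe vector without its scalar normalization, by the nested algebraic Bethe ansatz: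
`∑_{k_1,…,k_r} T_{1,k_1}(t^1_1) ⋯ T_{1,k_r}(t^1_r) [B']_{k_1,…,k_r}`, where `B'` is the corresponding
vector of the nested monodromy matrix, with parameters `t^2, …, t^N` and pseudovacuum
`v ⊗ e_2 ⊗ ⋯ ⊗ e_2`. -/
def preBethe (q : ℂ) : (N : ℕ) → {H : Type u} → [AddCommGroup H] → [Module ℂ H] →
    Monodromy (N + 1) H → {r : Fin N → ℕ} → Params r → H → H
  | 0, _, _, _, _, _, _, v => v
  | N + 1, _, _, _, T, r, t, v =>
      ∑ κ : Fin (r 0) → Fin (N + 1),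
        (List.ofFn fun j => T (t 0 j) 0 (κ j).succ).prod
          (preBethe q N (nestedMonodromy q T (t 0)) (r := fun k => r k.succ)
            (fun k => t k.succ) (fun κ' => if κ' = 0 then v else 0) κ)

/-- The Bethe vector `B(t)` of the monodromy matrix `T` with vacuum eigenvalues `lam` and
pseudovacuum `v`, normalized so that its main term is
`T_{1,2}(t^1) ⋯ T_{N,N+1}(t^N) v / (∏_k λ_{k+1}(t^k) ∏_k f(t^{k+1},t^k))`. -/
def betheVector {N : ℕ} {H : Type u} [AddCommGroup H] [Module ℂ H] (q : ℂ)
    (T : Monodromy (N + 1) H) (lam : Fin (N + 1) → ℂ → ℂ) (v : H) {r : Fin N → ℕ}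
    (t : Params r) : H :=
  ((∏ k, ∏ j, lam k.succ (t k j)) *
    ∏ k : Fin N, ∏ l : Fin N, if (l : ℕ) = k + 1 then ∏ a, ∏ b, f q (t l a) (t k b) else 1)⁻¹ •
    preBethe q N T t v

namespace Model

variable {N : ℕ} {q : ℂ} {H : Type u} [AddCommGroup H] [Module ℂ H]

/-- The ratio of vacuum eigenvalues `α_k(u) = λ_k(u) / λ_{k+1}(u)`, `k = 1, …, N`. -/
def alpha (M : Model (N + 1) q H) (k : Fin N) (u : ℂ) : ℂ :=
  M.lam k.castSucc u / M.lam k.succ u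

/-- The Bethe vector `B(t)`. -/
def bethe (M : Model (N + 1) q H) {r : Fin N → ℕ} (t : Params r) : H :=
  betheVector q M.T M.lam M.vac t

/-- The dual Bethe vector `C(s)`, obtained from Bethe vectors by the antimorphism
`T_{a,b}(u) ↦ T_{b,a}(u⁻¹)` relating the algebras with deformation parameters `q` and `q⁻¹`:
`C_q(s)` is the Bethe vector with parameters `s⁻¹`, for the deformation parameter `q⁻¹`, of the
transposed operators acting in the dual space. -/
def dualBethe (M : Model (N + 1) q H) {r : Fin N → ℕ} (s : Params r) : Module.Dual ℂ H :=
  betheVector q⁻¹ (fun u a b => (M.T u⁻¹ b a).dualMap) (fun i u => M.lam i u⁻¹) M.covac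
    (fun k j => (s k j)⁻¹)

/-- The scalar product `S(s|t) = C(s) B(t)`. -/
def scalarProduct (M : Model (N + 1) q H) {r : Fin N → ℕ} (s t : Params r) : ℂ :=
  M.dualBethe s (M.bethe t)

/-- The Bethe parameters lie in the domain of the monodromy matrix, and the denominators
`λ_{k+1}(t^k)` of the Bethe vector and of the `α_k` do not vanish. -/
def Admissible (M : Model (N + 1) q H) {r : Fin N → ℕ} (t : Params r) : Prop :=
  ∀ k j, t k j ∈ M.dom ∧ M.lam k.succ (t k j) ≠ 0

end Model

/-- The factors `f(t^{k+1}_a, t^k_b)` in the normalization do not vanish. -/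
def NormalizationRegular {N : ℕ} (q : ℂ) {r : Fin N → ℕ} (t : Params r) : Prop :=
  ∀ k l : Fin N, (l : ℕ) = k + 1 → ∀ a b, f q (t l a) (t k b) ≠ 0

/-- Generic pair of families of Bethe parameters: all the parameters are non-zero and pairwise
distinct, and the normalization factors of the two Bethe vectors are non-zero. -/
def Generic {N : ℕ} (q : ℂ) {r : Fin N → ℕ} (s t : Params r) : Prop :=
  (∀ k j, s k j ≠ 0) ∧ (∀ k j, t k j ≠ 0) ∧
  Function.Injective
    (Sum.elim (fun p : Σ k, Fin (r k) => s p.1 p.2) (fun p : Σ k, Fin (r k) => t p.1 p.2)) ∧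
  NormalizationRegular q s ∧ NormalizationRegular q t

/-- A family of finite sets of Bethe parameters, one for each colour. -/
abbrev ParamSets (N : ℕ) : Type := Fin N → Finset ℂ

/-- The subsets `{t^k_j : j ∈ J_k}` of a family of Bethe parameters. -/
def subsets {N : ℕ} {r : Fin N → ℕ} (t : Params r) (J : ∀ k, Finset (Fin (r k))) : ParamSets N :=
  fun k => (J k).image (t k)

/-- `W(s_I, s_II | t_I, t_II)` is a rational function of the Bethe parameters: for all cardinalities
`r` and all index sets `I`, `J` of `s_I`, `t_I`, it is a quotient of two polynomials in the variables
`s^k_j`, `t^k_j`, whose denominator does not vanish at generic parameters. -/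
def IsRational {N : ℕ} (q : ℂ)
    (W : ParamSets N → ParamSets N → ParamSets N → ParamSets N → ℂ) : Prop :=
  ∀ (r : Fin N → ℕ) (I J : ∀ k, Finset (Fin (r k))), (∀ k, (I k).card = (J k).card) →
    ∃ P Q : MvPolynomial ((Σ k, Fin (r k)) ⊕ (Σ k, Fin (r k))) ℂ,
      ∀ s t : Params r, Generic q s t →
        MvPolynomial.eval (Sum.elim (fun p => s p.1 p.2) (fun p => t p.1 p.2)) Q ≠ 0 ∧
        W (subsets s I) (subsets s fun k => (I k)ᶜ) (subsets t J) (subsets t fun k => (J k)ᶜ) =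
          MvPolynomial.eval (Sum.elim (fun p => s p.1 p.2) (fun p => t p.1 p.2)) P /
          MvPolynomial.eval (Sum.elim (fun p => s p.1 p.2) (fun p => t p.1 p.2)) Q

end BetheAnsatz

end

/-! The scalar product is evaluated by normal ordering. Up to normalization, the Bethe vector is a
combination of words in the entries `T_{a,b}(x)` applied to the vacuum, with coefficients built from
entries of `R` (`preBethe_mem_wordSpan`). Transposition turns the dual Bethe vector into words
acting from the other side, so the scalar product becomes `⟨0| word |0⟩`, each parameter occurring
exactly once. The RTT-relations push lower triangular letters to the right, where they kill the
vacuum (`op_mem_normalSpan_of_exchanges`); of an upper triangular word, `⟨0|` retains only the case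
of diagonal letters. This gives `∑_φ C_φ ∏_p λ_{φ(p)}(x_p)` over labellings `φ` of the parameters.
The `C_φ` are rational and independent of the model because the computation is done once, for the
family of all models and generic points, linearly over the algebra of rational functions regular at
generic points (`Datum`, `exists_expansion`).

Two restrictions on `φ` remain to be proved. The exchange relations preserve the multiset of row
indices, and this yields `#s_I = #t_I`. The second restriction, that a parameter of colour `k`
carries only `λ_k` or `λ_{k+1}`, cannot be read off from this expansion. However, for the last
parameter of colour `k` the Bethe vector can be rewritten so that the rightmost letter is
`T_{a,c}(t^k_j)` with `k ≤ a ≤ c ≤ k + 1` (`preBethe_mem_wordSpan_last`), and normal ordering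
respects this form (`pairBase_normal`). This gives another expansion, in which that one parameter is
correctly labelled. Since Bethe vectors are symmetric within each colour (`preBethe_perm`),
uniqueness of coefficients carries the restriction to every `t^k_j`, and duality (`preScalar_dual`)
carries it to every `s^k_j`.

Uniqueness of coefficients needs sufficiently many models (`coeff_eq_zero`). For `q² ≠ 1`, fusion on
`q`-antisymmetric tensors gives models whose first `r + 1` vacuum eigenvalues are `f(w, ξ)` and
whose others are `1` (`chainModel`); for `q² = 1`, one-dimensional models realize all eigenvalues.
Tensor products multiply eigenvalues, so the monomials `∏_p λ_{φ(p)}(x_p)` are characters of a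
monoid. They are pairwise distinct, by comparing poles in `ξ`, hence linearly independent. The
argument requires `q² x_p ≠ x_{p'}`; such points are Zariski dense, so the resulting identities
extend to all generic points as polynomial identities.

Finally, by symmetry the coefficients depend only on the sets of parameters, which makes `Wpart`
well defined. -/

noncomputable section

namespace BetheAnsatz

/-! ### Entries of the `R`-matrix and the RTT-relation in components -/

/-- The exchange amplitude `g(u,v) u` for `a < b`, `g(u,v) v` otherwise. -/
def h {m : ℕ} (q u v : ℂ) (a b : Fin m) : ℂ := if a < b then g q u v * u else g q u v * v

lemma Rmat_apply (m : ℕ) (q u v : ℂ) (a b c d : Fin m) :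
    Rmat m q u v (a, b) (c, d) =
      if a = b then (if c = a ∧ d = a then f q u v else 0)
      else if c = a ∧ d = b then 1
      else if c = b ∧ d = a then h q u v a b else 0 := by
  have key : ∀ i j k l : Fin m, (E i j ⊗ₖ E k l : Matrix (Fin m × Fin m) (Fin m × Fin m) ℂ)
      (a, b) (c, d) = if i = a ∧ k = b ∧ j = c ∧ l = d then 1 else 0 := by
    intro i j k l
    simp only [E, Matrix.kroneckerMap_apply, Matrix.single_apply]
    split_ifs <;> simp_all
  simp only [Rmat, Matrix.add_apply, Matrix.smul_apply, Matrix.sum_apply, key, smul_eq_mul]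
  have h1 : ∑ i : Fin m, (if i = a ∧ i = b ∧ i = c ∧ i = d then (1 : ℂ) else 0)
      = if a = b ∧ a = c ∧ a = d then 1 else 0 := by
    rw [Finset.sum_eq_single a] <;> simp_all
  have h3 : ∀ (a' b' : Fin m) (P : Prop) [Decidable P], ∑ i : Fin m, ∑ j ∈ Finset.Ioi i,
      (if i = a' ∧ j = b' ∧ P then (1 : ℂ) else 0) = if a' < b' ∧ P then 1 else 0 := by
    intro a' b' P _
    by_cases hP : P
    · simp [hP, ite_and]
    · simp [hP]
  have h4 : ∀ (a' b' : Fin m) (P : Prop) [Decidable P], ∑ i : Fin m, ∑ j ∈ Finset.Ioi i,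
      (if j = a' ∧ i = b' ∧ P then (1 : ℂ) else 0) = if b' < a' ∧ P then 1 else 0 := by
    intro a' b' P _
    rw [← h3]
    simp only [← and_assoc, and_comm (a := _ = a')]
  have e1 : ∀ i j : Fin m, (i = a ∧ j = b ∧ i = c ∧ j = d) ↔ (i = a ∧ j = b ∧ (a = c ∧ b = d)) := by
    intro i j
    constructor <;> rintro ⟨rfl, rfl, rfl, rfl⟩ <;> simp
  have e3 : ∀ i j : Fin m, (i = a ∧ j = b ∧ j = c ∧ i = d) ↔ (i = a ∧ j = b ∧ (b = c ∧ a = d)) := by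
    intro i j
    constructor <;> rintro ⟨rfl, rfl, rfl, rfl⟩ <;> simp
  rw [h1]
  simp only [e1, e3, mul_add, Finset.sum_add_distrib, ← Finset.mul_sum, h3, h4, h]
  rcases lt_trichotomy a b with hab | hab | hab
  · have h5 := hab.ne
    have h6 := hab.not_gt
    by_cases h1 : c = a
    · subst h1; by_cases h4 : d = b <;> simp [hab, h5, h6, h5.symm, h4, eq_comm] <;> grind
    · by_cases h2 : c = b
      · subst h2; by_cases h4 : d = a <;> simp [hab, h5, h6, h5.symm, h4, eq_comm] <;> grind
      · simp [hab, h5, h6, h1, h2, Ne.symm h1, Ne.symm h2]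
  · subst hab
    simp [eq_comm]
  · have h5 := hab.ne'
    have h6 := hab.not_gt
    by_cases h1 : c = a
    · subst h1; by_cases h4 : d = b <;> simp [hab, h5, h6, h5.symm, h4, eq_comm] <;> grind
    · by_cases h2 : c = b
      · subst h2; by_cases h4 : d = a <;> simp [hab, h5, h6, h5.symm, h4, eq_comm] <;> grind
      · simp [hab, h5, h6, h1, h2, Ne.symm h1, Ne.symm h2]

/-- Conservation of colours: this is the source of all weight bookkeeping for words below. -/
lemma Rmat_conserve {m : ℕ} {q u v : ℂ} {a b c d : Fin m} (hne : Rmat m q u v (a, b) (c, d) ≠ 0) :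
    (c = a ∧ d = b) ∨ (c = b ∧ d = a) := by
  rw [Rmat_apply] at hne
  split_ifs at hne <;> simp_all

section sums
variable {m : ℕ} {q u v : ℂ} {M : Type*} [AddCommGroup M] [Module ℂ M]

lemma sum_Rmat_row (F : Fin m → Fin m → M) (a b : Fin m) :
    ∑ c, ∑ d, Rmat m q u v (a, b) (c, d) • F c d =
      if a = b then f q u v • F a a else F a b + h q u v a b • F b a := by
  simp only [Rmat_apply]
  split_ifs with hab
  · simp [ite_and, ite_smul]
  · have e : ∀ c d, (if c = a ∧ d = b then (1:ℂ) else if c = b ∧ d = a then h q u v a b else 0)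
        • F c d = (if c = a then if d = b then F c d else 0 else 0)
          + (if c = b then if d = a then h q u v a b • F c d else 0 else 0) := by
      intro c d
      split_ifs <;> simp_all
    simp [e, Finset.sum_add_distrib]

lemma sum_Rmat_col (F : Fin m → Fin m → M) (c d : Fin m) :
    ∑ a, ∑ b, Rmat m q u v (a, b) (c, d) • F a b =
      if c = d then f q u v • F c c else F c d + h q u v d c • F d c := by
  have e : ∀ a b, Rmat m q u v (a, b) (c, d) • F a b =
      if c = d then (if a = c then if b = c then f q u v • F a b else 0 else 0)
      else (if a = c then if b = d then F a b else 0 else 0)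
          + (if a = d then if b = c then h q u v a b • F a b else 0 else 0) := by
    intro a b
    rw [Rmat_apply]
    by_cases hab : a = b
    · subst hab
      by_cases h1 : c = a
      · subst h1; by_cases h2 : d = c
        · subst h2; simp
        · simp [h2, Ne.symm h2]
      · by_cases h2 : d = a
        · subst h2; simp [h1, Ne.symm h1]
        · simp [h1, h2, Ne.symm h1, Ne.symm h2]
    · by_cases h1 : c = a
      · subst h1; by_cases h2 : d = b
        · subst h2; simp [hab]
        · by_cases h3 : d = c
          · subst h3; simp [hab, Ne.symm hab]
          · simp [hab, h2, Ne.symm h2, Ne.symm h3]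
      · by_cases h2 : c = b
        · subst h2; by_cases h3 : d = a
          · subst h3; simp [hab, h1]
          · simp [hab, h1, h3, Ne.symm h3]
        · simp [hab, h1, h2, Ne.symm h1, Ne.symm h2]
  simp only [e]
  split_ifs with hcd
  · simp
  · simp [Finset.sum_add_distrib]

end sums

section exchange
variable {m : ℕ} {A : Type*} [Ring A] [Algebra ℂ A]

/-- The `RTT`-relation in components, for matrices over an arbitrary algebra. -/
def Exch (q u v : ℂ) (X Y : Matrix (Fin m) (Fin m) A) : Prop :=
  ∀ a c b d, ∑ a', ∑ c', Rmat m q u v (a, c) (a', c') • (X a' b * Y c' d)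
    = ∑ b', ∑ d', Rmat m q u v (b', d') (b, d) • (Y c d' * X a b')

lemma exch_iff {q u v : ℂ} {X Y : Matrix (Fin m) (Fin m) A} :
    Exch q u v X Y ↔ (Rmat m q u v).map (algebraMap ℂ A) * (X ⊗ₖ 1) * (1 ⊗ₖ Y)
      = (1 ⊗ₖ Y) * (X ⊗ₖ 1) * (Rmat m q u v).map (algebraMap ℂ A) := by
  have e1 : ∀ a c b d, ((Rmat m q u v).map (algebraMap ℂ A) * (X ⊗ₖ 1) * (1 ⊗ₖ Y) :
      Matrix (Fin m × Fin m) (Fin m × Fin m) A) (a, c) (b, d)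
      = ∑ a', ∑ c', Rmat m q u v (a, c) (a', c') • (X a' b * Y c' d) := by
    intro a c b d
    rw [Matrix.mul_assoc, Matrix.mul_apply, Fintype.sum_prod_type]
    refine Finset.sum_congr rfl fun a' _ => Finset.sum_congr rfl fun c' _ => ?_
    rw [Matrix.map_apply, Algebra.smul_def]
    congr 1
    rw [Matrix.mul_apply, Fintype.sum_prod_type, Finset.sum_eq_single b, Finset.sum_eq_single c']
    · simp
    · intro x _ hx; simp [Ne.symm hx]
    · simp
    · intro x _ hx; exact Finset.sum_eq_zero fun y _ => by simp [hx]
    · simp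
  have e2 : ∀ a c b d, ((1 ⊗ₖ Y) * (X ⊗ₖ 1) * (Rmat m q u v).map (algebraMap ℂ A) :
      Matrix (Fin m × Fin m) (Fin m × Fin m) A) (a, c) (b, d)
      = ∑ b', ∑ d', Rmat m q u v (b', d') (b, d) • (Y c d' * X a b') := by
    intro a c b d
    rw [Matrix.mul_apply, Fintype.sum_prod_type]
    refine Finset.sum_congr rfl fun b' _ => Finset.sum_congr rfl fun d' _ => ?_
    rw [Matrix.map_apply, Algebra.smul_def, Algebra.commutes]
    congr 1
    rw [Matrix.mul_apply, Fintype.sum_prod_type, Finset.sum_eq_single a, Finset.sum_eq_single d']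
    · simp
    · intro x _ hx; simp [hx]
    · simp
    · intro x _ hx; exact Finset.sum_eq_zero fun y _ => by simp [Ne.symm hx]
    · simp
  constructor
  · intro hE
    ext ⟨a, c⟩ ⟨b, d⟩
    rw [e1, e2, hE]
  · intro hE a c b d
    rw [← e1, ← e2, hE]

lemma rtt_iff {H : Type u} [AddCommGroup H] [Module ℂ H] {q u v : ℂ} {T : Monodromy m H} :
    RTT q T u v ↔ Exch q u v (T u) (T v) :=
  exch_iff.symm

/-- The usual comultiplication argument: since entries of different factors commute at different
points, `R` can be carried first through `X, Y` and then through `X', Y'`. -/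
lemma Exch.mul {q u v : ℂ} {X Y X' Y' : Matrix (Fin m) (Fin m) A} (h1 : Exch q u v X Y)
    (h2 : Exch q u v X' Y') (hc1 : ∀ a b c d, Commute (X' a b) (Y c d))
    (hc2 : ∀ a b c d, Commute (Y' a b) (X c d)) : Exch q u v (X * X') (Y * Y') := by
  intro a c b d
  have e1 : ∀ a' c', (X * X') a' b * (Y * Y') c' d
      = ∑ l, ∑ n, X a' l * Y c' n * (X' l b * Y' n d) := by
    intro a' c'
    simp only [Matrix.mul_apply, Finset.sum_mul_sum]
    refine Finset.sum_congr rfl fun l _ => Finset.sum_congr rfl fun n _ => ?_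
    rw [mul_assoc, mul_assoc, ← mul_assoc (X' l b), (hc1 l b c' n).eq, mul_assoc]
  have e2 : ∀ b' d', (Y * Y') c d' * (X * X') a b'
      = ∑ n, ∑ l, Y c n * X a l * (Y' n d' * X' l b') := by
    intro b' d'
    simp only [Matrix.mul_apply, Finset.sum_mul_sum]
    refine Finset.sum_congr rfl fun n _ => Finset.sum_congr rfl fun l _ => ?_
    rw [mul_assoc, mul_assoc, ← mul_assoc (Y' n d'), (hc2 n d' a l).eq, mul_assoc]
  calc ∑ a', ∑ c', Rmat m q u v (a, c) (a', c') • ((X * X') a' b * (Y * Y') c' d)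
      = ∑ l, ∑ n, (∑ a', ∑ c', Rmat m q u v (a, c) (a', c') • (X a' l * Y c' n))
          * (X' l b * Y' n d) := by
        simp only [e1, Finset.smul_sum, Finset.sum_mul, smul_mul_assoc]
        rw [Finset.sum_congr rfl fun _ _ => Finset.sum_comm, Finset.sum_comm]
        refine Finset.sum_congr rfl fun l _ => ?_
        rw [Finset.sum_congr rfl fun _ _ => Finset.sum_comm, Finset.sum_comm]
    _ = ∑ l, ∑ n, (∑ b', ∑ d', Rmat m q u v (b', d') (l, n) • (Y c d' * X a b'))
          * (X' l b * Y' n d) := by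
        simp only [h1 a c]
    _ = ∑ b', ∑ d', (Y c d' * X a b') *
          ∑ l, ∑ n, Rmat m q u v (b', d') (l, n) • (X' l b * Y' n d) := by
        simp only [Finset.mul_sum, Finset.sum_mul, smul_mul_assoc, mul_smul_comm]
        rw [Finset.sum_congr rfl fun _ _ => Finset.sum_comm, Finset.sum_comm]
        refine Finset.sum_congr rfl fun l _ => ?_
        rw [Finset.sum_congr rfl fun _ _ => Finset.sum_comm, Finset.sum_comm]
    _ = ∑ b', ∑ d', (Y c d' * X a b') *
          ∑ l, ∑ n, Rmat m q u v (l, n) (b, d) • (Y' d' n * X' b' l) := by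
        simp only [h2 _ _ b d]
    _ = _ := by
        simp only [e2, Finset.mul_sum, Finset.smul_sum, mul_smul_comm]
        rw [Finset.sum_congr rfl fun _ _ => Finset.sum_comm, Finset.sum_comm]
        refine Finset.sum_congr rfl fun l _ => ?_
        rw [Finset.sum_congr rfl fun _ _ => Finset.sum_comm, Finset.sum_comm]
        refine Finset.sum_congr rfl fun n _ => ?_
        rw [Finset.sum_comm]

end exchange

/-! ### The Yang–Baxter equation -/

/-- The `R`-matrix with spectral parameters `u`, `x` as a matrix of operators in `ℂ^m`. -/
def site (m : ℕ) (q u x : ℂ) : Matrix (Fin m) (Fin m) (Matrix (Fin m) (Fin m) ℂ) :=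
  fun a b κ κ' => Rmat m q u x (a, κ) (b, κ')

section
variable {m : ℕ}

/-- The transposed action of `R(u,v)` on functions of two indices. -/
def colAct (q u v : ℂ) (F : Fin m → Fin m → ℂ) (b d : Fin m) : ℂ :=
  if b = d then f q u v * F b d else F b d + h q u v d b * F d b

lemma sum_Rmat_colAct (q u v : ℂ) (F : Fin m → Fin m → ℂ) (b d : Fin m) :
    ∑ a, ∑ c, Rmat m q u v (a, c) (b, d) * F a c = colAct q u v F b d := by
  have := sum_Rmat_col (q := q) (u := u) (v := v) F b d
  simp only [smul_eq_mul] at this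
  rw [this, colAct]
  split_ifs with hbd
  · rw [hbd]
  · rfl

/-- Each operator only permutes the three indices, so for given `b, d, k` both sides involve at most
six values of `F`, and the claim is a rational identity depending only on the relative order of the
indices. -/
lemma colAct_yang_baxter {q u v x : ℂ} (hq : q ≠ 0) (huv : u ≠ v) (hux : u ≠ x) (hvx : v ≠ x)
    (F : Fin m → Fin m → Fin m → ℂ) (b d k : Fin m) :
    colAct q v x (fun c n => colAct q u x (fun a n' => colAct q u v (fun a' c' => F a' c' n') a c)
      b n) d k
    = colAct q u v (fun a c => colAct q u x (fun a' n => colAct q v x (fun c' n' => F a' c' n') c n)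
      a k) b d := by
  have huv' : u - v ≠ 0 := sub_ne_zero.2 huv
  have hux' : u - x ≠ 0 := sub_ne_zero.2 hux
  have hvx' : v - x ≠ 0 := sub_ne_zero.2 hvx
  rcases lt_trichotomy b d with h1 | h1 | h1 <;> rcases lt_trichotomy b k with h2 | h2 | h2 <;>
    rcases lt_trichotomy d k with h3 | h3 | h3 <;> first | (exfalso; omega) | skip
  all_goals try subst h1
  all_goals try subst h2
  all_goals try subst h3
  all_goals simp only [colAct, h, if_true, if_false, lt_irrefl, *]
  all_goals try simp only [h1.ne, h1.ne', h1.not_gt, if_false]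
  all_goals try simp only [h2.ne, h2.ne', h2.not_gt, if_false]
  all_goals try simp only [h3.ne, h3.ne', h3.not_gt, if_false]
  all_goals simp only [f, g]
  all_goals field_simp
  all_goals ring

lemma yang_baxter {q u v x : ℂ} (hq : q ≠ 0) (huv : u ≠ v) (hux : u ≠ x) (hvx : v ≠ x) :
    Exch q u v (site m q u x) (site m q v x) := by
  intro a c b d
  ext k k'
  have e1 : ∀ (y z : ℂ) (P : Prop) [Decidable P] (p n p' n' : Fin m),
      colAct q y z (fun i j => if (i = p ∧ j = n) ∧ P then 1 else 0) p' n'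
        = if P then Rmat m q y z (p, n) (p', n') else 0 := by
    intro y z P _ p n p' n'
    rw [← sum_Rmat_colAct, Finset.sum_eq_single p, Finset.sum_eq_single n] <;> simp +contextual
  have e2 : ∀ (y z : ℂ) (X : Fin m → ℂ) (p n : Fin m),
      colAct q y z (fun i j => if j = k then X i else 0) p n
        = ∑ i, Rmat m q y z (i, k) (p, n) * X i := by
    intro y z X p n
    rw [← sum_Rmat_colAct]
    exact Finset.sum_congr rfl fun i _ => by simp
  have e3 : ∀ (y z : ℂ) (X : Fin m → ℂ) (p n : Fin m),
      colAct q y z (fun i j => if i = a then X j else 0) p n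
        = ∑ j, Rmat m q y z (a, j) (p, n) * X j := by
    intro y z X p n
    rw [← sum_Rmat_colAct, Finset.sum_eq_single a] <;> simp +contextual
  -- Testing on the delta function at `(a, c, k)` extracts a single matrix entry.
  have key := colAct_yang_baxter hq huv hux hvx
    (fun a' c' n' => if (a' = a ∧ c' = c) ∧ n' = k then 1 else 0) b d k'
  have e4 : ∀ a' c' n' : Fin m, ((a' = a ∧ c' = c) ∧ n' = k) ↔ ((c' = c ∧ n' = k) ∧ a' = a) := by
    intros; tauto
  simp only [e1, e2] at key
  simp only [e4, e1, e3, ← sum_Rmat_colAct] at key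
  simp only [Matrix.sum_apply, Matrix.smul_apply, Matrix.mul_apply, site, smul_eq_mul]
  simp only [Finset.mul_sum] at key ⊢
  rw [Finset.sum_comm]
  convert key using 1
  · refine Finset.sum_congr rfl fun c' _ => ?_
    rw [Finset.sum_comm]
    exact Finset.sum_congr rfl fun n _ => Finset.sum_congr rfl fun a' _ => by ring
  · exact Finset.sum_congr rfl fun c' _ => Finset.sum_congr rfl fun n _ =>
      Finset.sum_congr rfl fun a' _ => by ring
end

/-! ### The RTT-relation for nested monodromy matrices -/

section tensor
variable {ι : Type} [Fintype ι] {H : Type u} [AddCommGroup H] [Module ℂ H]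

lemma tensorOp_apply (X : Module.End ℂ H) (A : Matrix ι ι ℂ) (ψ : ι → H) (κ : ι) :
    tensorOp X A ψ κ = ∑ κ', A κ κ' • X (ψ κ') := by
  simp [tensorOp]

lemma tensorOp_mul (X Y : Module.End ℂ H) (A B : Matrix ι ι ℂ) :
    tensorOp X A * tensorOp Y B = tensorOp (X * Y) (A * B) := by
  ext1 ψ
  funext κ
  simp only [Module.End.mul_apply, tensorOp_apply, map_sum, map_smul, Matrix.mul_apply,
    Finset.smul_sum, Finset.sum_smul, smul_smul]
  exact Finset.sum_comm

variable [DecidableEq ι]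

/-- The operators `X ⊗ 1`. -/
def tensorLeft (ι : Type) [Fintype ι] [DecidableEq ι] (H : Type u) [AddCommGroup H] [Module ℂ H] :
    Module.End ℂ H →ₐ[ℂ] Module.End ℂ (ι → H) :=
  AlgHom.ofLinearMap
    { toFun := fun X => tensorOp X (1 : Matrix ι ι ℂ)
      map_add' := fun X Y => by
        refine LinearMap.ext fun ψ => funext fun κ => ?_
        simp [tensorOp_apply, Finset.sum_add_distrib]
      map_smul' := fun c X => by
        refine LinearMap.ext fun ψ => funext fun κ => ?_
        simp [tensorOp_apply, Finset.smul_sum, smul_comm c] }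
    (by refine LinearMap.ext fun ψ => funext fun κ => ?_; simp [tensorOp_apply, Matrix.one_apply])
    (fun X Y => by simp [tensorOp_mul])

/-- The operators `1 ⊗ A`. -/
def tensorRight (ι : Type) [Fintype ι] [DecidableEq ι] (H : Type u) [AddCommGroup H] [Module ℂ H] :
    Matrix ι ι ℂ →ₐ[ℂ] Module.End ℂ (ι → H) :=
  AlgHom.ofLinearMap
    { toFun := fun A => tensorOp (1 : Module.End ℂ H) A
      map_add' := fun X Y => by
        refine LinearMap.ext fun ψ => funext fun κ => ?_
        simp [tensorOp_apply, Finset.sum_add_distrib, add_smul]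
      map_smul' := fun c X => by
        refine LinearMap.ext fun ψ => funext fun κ => ?_
        simp [tensorOp_apply, Finset.smul_sum, smul_smul] }
    (by refine LinearMap.ext fun ψ => funext fun κ => ?_; simp [tensorOp_apply, Matrix.one_apply])
    (fun X Y => by simp [tensorOp_mul])

lemma tensorLeft_mul_tensorRight (X : Module.End ℂ H) (A : Matrix ι ι ℂ) :
    tensorLeft ι H X * tensorRight ι H A = tensorOp X A := by
  change tensorOp X 1 * tensorOp 1 A = _
  rw [tensorOp_mul, mul_one, one_mul]

lemma tensorRight_commute (X : Module.End ℂ H) (A : Matrix ι ι ℂ) :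
    Commute (tensorRight ι H A) (tensorLeft ι H X) := by
  change tensorOp 1 A * tensorOp X 1 = tensorOp X 1 * tensorOp 1 A
  rw [tensorOp_mul, tensorOp_mul, mul_one, one_mul, mul_one, one_mul]

end tensor

lemma Exch.map {m : ℕ} {A B : Type*} [Ring A] [Algebra ℂ A] [Ring B] [Algebra ℂ B] (φ : A →ₐ[ℂ] B)
    {q u v : ℂ} {X Y : Matrix (Fin m) (Fin m) A} (hE : Exch q u v X Y) :
    Exch q u v (X.map φ) (Y.map φ) := by
  intro a c b d
  have := congrArg φ (hE a c b d)
  simpa only [map_sum, map_smul, map_mul, Matrix.map_apply] using this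

section addSite
variable {n : ℕ} {H : Type u} [AddCommGroup H] [Module ℂ H]

/-- The monodromy matrix `T(u) R_{01}(u,x)` in `H ⊗ ℂ^n`. -/
def addSite (q : ℂ) (T : Monodromy n H) (x : ℂ) : Monodromy n (Fin n → H) :=
  fun u i j => ∑ l, tensorOp (T u i l) (site n q u x l j)

lemma addSite_apply (q : ℂ) (T : Monodromy n H) (x u : ℂ) (i j : Fin n) (ψ : Fin n → H)
    (α : Fin n) :
    addSite q T x u i j ψ α = ∑ l, ∑ β, Rmat n q u x (l, α) (j, β) • T u i l (ψ β) := by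
  simp [addSite, tensorOp_apply, site]

lemma rtt_addSite {q : ℂ} (hq : q ≠ 0) {T : Monodromy n H} {x u v : ℂ} (hT : RTT q T u v)
    (huv : u ≠ v) (hux : u ≠ x) (hvx : v ≠ x) : RTT q (addSite q T x) u v := by
  rw [rtt_iff] at hT ⊢
  have e : ∀ u, addSite q T x u = (T u).map (tensorLeft (Fin n) H) *
      (site n q u x).map (tensorRight (Fin n) H) := by
    intro u
    ext1 i j
    simp [addSite, Matrix.mul_apply, tensorLeft_mul_tensorRight]
  rw [e, e]
  exact (hT.map _).mul ((yang_baxter hq huv hux hvx).map _)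
    (fun _ _ _ _ => tensorRight_commute _ _) (fun _ _ _ _ => tensorRight_commute _ _)

lemma rtt_of_equiv {m : ℕ} {H' : Type*} [AddCommGroup H'] [Module ℂ H'] (e : H' ≃ₗ[ℂ] H)
    {q : ℂ} {T : Monodromy m H} {T' : Monodromy m H'} {u v : ℂ} (hT : RTT q T u v)
    (he : ∀ w i j ψ, e (T' w i j ψ) = T w i j (e ψ)) : RTT q T' u v := by
  rw [rtt_iff] at hT ⊢
  have e1 : ∀ w, T' w = (T w).map (e.symm.conjAlgEquiv ℂ).toAlgHom := by
    intro w
    ext i j ψ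
    apply e.injective
    simp [he, LinearEquiv.conjAlgEquiv]
  rw [e1, e1]
  exact hT.map _

end addSite

section inhom
variable {n : ℕ}

lemma sum_fin_cons {M : Type*} [AddCommMonoid M] {r : ℕ} (F : (Fin (r + 1) → Fin n) → M) :
    ∑ κ, F κ = ∑ α, ∑ κ, F (Fin.cons α κ) := by
  rw [← (Fin.consEquiv fun _ => Fin n).sum_comp, Fintype.sum_prod_type]
  rfl

/-- Operators in `ℂ^n ⊗ (ℂ^n)^{⊗ r}`, acting trivially in an additional first factor. -/
def liftSites (n r : ℕ) :
    Matrix (Fin n) (Fin n) (Matrix (Fin r → Fin n) (Fin r → Fin n) ℂ) →*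
    Matrix (Fin n) (Fin n) (Matrix (Fin (r + 1) → Fin n) (Fin (r + 1) → Fin n) ℂ) where
  toFun A := Matrix.of fun a b => Matrix.of fun κ κ' =>
    if κ 0 = κ' 0 then A a b (Fin.tail κ) (Fin.tail κ') else 0
  map_one' := by
    ext a b κ κ'
    by_cases hab : a = b
    · subst hab
      rw [Matrix.of_apply, Matrix.of_apply, Matrix.one_apply_eq, Matrix.one_apply_eq,
        Matrix.one_apply, Matrix.one_apply]
      have : κ = κ' ↔ κ 0 = κ' 0 ∧ Fin.tail κ = Fin.tail κ' := by
        conv_lhs => rw [← Fin.cons_self_tail κ, ← Fin.cons_self_tail κ', Fin.cons_inj]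
      split_ifs <;> simp_all
    · simp [Matrix.one_apply_ne hab]
  map_mul' A B := by
    ext a b κ κ'
    simp only [Matrix.mul_apply, Matrix.sum_apply, Matrix.of_apply]
    have : ∀ l, ∑ x : Fin (r + 1) → Fin n,
        (if κ 0 = x 0 then A a l (Fin.tail κ) (Fin.tail x) else 0) *
          (if x 0 = κ' 0 then B l b (Fin.tail x) (Fin.tail κ') else 0)
        = if κ 0 = κ' 0 then ∑ x, A a l (Fin.tail κ) x * B l b x (Fin.tail κ') else 0 := by
      intro l
      rw [sum_fin_cons,
        Finset.sum_eq_single (κ 0)]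
      · simp only [Fin.cons_zero, Fin.tail_cons, if_true]
        split_ifs <;> simp
      · intro y _ hy
        refine Finset.sum_eq_zero fun z _ => ?_
        simp [Ne.symm hy]
      · simp
    simp only [this]
    split_ifs <;> simp

lemma liftSites_apply {r : ℕ}
    (A : Matrix (Fin n) (Fin n) (Matrix (Fin r → Fin n) (Fin r → Fin n) ℂ)) (a b : Fin n)
    (κ κ' : Fin (r + 1) → Fin n) : liftSites n r A a b κ κ' =
      if κ 0 = κ' 0 then A a b (Fin.tail κ) (Fin.tail κ') else 0 := rfl

lemma siteR_succ {r : ℕ} (q u x : ℂ) (j : Fin r) :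
    siteR n (r + 1) q u x j.succ = liftSites n r (siteR n r q u x j) := by
  ext a b κ κ'
  simp only [siteR, liftSites_apply, Fin.tail]
  have : (∀ i, i ≠ j.succ → κ i = κ' i) ↔
      κ 0 = κ' 0 ∧ ∀ i : Fin r, i ≠ j → κ i.succ = κ' i.succ := by
    rw [Fin.forall_fin_succ]
    simp [Fin.succ_ne_zero, eq_comm]
  simp only [this, ite_and]
  congr

lemma inhomogeneous_succ {r : ℕ} (q : ℂ) (x : Fin (r + 1) → ℂ) (u : ℂ) :
    inhomogeneous n q x u
      = liftSites n r (inhomogeneous n q (Fin.tail x) u) * siteR n (r + 1) q u (x 0) 0 := by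
  simp only [inhomogeneous, List.ofFn_succ, List.reverse_cons, List.prod_append, List.prod_cons,
    List.prod_nil, mul_one, map_list_prod, List.map_reverse, List.map_ofFn]
  congr 4
  funext j
  simp [siteR_succ, Fin.tail]

/-- Recursion in the first site, on which the later inductions over the number of sites rest. -/
lemma inhomogeneous_cons {r : ℕ} (q : ℂ) (x : Fin (r + 1) → ℂ) (u : ℂ) (a b α β : Fin n)
    (κ κ' : Fin r → Fin n) :
    inhomogeneous n q x u a b (Fin.cons α κ) (Fin.cons β κ')
      = ∑ l, Rmat n q u (x 0) (l, α) (b, β) * inhomogeneous n q (Fin.tail x) u a l κ κ' := by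
  rw [inhomogeneous_succ, Matrix.mul_apply, Matrix.sum_apply]
  refine Finset.sum_congr rfl fun l _ => ?_
  rw [Matrix.mul_apply, sum_fin_cons,
    Finset.sum_eq_single α, Finset.sum_eq_single κ']
  · simp [liftSites_apply, siteR, Fin.forall_fin_succ, mul_comm]
  · intro y _ hy
    have : ¬ ∀ i : Fin r, y i = κ' i := fun hh => hy (funext hh)
    simp [liftSites_apply, siteR, Fin.forall_fin_succ, this]
  · simp
  · intro y _ hy
    refine Finset.sum_eq_zero fun z _ => ?_
    simp [liftSites_apply, Ne.symm hy]
  · simp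

lemma inhomogeneous_zero (q : ℂ) (x : Fin 0 → ℂ) (u : ℂ) : inhomogeneous n q x u = 1 := by
  simp [inhomogeneous]

variable {H : Type u} [AddCommGroup H] [Module ℂ H]

lemma nested_apply {r : ℕ} (q : ℂ) (T : Monodromy (n + 1) H) (x : Fin r → ℂ) (u : ℂ) (i j : Fin n)
    (ψ : (Fin r → Fin n) → H) (κ : Fin r → Fin n) :
    nestedMonodromy q T x u i j ψ κ
      = ∑ l, ∑ κ', inhomogeneous n q x u l j κ κ' • T u i.succ l.succ (ψ κ') := by
  simp [nestedMonodromy, tensorOp_apply]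

lemma nested_zero (q : ℂ) (T : Monodromy (n + 1) H) (x : Fin 0 → ℂ) (u : ℂ) (i j : Fin n)
    (ψ : (Fin 0 → Fin n) → H) (κ : Fin 0 → Fin n) :
    nestedMonodromy q T x u i j ψ κ = T u i.succ j.succ (ψ κ) := by
  rw [nested_apply, inhomogeneous_zero, Finset.sum_eq_single j]
  · rw [Matrix.one_apply_eq, Fintype.sum_unique, Subsingleton.elim κ default,
      Matrix.one_apply_eq, one_smul]
  · intro l _ hl; simp [hl]
  · simp

lemma nested_cons {r : ℕ} (q : ℂ) (T : Monodromy (n + 1) H) (x : Fin (r + 1) → ℂ) (u : ℂ)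
    (i j : Fin n) (ψ : (Fin (r + 1) → Fin n) → H) (α : Fin n) (κ : Fin r → Fin n) :
    nestedMonodromy q T x u i j ψ (Fin.cons α κ)
      = ∑ l, ∑ β, Rmat n q u (x 0) (l, α) (j, β) •
          nestedMonodromy q T (Fin.tail x) u i l (fun κ' => ψ (Fin.cons β κ')) κ := by
  simp only [nested_apply]
  have : ∀ l, ∑ κ', inhomogeneous n q x u l j (Fin.cons α κ) κ' • T u i.succ l.succ (ψ κ')
      = ∑ β, ∑ κ', ∑ l', (Rmat n q u (x 0) (l', α) (j, β) *
          inhomogeneous n q (Fin.tail x) u l l' κ κ') • T u i.succ l.succ (ψ (Fin.cons β κ')) := by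
    intro l
    rw [sum_fin_cons]
    refine Finset.sum_congr rfl fun β _ => Finset.sum_congr rfl fun κ' _ => ?_
    simp only [inhomogeneous_cons, Finset.sum_smul]
  simp only [this, Finset.smul_sum, smul_smul]
  calc _ = ∑ l, ∑ β, ∑ l', ∑ κ', (Rmat n q u (x 0) (l', α) (j, β) *
          inhomogeneous n q (Fin.tail x) u l l' κ κ') • T u i.succ l.succ (ψ (Fin.cons β κ')) :=
        Finset.sum_congr rfl fun l _ => Finset.sum_congr rfl fun β _ => Finset.sum_comm
    _ = ∑ l, ∑ l', ∑ β, ∑ κ', (Rmat n q u (x 0) (l', α) (j, β) *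
          inhomogeneous n q (Fin.tail x) u l l' κ κ') • T u i.succ l.succ (ψ (Fin.cons β κ')) :=
        Finset.sum_congr rfl fun l _ => Finset.sum_comm
    _ = ∑ l', ∑ l, ∑ β, ∑ κ', (Rmat n q u (x 0) (l', α) (j, β) *
          inhomogeneous n q (Fin.tail x) u l l' κ κ') • T u i.succ l.succ (ψ (Fin.cons β κ')) :=
        Finset.sum_comm
    _ = _ := Finset.sum_congr rfl fun l' _ => Finset.sum_comm

/-- `H ⊗ (ℂ^n)^{⊗ (r+1)} = (H ⊗ (ℂ^n)^{⊗ r}) ⊗ ℂ^n`, the last factor being the first site. -/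
def consCurry (n r : ℕ) (H : Type u) [AddCommGroup H] [Module ℂ H] :
    ((Fin (r + 1) → Fin n) → H) ≃ₗ[ℂ] (Fin n → (Fin r → Fin n) → H) where
  toFun ψ α κ := ψ (Fin.cons α κ)
  invFun φ κ := φ (κ 0) (Fin.tail κ)
  map_add' _ _ := rfl
  map_smul' _ _ := rfl
  left_inv ψ := by funext κ; simp
  right_inv φ := by funext α κ; simp

lemma consCurry_nested {r : ℕ} (q : ℂ) (T : Monodromy (n + 1) H) (x : Fin (r + 1) → ℂ) (u : ℂ)
    (i j : Fin n) (ψ : (Fin (r + 1) → Fin n) → H) :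
    consCurry n r H (nestedMonodromy q T x u i j ψ)
      = addSite q (nestedMonodromy q T (Fin.tail x)) (x 0) u i j (consCurry n r H ψ) := by
  funext α κ
  rw [addSite_apply]
  simp only [Finset.sum_apply, Pi.smul_apply]
  exact nested_cons q T x u i j ψ α κ

end inhom

lemma h_succ {n : ℕ} (q u v : ℂ) (a b : Fin n) : h q u v a.succ b.succ = h q u v a b := by
  simp [h]

/-- As `R` only permutes colours, its restriction to indices `≥ 2` closes on itself and is the
`R`-matrix of smaller size. -/
lemma Exch.block {n : ℕ} {A : Type*} [Ring A] [Algebra ℂ A] {q u v : ℂ}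
    {X Y : Matrix (Fin (n + 1)) (Fin (n + 1)) A} (hE : Exch q u v X Y) :
    Exch q u v (fun a b => X a.succ b.succ : Matrix (Fin n) (Fin n) A)
      (fun a b => Y a.succ b.succ) := by
  intro a c b d
  have := hE a.succ c.succ b.succ d.succ
  rw [sum_Rmat_row (fun a' c' => X a' b.succ * Y c' d.succ),
    sum_Rmat_col (fun b' d' => Y c.succ d' * X a.succ b')] at this
  rw [sum_Rmat_row (fun a' c' : Fin n => X a'.succ b.succ * Y c'.succ d.succ),
    sum_Rmat_col (fun b' d' : Fin n => Y c.succ d'.succ * X a.succ b'.succ)]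
  simpa only [h_succ, Fin.succ_inj] using this

section nested
variable {n : ℕ} {H : Type u} [AddCommGroup H] [Module ℂ H]

lemma rtt_nested {q : ℂ} (hq : q ≠ 0) {T : Monodromy (n + 1) H} {u v : ℂ} (hT : RTT q T u v)
    (huv : u ≠ v) : ∀ {r : ℕ} {x : Fin r → ℂ}, (∀ j, u ≠ x j) → (∀ j, v ≠ x j) →
    RTT q (nestedMonodromy q T x) u v
  | 0, x, _, _ => by
    have hB : RTT q (fun w a b => T w (Fin.succ a) (Fin.succ b) : Monodromy n H) u v :=
      rtt_iff.2 (rtt_iff.1 hT).block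
    refine rtt_of_equiv (LinearEquiv.funUnique (Fin 0 → Fin n) ℂ H) hB fun w i j ψ => ?_
    simp [nested_zero]
  | r + 1, x, hu, hv =>
    rtt_of_equiv (consCurry n r H)
      (rtt_addSite hq (rtt_nested hq hT huv (x := Fin.tail x) (fun j => hu j.succ)
        fun j => hv j.succ) huv (hu 0) (hv 0))
      fun w i j ψ => consCurry_nested q T x w i j ψ

lemma list_prod_intertwine {H' : Type*} [AddCommGroup H'] [Module ℂ H'] (φ : H →ₗ[ℂ] H') :
    ∀ {r : ℕ} (A : Fin r → Module.End ℂ H) (B : Fin r → Module.End ℂ H'),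
      (∀ j ψ, φ (A j ψ) = B j (φ ψ)) → ∀ ψ,
      φ ((List.ofFn A).prod ψ) = (List.ofFn B).prod (φ ψ)
  | 0, A, B, _, ψ => by simp
  | r + 1, A, B, hAB, ψ => by
    simp only [List.ofFn_succ, List.prod_cons, Module.End.mul_apply]
    rw [hAB, list_prod_intertwine φ _ _ fun j => hAB j.succ]

/-- The contraction `∑_κ T_{ρ_1,κ_1}(x_1) ⋯ T_{ρ_r,κ_r}(x_r) ψ_κ`. -/
def contr {r : ℕ} (T : Monodromy (n + 1) H) (x : Fin r → ℂ) (ρ : Fin r → Fin (n + 1)) :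
    ((Fin r → Fin n) → H) →ₗ[ℂ] H :=
  ∑ κ : Fin r → Fin n, (List.ofFn fun j => T (x j) (ρ j) (κ j).succ).prod ∘ₗ LinearMap.proj κ

lemma contr_apply {r : ℕ} (T : Monodromy (n + 1) H) (x : Fin r → ℂ) (ρ : Fin r → Fin (n + 1))
    (ψ : (Fin r → Fin n) → H) : contr T x ρ ψ =
      ∑ κ : Fin r → Fin n, (List.ofFn fun j => T (x j) (ρ j) (κ j).succ).prod (ψ κ) := by
  simp [contr]

lemma contr_succ {r : ℕ} (T : Monodromy (n + 1) H) (x : Fin (r + 1) → ℂ)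
    (ρ : Fin (r + 1) → Fin (n + 1)) (ψ : (Fin (r + 1) → Fin n) → H) : contr T x ρ ψ =
      ∑ α, T (x 0) (ρ 0) (Fin.succ α)
        (contr T (Fin.tail x) (Fin.tail ρ) fun κ => ψ (Fin.cons α κ)) := by
  simp only [contr_apply, sum_fin_cons, map_sum]
  refine Finset.sum_congr rfl fun α _ => Finset.sum_congr rfl fun κ _ => ?_
  simp only [List.ofFn_succ, List.prod_cons, Module.End.mul_apply, Fin.cons_zero, Fin.cons_succ]
  rfl

end nested

/-- The vector `v ⊗ e_1 ⊗ ⋯ ⊗ e_1`. -/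
def vacTensor {N : ℕ} (r : ℕ) {H : Type*} [AddCommGroup H] [Module ℂ H] :
    H →ₗ[ℂ] ((Fin r → Fin (N + 1)) → H) where
  toFun v κ := if κ = 0 then v else 0
  map_add' v w := by funext κ; simp only [Pi.add_apply]; split_ifs <;> simp
  map_smul' c v := by funext κ; simp only [Pi.smul_apply, RingHom.id_apply]; split_ifs <;> simp

lemma vacTensor_apply {N r : ℕ} {H : Type*} [AddCommGroup H] [Module ℂ H] (v : H)
    (κ : Fin r → Fin (N + 1)) : vacTensor r v κ = if κ = 0 then v else 0 := rfl

lemma vacTensor_cons {N r : ℕ} {H : Type*} [AddCommGroup H] [Module ℂ H] (v : H)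
    (α : Fin (N + 1)) : (fun κ => vacTensor (r + 1) v (Fin.cons α κ)) =
      if α = 0 then vacTensor r v else 0 := by
  funext κ
  have : (Fin.cons α κ : Fin (r + 1) → Fin (N + 1)) = 0 ↔ α = 0 ∧ κ = 0 := by
    constructor
    · intro h0
      exact ⟨by simpa using congrFun h0 0, funext fun i => by simpa using congrFun h0 i.succ⟩
    · rintro ⟨rfl, rfl⟩
      funext i
      exact Fin.cases rfl (fun _ => rfl) i
  rw [vacTensor_apply]
  simp only [this]
  by_cases h1 : α = 0 <;> simp [vacTensor_apply, h1]

section preBethe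

lemma preBethe_succ {N : ℕ} {H : Type u} [AddCommGroup H] [Module ℂ H] (q : ℂ)
    (T : Monodromy (N + 2) H) {r : Fin (N + 1) → ℕ} (t : Params r) (v : H) :
    preBethe q (N + 1) T t v = contr T (t 0) 0
      (preBethe q N (nestedMonodromy q T (t 0)) (r := fun k => r k.succ) (fun k => t k.succ)
        (vacTensor (r 0) v)) := by
  rw [contr_apply]
  rfl

/-- Naturality of the construction. It is applied to scalars, to intertwiners of inhomogeneities,
and to the evaluation map into the bidual. -/
lemma preBethe_map {q : ℂ} : ∀ {N : ℕ} {H H' : Type u} [AddCommGroup H] [Module ℂ H]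
    [AddCommGroup H'] [Module ℂ H'] (φ : H →ₗ[ℂ] H') {T : Monodromy (N + 1) H}
    {T' : Monodromy (N + 1) H'} {r : Fin N → ℕ} (t : Params r),
    (∀ k j a b ψ, φ (T (t k j) a b ψ) = T' (t k j) a b (φ ψ)) → ∀ v,
    φ (preBethe q N T t v) = preBethe q N T' t (φ v)
  | 0, _, _, _, _, _, _, _, _, _, _, _, _, _ => rfl
  | N + 1, H, H', _, _, _, _, φ, T, T', r, t, hφ, v => by
    let φ' : ((Fin (r 0) → Fin (N + 1)) → H) →ₗ[ℂ] ((Fin (r 0) → Fin (N + 1)) → H') :=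
      LinearMap.pi fun κ => φ ∘ₗ LinearMap.proj κ
    have ih := preBethe_map (q := q) φ' (T := nestedMonodromy q T (t 0))
      (T' := nestedMonodromy q T' (t 0)) (r := fun k => r k.succ) (fun k => t k.succ)
      (fun k j a b ψ => by
        funext κ
        simp only [φ', LinearMap.pi_apply, LinearMap.comp_apply, LinearMap.proj_apply, nested_apply,
          map_sum, map_smul, hφ]) (vacTensor (r 0) v)
    have hv : φ' (vacTensor (r 0) v) = vacTensor (r 0) (φ v) := by
      funext κ
      simp only [φ', LinearMap.pi_apply, LinearMap.comp_apply, LinearMap.proj_apply,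
        vacTensor_apply]
      split_ifs <;> simp
    rw [hv] at ih
    rw [preBethe_succ, preBethe_succ, ← ih, contr_apply, contr_apply, map_sum]
    refine Finset.sum_congr rfl fun κ _ => ?_
    exact list_prod_intertwine φ _ _ (fun j ψ => hφ 0 j _ _ ψ) _

lemma preBethe_smul {q : ℂ} {N : ℕ} {H : Type u} [AddCommGroup H] [Module ℂ H]
    (T : Monodromy (N + 1) H) {r : Fin N → ℕ} (t : Params r) (c : ℂ) (v : H) :
    preBethe q N T t (c • v) = c • preBethe q N T t v :=
  (preBethe_map (c • LinearMap.id) t (fun k j a b ψ => by simp) v).symm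

end preBethe

lemma sum_comm_two_three {α β γ δ ε M : Type*} [Fintype α] [Fintype β] [Fintype γ] [Fintype δ]
    [Fintype ε] [AddCommMonoid M] (F : α → β → γ → δ → ε → M) :
    ∑ a, ∑ b, ∑ c, ∑ d, ∑ e, F a b c d e = ∑ c, ∑ d, ∑ e, ∑ a, ∑ b, F a b c d e := by
  have := Finset.sum_comm (s := (Finset.univ : Finset (α × β)))
    (t := (Finset.univ : Finset (γ × δ × ε))) (f := fun p s => F p.1 p.2 s.1 s.2.1 s.2.2)
  simpa only [Fintype.sum_prod_type] using this

/-! ### Symmetry of Bethe vectors in the parameters of each colour -/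

section swap
variable {n : ℕ} {H : Type u} [AddCommGroup H] [Module ℂ H]

lemma yang_baxter_apply {q w y z : ℂ} (hq : q ≠ 0) (hwy : w ≠ y) (hwz : w ≠ z) (hyz : y ≠ z)
    (a b c j β β' : Fin n) :
    ∑ γ, ∑ γ', Rmat n q y z (b, a) (γ, γ') *
      ∑ l, Rmat n q w z (c, γ') (l, β') * Rmat n q w y (l, γ) (j, β)
    = ∑ γ, ∑ γ', Rmat n q y z (γ', γ) (β, β') *
      ∑ l, Rmat n q w y (c, b) (l, γ') * Rmat n q w z (l, a) (j, γ) := by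
  have key := congrFun (congrFun (yang_baxter hq hwy hwz hyz c b j β) a) β'
  simp only [Matrix.sum_apply, Matrix.smul_apply, Matrix.mul_apply, site, smul_eq_mul,
    Finset.mul_sum] at key
  simp only [Finset.mul_sum]
  symm
  calc _ = ∑ l, ∑ γ', ∑ γ, Rmat n q w y (c, b) (l, γ') *
          (Rmat n q w z (l, a) (j, γ) * Rmat n q y z (γ', γ) (β, β')) := by
        rw [Finset.sum_comm, Finset.sum_congr rfl fun _ _ => Finset.sum_comm, Finset.sum_comm]
        exact Finset.sum_congr rfl fun _ _ => Finset.sum_congr rfl fun _ _ =>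
          Finset.sum_congr rfl fun _ _ => by ring
    _ = _ := key
    _ = _ := by
        rw [Finset.sum_comm, Finset.sum_congr rfl fun _ _ => Finset.sum_comm]
        exact Finset.sum_congr rfl fun _ _ => Finset.sum_congr rfl fun _ _ =>
          Finset.sum_congr rfl fun _ _ => by ring

/-- The intertwiner exchanging the inhomogeneities `x_1 = y`, `x_2 = z` of the first two sites. -/
def swapFirst (q y z : ℂ) (r : ℕ) :
    ((Fin (r + 2) → Fin n) → H) →ₗ[ℂ] ((Fin (r + 2) → Fin n) → H) :=
  LinearMap.pi fun κ => ∑ β, ∑ β', Rmat n q y z (κ 1, κ 0) (β, β') •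
    LinearMap.proj (Fin.cons β (Fin.cons β' (Fin.tail (Fin.tail κ))))

lemma swapFirst_cons (q y z : ℂ) (r : ℕ) (ψ : (Fin (r + 2) → Fin n) → H) (a b : Fin n)
    (κ : Fin r → Fin n) : swapFirst q y z r ψ (Fin.cons a (Fin.cons b κ)) =
      ∑ β, ∑ β', Rmat n q y z (b, a) (β, β') • ψ (Fin.cons β (Fin.cons β' κ)) := by
  simp only [swapFirst, LinearMap.pi_apply, LinearMap.sum_apply, LinearMap.smul_apply,
    LinearMap.proj_apply, Fin.tail_cons, Fin.cons_zero]
  rfl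

lemma nested_cons_cons {r : ℕ} (q : ℂ) (T : Monodromy (n + 1) H) (y z : ℂ) (x : Fin r → ℂ) (w : ℂ)
    (i j : Fin n) (ψ : (Fin (r + 2) → Fin n) → H) (a b : Fin n) (κ : Fin r → Fin n) :
    nestedMonodromy q T (Fin.cons y (Fin.cons z x) : Fin (r + 2) → ℂ) w i j ψ
      (Fin.cons a (Fin.cons b κ)) =
      ∑ c, ∑ β, ∑ β', (∑ l, Rmat n q w z (c, b) (l, β') * Rmat n q w y (l, a) (j, β)) •
        nestedMonodromy q T x w i c (fun κ' => ψ (Fin.cons β (Fin.cons β' κ'))) κ := by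
  simp only [nested_cons, Fin.tail_cons, Fin.cons_zero, Finset.smul_sum, Finset.sum_smul, smul_smul]
  rw [Finset.sum_comm, Finset.sum_congr rfl fun _ _ => Finset.sum_comm, Finset.sum_comm]
  refine Finset.sum_congr rfl fun c _ => Finset.sum_congr rfl fun β _ => ?_
  rw [Finset.sum_comm]
  exact Finset.sum_congr rfl fun β' _ => Finset.sum_congr rfl fun l _ => by rw [mul_comm]

/-- On the first two sites this is the Yang–Baxter equation with spectral parameters `w, y, z`; the
remaining sites and `H` are spectators. -/
lemma swapFirst_nested {r : ℕ} {q : ℂ} (hq : q ≠ 0) (T : Monodromy (n + 1) H) {y z w : ℂ}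
    (hwy : w ≠ y) (hwz : w ≠ z) (hyz : y ≠ z) (x : Fin r → ℂ) (i j : Fin n)
    (ψ : (Fin (r + 2) → Fin n) → H) :
    swapFirst q y z r (nestedMonodromy q T (Fin.cons y (Fin.cons z x) : Fin (r + 2) → ℂ) w i j ψ)
    = nestedMonodromy q T (Fin.cons z (Fin.cons y x) : Fin (r + 2) → ℂ) w i j
        (swapFirst q y z r ψ) := by
  funext κ
  obtain ⟨a, κ, rfl⟩ : ∃ a κ', κ = Fin.cons a κ' := ⟨κ 0, Fin.tail κ, (Fin.cons_self_tail κ).symm⟩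
  obtain ⟨b, κ, rfl⟩ : ∃ a κ', κ = Fin.cons a κ' := ⟨κ 0, Fin.tail κ, (Fin.cons_self_tail κ).symm⟩
  rw [swapFirst_cons, nested_cons_cons]
  simp only [nested_cons_cons, swapFirst_cons]
  have e : ∀ c γ γ', nestedMonodromy q T x w i c (fun κ' => ∑ β, ∑ β',
        Rmat n q y z (γ', γ) (β, β') • ψ (Fin.cons β (Fin.cons β' κ'))) κ
      = ∑ β, ∑ β', Rmat n q y z (γ', γ) (β, β') •
        nestedMonodromy q T x w i c (fun κ' => ψ (Fin.cons β (Fin.cons β' κ'))) κ := by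
    intro c γ γ'
    have : (fun κ' => ∑ β, ∑ β', Rmat n q y z (γ', γ) (β, β') • ψ (Fin.cons β (Fin.cons β' κ')))
      = ∑ β, ∑ β', Rmat n q y z (γ', γ) (β, β') •
        fun κ' => ψ (Fin.cons β (Fin.cons β' κ') : Fin (r + 2) → Fin n) := by
      funext κ'
      simp
    rw [this]
    simp
  simp only [e, Finset.smul_sum, smul_smul]
  rw [sum_comm_two_three]
  refine Finset.sum_congr rfl fun c _ => ?_
  calc _ = ∑ β, ∑ β', (∑ γ, ∑ γ', Rmat n q y z (b, a) (γ, γ') *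
      ∑ l, Rmat n q w z (c, γ') (l, β') * Rmat n q w y (l, γ) (j, β)) •
        nestedMonodromy q T x w i c (fun κ' => ψ (Fin.cons β (Fin.cons β' κ'))) κ := by
        simp only [Finset.sum_smul]
    _ = _ := by
        simp only [yang_baxter_apply hq hwy hwz hyz, Finset.sum_smul]
        have := Finset.sum_comm (s := (Finset.univ : Finset (Fin n × Fin n)))
          (t := (Finset.univ : Finset (Fin n × Fin n)))
          (f := fun p s => (Rmat n q y z (s.2, s.1) (p.1, p.2) *
            ∑ l, Rmat n q w y (c, b) (l, s.2) * Rmat n q w z (l, a) (j, s.1)) •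
            nestedMonodromy q T x w i c (fun κ' => ψ (Fin.cons p.1 (Fin.cons p.2 κ'))) κ)
        simp only [Fintype.sum_prod_type] at this
        rw [this]
        simp only [mul_comm]

end swap

section symmetry
variable {N : ℕ} {H : Type u} [AddCommGroup H] [Module ℂ H]

/-- `Φ` intertwines the nested monodromy matrices with inhomogeneities `x` and `x'`, and multiplies
the pseudovacuum and the contractions with `T_{1,κ}` by `c`. -/
structure Intertwines {r : ℕ} (q c : ℂ) (T : Monodromy (N + 2) H) (x x' : Fin r → ℂ)
    (Φ : Module.End ℂ ((Fin r → Fin (N + 1)) → H)) : Prop where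
  nested : ∀ w, (∀ j, w ≠ x j) → ∀ i j ψ,
    Φ (nestedMonodromy q T x w i j ψ) = nestedMonodromy q T x' w i j (Φ ψ)
  vac : ∀ v, Φ (vacTensor r v) = c • vacTensor r v
  contr : ∀ ψ, contr T x' 0 (Φ ψ) = c • contr T x 0 ψ

lemma exists_cons {X : Type*} {r : ℕ} (x : Fin (r + 1) → X) : ∃ y x', x = Fin.cons y x' :=
  ⟨x 0, Fin.tail x, (Fin.cons_self_tail x).symm⟩

/-- The factor `f(y,z)` appears twice for different reasons: on the vacuum because `R` acts by `f`
on equal indices, and on contractions because the RTT-relation with both rows equal to the first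
index has the scalar `f` on its left-hand side. -/
lemma intertwines_swapFirst {r : ℕ} {q : ℂ} (hq : q ≠ 0) {T : Monodromy (N + 2) H} {y z : ℂ}
    (hyz : y ≠ z) (hT : RTT q T y z) (x : Fin r → ℂ) :
    Intertwines q (f q y z) T (Fin.cons y (Fin.cons z x) : Fin (r + 2) → ℂ)
      (Fin.cons z (Fin.cons y x)) (swapFirst q y z r) where
  nested w hw i j ψ := swapFirst_nested hq T (by simpa using hw 0) (by simpa using hw 1) hyz x i j ψ
  vac v := by
    funext κ
    obtain ⟨a, κ, rfl⟩ := exists_cons κ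
    obtain ⟨b, κ, rfl⟩ := exists_cons κ
    have e : ∀ β β' : Fin (N + 1), vacTensor (r + 2) v (Fin.cons β (Fin.cons β' κ))
        = if β = 0 then (if β' = 0 then vacTensor r v κ else 0) else 0 := by
      intro β β'
      have h1 := congrFun (vacTensor_cons (r := r + 1) v β) (Fin.cons β' κ)
      have h2 := congrFun (vacTensor_cons (r := r) v β') κ
      rw [h1]
      split_ifs with h3 h4
      · rw [h2, if_pos h4]
      · rw [h2, if_neg h4]; rfl
      · rfl
    rw [swapFirst_cons, Pi.smul_apply]
    have := sum_Rmat_row (q := q) (u := y) (v := z)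
      (fun β β' : Fin (N + 1) => vacTensor (r + 2) v (Fin.cons β (Fin.cons β' κ))) b a
    rw [this]
    simp only [e]
    by_cases ha : a = 0 <;> by_cases hb : b = 0 <;> simp [ha, hb]
    exact fun h0 => absurd h0.symm ha
  contr ψ := by
    have hE : ∀ β β' : Fin (N + 1), ∑ b : Fin (N + 1), ∑ a : Fin (N + 1),
        Rmat (N + 1) q y z (b, a) (β, β') • (T z 0 a.succ * T y 0 b.succ)
          = f q y z • (T y 0 β.succ * T z 0 β'.succ) := by
      intro β β'
      have := rtt_iff.1 hT 0 0 β.succ β'.succ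
      rw [sum_Rmat_row (fun a' c' => T y a' β.succ * T z c' β'.succ), if_pos rfl,
        sum_Rmat_col (fun b' d' => T z 0 d' * T y 0 b')] at this
      rw [this, sum_Rmat_col (fun b' d' : Fin (N + 1) => T z 0 d'.succ * T y 0 b'.succ)]
      simp only [h_succ, Fin.succ_inj]
    have hX : ∀ a b : Fin (N + 1), contr T x 0 (fun κ => ∑ β, ∑ β',
        Rmat (N + 1) q y z (b, a) (β, β') • ψ (Fin.cons β (Fin.cons β' κ)))
        = ∑ β, ∑ β', Rmat (N + 1) q y z (b, a) (β, β') •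
          contr T x 0 (fun κ => ψ (Fin.cons β (Fin.cons β' κ))) := by
      intro a b
      simp only [← map_smul, ← map_sum]
      congr 1
      funext κ
      simp
    have h0 : ∀ k : ℕ, Fin.tail (0 : Fin (k + 1) → Fin (N + 2)) = 0 := fun _ => rfl
    simp only [contr_succ, Fin.cons_zero, Fin.tail_cons, swapFirst_cons, h0, hX, map_sum, map_smul,
      Finset.smul_sum]
    have := Finset.sum_comm (s := (Finset.univ : Finset (Fin (N + 1) × Fin (N + 1))))
      (t := (Finset.univ : Finset (Fin (N + 1) × Fin (N + 1))))
      (f := fun p s => Rmat (N + 1) q y z (p.2, p.1) (s.1, s.2) • (T z 0 p.1.succ)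
        (T y 0 p.2.succ (contr T x 0 fun κ => ψ (Fin.cons s.1 (Fin.cons s.2 κ)))))
    simp only [Fintype.sum_prod_type] at this
    refine Eq.trans ?_ (this.trans ?_)
    · rfl
    refine Finset.sum_congr rfl fun β _ => Finset.sum_congr rfl fun β' _ => ?_
    have := congrArg (fun F : Module.End ℂ H => F (contr T x 0 fun κ =>
      ψ (Fin.cons β (Fin.cons β' κ)))) (hE β β')
    rw [Finset.sum_comm] at this
    simpa using this

lemma exists_intertwiner {q : ℂ} (hq : q ≠ 0) {T : Monodromy (N + 2) H} :
    ∀ {r : ℕ} (j : Fin r) {x : Fin (r + 1) → ℂ}, x j.castSucc ≠ x j.succ →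
      RTT q T (x j.castSucc) (x j.succ) →
      ∃ Φ, Intertwines q (f q (x j.castSucc) (x j.succ)) T x
        (x ∘ Equiv.swap j.castSucc j.succ) Φ
  | 0, j, _, _, _ => j.elim0
  | r + 1, j, x, hne, hT => by
    induction j using Fin.cases with
    | zero =>
      obtain ⟨y, x, rfl⟩ := exists_cons x
      obtain ⟨z, x, rfl⟩ := exists_cons x
      have e : (Fin.cons y (Fin.cons z x) : Fin (r + 2) → ℂ) ∘ Equiv.swap 0 1
          = Fin.cons z (Fin.cons y x) := by
        funext i
        refine Fin.cases ?_ (fun i => Fin.cases ?_ (fun i => ?_) i) i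
        · simp
        · simp
        · rw [Function.comp_apply, Equiv.swap_apply_of_ne_of_ne] <;> simp [Fin.ext_iff]
      exact ⟨_, e ▸ intertwines_swapFirst hq hne hT x⟩
    | succ j =>
      obtain ⟨y, x, rfl⟩ := exists_cons x
      obtain ⟨Φ, hΦ⟩ := exists_intertwiner hq (T := T) j (x := x) hne hT
      have e : (Fin.cons y x : Fin (r + 2) → ℂ) ∘ Equiv.swap j.succ.castSucc j.succ.succ
          = Fin.cons y (x ∘ Equiv.swap j.castSucc j.succ) := by
        funext i
        refine Fin.cases ?_ (fun i => ?_) i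
        · rw [Function.comp_apply, Equiv.swap_apply_of_ne_of_ne] <;> simp [Fin.ext_iff]
        · rw [← Fin.succ_castSucc, Function.comp_apply,
            (Fin.succ_injective _).swap_apply, Fin.cons_succ, Fin.cons_succ, Function.comp_apply]
      have hc : (Fin.cons y x : Fin (r + 2) → ℂ) j.succ.castSucc = x j.castSucc := by
        rw [← Fin.succ_castSucc, Fin.cons_succ]
      rw [e, hc, Fin.cons_succ]
      -- For a swap not involving the first site, act by the intertwiner of the tail on each slice
      -- with fixed first index.
      refine ⟨(consCurry (N + 1) (r + 1) H).symm.toLinearMap ∘ₗ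
        (LinearMap.pi fun α => Φ ∘ₗ LinearMap.proj α) ∘ₗ
        (consCurry (N + 1) (r + 1) H).toLinearMap, ?_, ?_, ?_⟩
      · intro w hw i k ψ
        apply (consCurry (N + 1) (r + 1) H).injective
        simp only [LinearMap.comp_apply, LinearEquiv.coe_coe, LinearEquiv.apply_symm_apply,
          consCurry_nested, Fin.tail_cons, Fin.cons_zero]
        funext α
        simp only [LinearMap.pi_apply, LinearMap.comp_apply, LinearMap.proj_apply, addSite_apply,
          map_sum, map_smul]
        refine Finset.sum_congr rfl fun l _ => Finset.sum_congr rfl fun β _ => ?_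
        rw [hΦ.nested w fun j' => by simpa using hw j'.succ]
      · intro v
        apply (consCurry (N + 1) (r + 1) H).injective
        simp only [LinearMap.comp_apply, LinearEquiv.coe_coe, LinearEquiv.apply_symm_apply]
        funext α
        have e2 : ∀ α, consCurry (N + 1) (r + 1) H (vacTensor (r + 2) v) α =
          if α = 0 then vacTensor (r + 1) v else 0 := fun α => vacTensor_cons v α
        rw [LinearMap.pi_apply, LinearMap.comp_apply, LinearMap.proj_apply, map_smul, Pi.smul_apply,
          e2]
        split_ifs
        · exact hΦ.vac v
        · simp
      · intro ψ
        rw [contr_succ, contr_succ, Finset.smul_sum]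
        refine Finset.sum_congr rfl fun α _ => ?_
        rw [← map_smul]
        have e3 := hΦ.contr fun κ => ψ (Fin.cons α κ)
        simp only [Fin.tail_cons, Fin.cons_zero]
        exact congrArg _ e3

/-- Adjacent transpositions generate the permutations. For each of them the intertwiner produces one
factor `f` from the nested vacuum and one from the contraction, on opposite sides of the equation,
so they cancel when `f ≠ 0`. -/
lemma preBethe_first_perm {q : ℂ} (hq : q ≠ 0) {T : Monodromy (N + 2) H} {r : Fin (N + 1) → ℕ}
    (t : Params r) (hne : ∀ k j, t (Fin.succ k) j ∉ Set.range (t 0))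
    (hinj : Function.Injective (t 0))
    (hT : ∀ i j, i ≠ j → RTT q T (t 0 i) (t 0 j)) (hf : ∀ i j, i ≠ j → f q (t 0 i) (t 0 j) ≠ 0)
    (σ : Equiv.Perm (Fin (r 0))) (v : H) :
    contr T (t 0 ∘ σ) 0
      (preBethe q N (nestedMonodromy q T (t 0 ∘ σ)) (r := fun k => r k.succ) (fun k => t k.succ)
        (vacTensor (r 0) v)) = preBethe q (N + 1) T t v := by
  rw [preBethe_succ]
  generalize t 0 = x at hne hinj hT hf ⊢
  generalize r 0 = n at x hne hinj hT hf σ ⊢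
  obtain _ | n := n
  · rw [Subsingleton.elim σ 1]; rfl
  · have hσ : σ ∈ Submonoid.closure
        (Set.range fun i : Fin n => Equiv.swap i.castSucc i.succ) := by
      rw [Equiv.Perm.mclosure_swap_castSucc_succ]; trivial
    induction hσ using Submonoid.closure_induction_right with
    | one => rfl
    | mul_right σ hσ τ hτ ih =>
      obtain ⟨j, rfl⟩ := hτ
      rw [← ih]
      have hj : σ j.castSucc ≠ σ j.succ := fun hh => by
        have := σ.injective hh
        simp [Fin.ext_iff] at this
      obtain ⟨Φ, hΦ⟩ := exists_intertwiner hq (T := T) j (x := x ∘ σ) (fun hh => hj (hinj hh))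
        (hT _ _ hj)
      have h1 := preBethe_map (q := q) (r := fun k => r k.succ) Φ (fun k => t k.succ)
        (fun k i a b ψ => hΦ.nested _ (fun j' hh => hne k i ⟨_, hh.symm⟩) a b ψ)
        (vacTensor (n + 1) v)
      rw [hΦ.vac, preBethe_smul] at h1
      have h2 := hΦ.contr (preBethe q N (nestedMonodromy q T (x ∘ σ)) (r := fun k => r k.succ)
        (fun k => t k.succ) (vacTensor (n + 1) v))
      rw [h1, map_smul] at h2
      exact smul_right_injective _ (hf _ _ hj) h2

/-- The parameters `t` are distinct, and the `RTT`-relations hold at any two of them. -/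
structure Exchangeable {N : ℕ} {H : Type*} [AddCommGroup H] [Module ℂ H] (q : ℂ)
    (T : Monodromy (N + 1) H) {r : Fin N → ℕ} (t : Params r) : Prop where
  inj : Function.Injective fun p : Σ k, Fin (r k) => t p.1 p.2
  rtt : ∀ p p' : Σ k, Fin (r k), p ≠ p' → RTT q T (t p.1 p.2) (t p'.1 p'.2)

lemma Exchangeable.ne {q : ℂ} {T : Monodromy (N + 2) H} {r : Fin (N + 1) → ℕ} {t : Params r}
    (ht : Exchangeable q T t) (k : Fin N) (j : Fin (r k.succ)) (i : Fin (r 0)) :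
    t k.succ j ≠ t 0 i := by
  intro hh
  have := ht.inj (a₁ := ⟨k.succ, j⟩) (a₂ := ⟨0, i⟩) hh
  exact Fin.succ_ne_zero k (congrArg Sigma.fst this)

lemma sigma_succ_ne {r : Fin (N + 1) → ℕ} {p p' : Σ k : Fin N, Fin (r k.succ)} (hp : p ≠ p') :
    (⟨p.1.succ, p.2⟩ : Σ k, Fin (r k)) ≠ ⟨p'.1.succ, p'.2⟩ := by
  intro hh
  apply hp
  obtain ⟨k, j⟩ := p
  obtain ⟨k', j'⟩ := p'
  simp only [Sigma.mk.injEq, Fin.succ_inj] at hh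
  obtain ⟨rfl, hh⟩ := hh
  simp_all

lemma Exchangeable.nested {q : ℂ} (hq : q ≠ 0) {T : Monodromy (N + 2) H} {r : Fin (N + 1) → ℕ}
    {t : Params r} (ht : Exchangeable q T t) :
    Exchangeable q (nestedMonodromy q T (t 0)) (r := fun k => r k.succ) (fun k => t k.succ) where
  inj p p' hh := by
    by_contra hp
    exact sigma_succ_ne hp (ht.inj hh)
  rtt p p' hp := rtt_nested hq (ht.rtt _ _ (sigma_succ_ne hp))
    (fun hh => sigma_succ_ne hp (ht.inj hh)) (ht.ne _ _) (ht.ne _ _)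

end symmetry

/-- Parameters of higher colours are Bethe parameters of the nested model, which again satisfies the
RTT-relation, so induction on the rank leaves only the first colour. -/
theorem preBethe_perm {q : ℂ} (hq : q ≠ 0) : ∀ {N : ℕ} {H : Type u} [AddCommGroup H] [Module ℂ H]
    {T : Monodromy (N + 1) H} {r : Fin N → ℕ} {t : Params r}, Exchangeable q T t →
    (∀ k i j, i ≠ j → f q (t k i) (t k j) ≠ 0) → ∀ (σ : ∀ k, Equiv.Perm (Fin (r k))) (v : H),
    preBethe q N T (fun k => t k ∘ σ k) v = preBethe q N T t v
  | 0, _, _, _, _, _, _, _, _, _, _ => rfl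
  | N + 1, H, _, _, T, r, t, ht, hf, σ, v => by
    rw [← preBethe_first_perm hq t (fun k j ⟨i, hi⟩ => ht.ne k j i hi.symm)
      (fun i j hij => by simpa using ht.inj (a₁ := ⟨0, i⟩) (a₂ := ⟨0, j⟩) hij)
      (fun i j hij => ht.rtt ⟨0, i⟩ ⟨0, j⟩ (by simpa using hij)) (hf 0) (σ 0) v, preBethe_succ]
    congr 1
    refine preBethe_perm hq (T := nestedMonodromy q T (t 0 ∘ σ 0)) (r := fun k => r k.succ)
      (t := fun k => t k.succ) ⟨(ht.nested hq).inj, fun p p' hp => ?_⟩ (fun k => hf k.succ)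
      (fun k => σ k.succ) _
    exact rtt_nested hq (ht.rtt _ _ (sigma_succ_ne hp)) (fun hh => sigma_succ_ne hp (ht.inj hh))
      (fun j => ht.ne _ _ (σ 0 j)) (fun j => ht.ne _ _ (σ 0 j))

/-! ### Words in the entries of a monodromy matrix -/

section words
variable {ι : Type*} {m : ℕ} {R F A : Type*} [CommRing R] [AddCommGroup F] [Module R F]
  [AddCommMonoid A]

/-- The operator `T_{a_1,b_1}(p_1) ⋯ T_{a_n,b_n}(p_n)`. -/
def word (op : ι → Fin m → Fin m → Module.End R F) (w : List (ι × Fin m × Fin m)) :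
    Module.End R F :=
  (w.map fun l => op l.1 l.2.1 l.2.2).prod

lemma word_nil (op : ι → Fin m → Fin m → Module.End R F) : word op [] = 1 := rfl

lemma word_cons (op : ι → Fin m → Fin m → Module.End R F) (l : ι × Fin m × Fin m)
    (w : List (ι × Fin m × Fin m)) : word op (l :: w) = op l.1 l.2.1 l.2.2 * word op w := by
  simp [word]

/-- The total weight of a word. -/
def wt (ω : ι → Fin m → Fin m → A) (w : List (ι × Fin m × Fin m)) : A :=
  (w.map fun l => ω l.1 l.2.1 l.2.2).sum

lemma wt_nil (ω : ι → Fin m → Fin m → A) : wt ω [] = 0 := rfl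

lemma wt_cons (ω : ι → Fin m → Fin m → A) (l : ι × Fin m × Fin m)
    (w : List (ι × Fin m × Fin m)) : wt ω (l :: w) = ω l.1 l.2.1 l.2.2 + wt ω w := by
  simp [wt]

/-- The span of the words of a given weight, applied to the weighted vectors in `β`. -/
def wordSpan (op : ι → Fin m → Fin m → Module.End R F) (ω : ι → Fin m → Fin m → A)
    (β : Set (A × F)) (P : A → Prop) : Submodule R F :=
  Submodule.span R {ψ | ∃ w, ∃ b ∈ β, P (wt ω w + b.1) ∧ ψ = word op w b.2}

variable {op : ι → Fin m → Fin m → Module.End R F} {ω : ι → Fin m → Fin m → A} {β : Set (A × F)}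

lemma base_mem_wordSpan {P : A → Prop} {b : A × F} (hb : b ∈ β) (hP : P b.1) :
    b.2 ∈ wordSpan op ω β P :=
  Submodule.subset_span ⟨[], b, hb, by simpa [wt_nil] using hP, by simp [word_nil]⟩

lemma op_mem_wordSpan {P Q : A → Prop} {ψ : F} (hψ : ψ ∈ wordSpan op ω β P) (p : ι) (a b : Fin m)
    (hPQ : ∀ g, P g → Q (ω p a b + g)) : op p a b ψ ∈ wordSpan op ω β Q := by
  have : wordSpan op ω β P ≤ (wordSpan op ω β Q).comap (op p a b) := by
    refine Submodule.span_le.2 ?_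
    rintro _ ⟨w, c, hc, hP, rfl⟩
    refine Submodule.subset_span ⟨(p, a, b) :: w, c, hc, ?_, by simp [word_cons]⟩
    simpa [wt_cons, add_assoc] using hPQ _ hP
  exact this hψ

/-- Induction principle: a graded family of submodules that contains the base vectors and is stable
under letters contains all words. -/
lemma wordSpan_le {D : A → Submodule R F} (hβ : ∀ b ∈ β, b.2 ∈ D b.1)
    (hop : ∀ g p a b ψ, ψ ∈ D g → op p a b ψ ∈ D (ω p a b + g)) (g : A) :
    wordSpan op ω β (· = g) ≤ D g := by
  refine Submodule.span_le.2 ?_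
  rintro _ ⟨w, b, hb, rfl, rfl⟩
  induction w with
  | nil => simpa [word_nil, wt_nil] using hβ b hb
  | cons l w ih => simpa [word_cons, wt_cons, add_assoc] using hop _ l.1 l.2.1 l.2.2 _ ih

lemma list_prod_mem_wordSpan : ∀ {r : ℕ} (p : Fin r → ι) (a b : Fin r → Fin m) {P Q : A → Prop}
    {ψ : F}, ψ ∈ wordSpan op ω β P →
    (∀ g, P g → Q (∑ j, ω (p j) (a j) (b j) + g)) →
    (List.ofFn fun j => op (p j) (a j) (b j)).prod ψ ∈ wordSpan op ω β Q
  | 0, p, a, b, P, Q, ψ, hψ, hPQ => by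
    have := Submodule.span_mono (R := R) (s := {ψ | ∃ w, ∃ b ∈ β, P (wt ω w + b.1) ∧
        ψ = word op w b.2}) (t := {ψ | ∃ w, ∃ b ∈ β, Q (wt ω w + b.1) ∧ ψ = word op w b.2})
        (fun ψ ⟨w, b, hb, h1, h2⟩ => ⟨w, b, hb, by simpa using hPQ _ h1, h2⟩) hψ
    rw [List.ofFn_zero, List.prod_nil]
    exact this
  | r + 1, p, a, b, P, Q, ψ, hψ, hPQ => by
    rw [List.ofFn_succ, List.prod_cons, Module.End.mul_apply]
    refine op_mem_wordSpan (list_prod_mem_wordSpan (fun j => p j.succ) (fun j => a j.succ)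
      (fun j => b j.succ) hψ (Q := fun g' => ∃ g, P g ∧
        g' = ∑ j : Fin r, ω (p j.succ) (a j.succ) (b j.succ) + g) fun g hg => ⟨g, hg, rfl⟩) _ _ _ ?_
    rintro _ ⟨g, hg, rfl⟩
    have := hPQ g hg
    rwa [Fin.sum_univ_succ, add_assoc] at this

end words

/-! ### Bethe vectors as combinations of words, uniformly in a family of models -/

section families
variable {Z : Type*} {H : Z → Type u} [∀ z, AddCommGroup (H z)] [∀ z, Module ℂ (H z)]
  (R : Subalgebra ℂ (Z → ℂ)) {ι : Type*} {m : ℕ}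

/-- The operators `T_{a,b}(x_p)` acting in a family of spaces. -/
def famOp (T : ∀ z, Monodromy m (H z)) (x : Z → ι → ℂ) (p : ι) (a b : Fin m) :
    Module.End R (∀ z, H z) where
  toFun ψ z := T z (x z p) a b (ψ z)
  map_add' φ ψ := by funext z; simp
  map_smul' c ψ := by
    funext z
    exact map_smul (T z (x z p) a b) ((c : Z → ℂ) z) (ψ z)

lemma famOp_apply (T : ∀ z, Monodromy m (H z)) (x : Z → ι → ℂ) (p : ι) (a b : Fin m)
    (ψ : ∀ z, H z) (z : Z) : famOp R T x p a b ψ z = T z (x z p) a b (ψ z) := rfl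

lemma fam_smul_apply (c : R) (ψ : ∀ z, H z) (z : Z) : (c • ψ) z = (c : Z → ℂ) z • ψ z := rfl

lemma famOp_list_prod_apply (T : ∀ z, Monodromy m (H z)) (x : Z → ι → ℂ) :
    ∀ {r : ℕ} (p : Fin r → ι) (a b : Fin r → Fin m) (ψ : ∀ z, H z) (z : Z),
    (List.ofFn fun j => famOp R T x (p j) (a j) (b j)).prod ψ z =
      (List.ofFn fun j => T z (x z (p j)) (a j) (b j)).prod (ψ z)
  | 0, _, _, _, _, _ => by simp
  | r + 1, p, a, b, ψ, z => by
    simp only [List.ofFn_succ, List.prod_cons, Module.End.mul_apply, famOp_apply]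
    rw [famOp_list_prod_apply T x (fun j => p j.succ)]

/-- The `R`-matrix entries at pairs of different points are in `R`. -/
def RegularAt (q : ℂ) (x : Z → ι → ℂ) : Prop :=
  ∀ p p', p ≠ p' → ∀ n i j, (fun z => Rmat n q (x z p) (x z p') i j) ∈ R

variable {R}

lemma inhomogeneous_mem {q : ℂ} {x : Z → ι → ℂ} (hx : RegularAt R q x) {n : ℕ} (p : ι) (a : Fin n) :
    ∀ {r : ℕ} {pt : Fin r → ι}, (∀ j, p ≠ pt j) → ∀ (b : Fin n) (κ κ' : Fin r → Fin n),
    (fun z => inhomogeneous n q (fun j => x z (pt j)) (x z p) a b κ κ') ∈ R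
  | 0, pt, _, b, κ, κ' => by
    simp only [inhomogeneous_zero]
    exact R.algebraMap_mem ((1 : Matrix (Fin n) (Fin n)
      (Matrix (Fin 0 → Fin n) (Fin 0 → Fin n) ℂ)) a b κ κ')
  | r + 1, pt, hp, b, κ, κ' => by
    obtain ⟨α, κ, rfl⟩ := exists_cons κ
    obtain ⟨α', κ', rfl⟩ := exists_cons κ'
    simp only [inhomogeneous_cons]
    have : (fun z => ∑ l, Rmat n q (x z p) (x z (pt 0)) (l, α) (b, α') *
        inhomogeneous n q (fun j => x z (pt (Fin.succ j))) (x z p) a l κ κ')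
        = ∑ l, (fun z => Rmat n q (x z p) (x z (pt 0)) (l, α) (b, α')) *
        (fun z => inhomogeneous n q (fun j => x z (pt (Fin.succ j))) (x z p) a l κ κ') := by
      funext z; simp
    exact this ▸ R.sum_mem fun l _ => R.mul_mem (hx _ _ (hp 0) _ _ _)
      (inhomogeneous_mem hx p a (fun j => hp j.succ) l κ κ')

end families

lemma inhomogeneous_conserve {n : ℕ} {A : Type*} [AddCommMonoid A] (ω : Fin n → A) {q u : ℂ}
    (a : Fin n) : ∀ {r : ℕ} {x : Fin r → ℂ} {b : Fin n} {κ κ' : Fin r → Fin n},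
    inhomogeneous n q x u a b κ κ' ≠ 0 → ω a + ∑ j, ω (κ j) = ω b + ∑ j, ω (κ' j)
  | 0, x, b, κ, κ', hne => by
    by_cases hab : a = b
    · simp [hab]
    · exact absurd (by simp [inhomogeneous_zero, hab]) hne
  | r + 1, x, b, κ, κ', hne => by
    obtain ⟨α, κ, rfl⟩ := exists_cons κ
    obtain ⟨α', κ', rfl⟩ := exists_cons κ'
    rw [inhomogeneous_cons] at hne
    obtain ⟨l, -, hl⟩ := Finset.exists_ne_zero_of_sum_ne_zero hne
    have h1 := inhomogeneous_conserve ω a (right_ne_zero_of_mul hl)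
    have h2 := Rmat_conserve (left_ne_zero_of_mul hl)
    simp only [Fin.sum_univ_succ, Fin.cons_zero, Fin.cons_succ]
    rw [add_left_comm, h1]
    rcases h2 with ⟨rfl, rfl⟩ | ⟨rfl, rfl⟩
    · rw [add_left_comm]
    · rfl

/-- If all sites carry the first colour on the right, conservation forces the colours `a, κ_1, …` on
the left to be `b` together with copies of the first one. -/
lemma inhomogeneous_vac {n r : ℕ} {q u : ℂ} {x : Fin r → ℂ} {a b : Fin (n + 1)}
    {κ : Fin r → Fin (n + 1)} (hne : inhomogeneous (n + 1) q x u a b κ 0 ≠ 0) : a = b ∨ a = 0 := by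
  have := inhomogeneous_conserve (fun i => ({i} : Multiset (Fin (n + 1)))) a hne
  have h1 : a ∈ ({a} : Multiset (Fin (n + 1))) + ∑ j, {κ j} := by simp
  rw [this] at h1
  simp only [Pi.zero_apply, Multiset.mem_add, Multiset.mem_singleton, Multiset.mem_sum] at h1
  rcases h1 with h1 | ⟨_, _, h1⟩
  · exact Or.inl h1
  · exact Or.inr h1

section contraction
variable {n : ℕ} {H : Type u} [AddCommGroup H] [Module ℂ H]

lemma rtt_block_col {q w y : ℂ} {T : Monodromy (n + 1) H} (hT : RTT q T w y) (a ρ : Fin (n + 1))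
    (b β : Fin n) :
    ∑ l : Fin n, ∑ κ : Fin n, Rmat n q w y (l, κ) (b, β) • (T y ρ κ.succ * T w a l.succ)
      = ∑ a', ∑ ρ', Rmat (n + 1) q w y (a, ρ) (a', ρ') • (T w a' b.succ * T y ρ' β.succ) := by
  rw [rtt_iff.1 hT a ρ b.succ β.succ, sum_Rmat_col (fun b' d' => T y ρ d' * T w a b'),
    sum_Rmat_col (fun l κ : Fin n => T y ρ κ.succ * T w a l.succ)]
  simp only [h_succ, Fin.succ_inj]

/-- A nested entry leaves the contraction by passing one factor `T(x_j)` at a time. On the column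
side the indices stay in the lower block, where the RTT-relation cancels the nested `R`-matrices; on
the row side the full `R`-matrices accumulate into an inhomogeneous monodromy matrix of size `n +
1`. -/
lemma contr_nested {q : ℂ} {T : Monodromy (n + 1) H} {w : ℂ} : ∀ {r : ℕ} {x : Fin r → ℂ},
    (∀ j, RTT q T w (x j)) → ∀ (ρ : Fin r → Fin (n + 1)) (a b : Fin n)
    (ψ : (Fin r → Fin n) → H),
    contr T x ρ (nestedMonodromy q T x w a b ψ) = ∑ l, ∑ ρ',
      inhomogeneous (n + 1) q x w a.succ l ρ ρ' • T w l b.succ (contr T x ρ' ψ)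
  | 0, x, _, ρ, a, b, ψ => by
    rw [Finset.sum_eq_single a.succ]
    · simp [contr_apply, nested_zero, inhomogeneous_zero, Subsingleton.elim _ ρ]
    · intro l _ hl
      simp [inhomogeneous_zero, Ne.symm hl]
    · simp
  | r + 1, x, hT, ρ, a, b, ψ => by
    obtain ⟨y, x, rfl⟩ := exists_cons x
    obtain ⟨ρ₀, ρ, rfl⟩ := exists_cons ρ
    have ih := contr_nested (T := T) (w := w) (x := x) (fun j => by simpa using hT j.succ) ρ
    have e1 : ∀ α, contr T x ρ (fun κ =>
        nestedMonodromy q T (Fin.cons y x : Fin (r + 1) → ℂ) w a b ψ (Fin.cons α κ)) =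
        ∑ l, ∑ β, Rmat n q w y (l, α) (b, β) • ∑ l', ∑ ρ',
          inhomogeneous (n + 1) q x w a.succ l' ρ ρ' •
            T w l' l.succ (contr T x ρ' fun κ => ψ (Fin.cons β κ)) := by
      intro α
      simp only [← ih]
      simp only [← map_smul, ← map_sum]
      congr 1
      funext κ
      simp only [nested_cons, Fin.cons_zero, Fin.tail_cons, Finset.sum_apply, Pi.smul_apply,
        map_sum, map_smul]
    simp only [contr_succ, Fin.cons_zero, Fin.tail_cons, e1, sum_fin_cons, inhomogeneous_cons]
    have hb : ∀ (β : Fin n) (l' : Fin (n + 1)) (φ : H),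
        ∑ l : Fin n, ∑ κ : Fin n, Rmat n q w y (l, κ) (b, β) • T y ρ₀ κ.succ (T w l' l.succ φ)
        = ∑ a', ∑ ρ', Rmat (n + 1) q w y (l', ρ₀) (a', ρ') • T w a' b.succ (T y ρ' β.succ φ) := by
      intro β l' φ
      have hT0 : RTT q T w y := by simpa using hT 0
      have := congrArg (fun X : Module.End ℂ H => X φ) (rtt_block_col hT0 l' ρ₀ b β)
      simpa using this
    calc _ = ∑ β, ∑ l', ∑ ρ', inhomogeneous (n + 1) q x w a.succ l' ρ ρ' •
          ∑ l : Fin n, ∑ κ : Fin n, Rmat n q w y (l, κ) (b, β) • T y ρ₀ κ.succ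
            (T w l' l.succ (contr T x ρ' fun κ => ψ (Fin.cons β κ))) := by
          simp only [map_sum, map_smul, Finset.smul_sum]
          rw [sum_comm_two_three]
          refine Finset.sum_congr rfl fun β _ => Finset.sum_congr rfl fun l' _ =>
            Finset.sum_congr rfl fun ρ' _ => ?_
          rw [Finset.sum_comm]
          exact Finset.sum_congr rfl fun l _ => Finset.sum_congr rfl fun α _ => smul_comm _ _ _
      _ = ∑ β, ∑ l', ∑ ρ', inhomogeneous (n + 1) q x w a.succ l' ρ ρ' •
          ∑ a', ∑ ρ'', Rmat (n + 1) q w y (l', ρ₀) (a', ρ'') • T w a' b.succ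
            (T y ρ'' β.succ (contr T x ρ' fun κ => ψ (Fin.cons β κ))) := by
          simp only [hb]
      _ = _ := by
          simp only [map_sum, Finset.smul_sum, Finset.sum_smul, smul_smul]
          rw [sum_comm_two_three, Finset.sum_comm,
            Finset.sum_congr rfl fun _ _ => Finset.sum_comm]
          refine Finset.sum_congr rfl fun a' _ => Finset.sum_congr rfl fun ρ'' _ =>
            Finset.sum_congr rfl fun ρ' _ => ?_
          exact Finset.sum_congr rfl fun β _ => Finset.sum_congr rfl fun l' _ => by rw [mul_comm]

end contraction

section steps
variable {Z : Type*} {H : Z → Type u} [∀ z, AddCommGroup (H z)] [∀ z, Module ℂ (H z)]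
  {R : Subalgebra ℂ (Z → ℂ)} {A : Type*} [AddCommMonoid A] {N : ℕ} {r : Fin (N + 1) → ℕ}

/-- The Bethe parameters as a family of points. -/
def pts {N : ℕ} {r : Fin N → ℕ} (t : Z → Params r) (z : Z) (p : Σ k, Fin (r k)) : ℂ := t z p.1 p.2

/-- The colours `2, …, N` of a family of points. -/
def sigmaSucc (p : Σ k : Fin N, Fin (r k.succ)) : Σ k, Fin (r k) := ⟨p.1.succ, p.2⟩

lemma sigmaSucc_injective : Function.Injective (sigmaSucc (r := r)) := by
  intro p p' hp
  by_contra hne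
  exact sigma_succ_ne hne hp

lemma sum_sigma_succ (F : (Σ k, Fin (r k)) → A) :
    ∑ p, F p = ∑ j, F ⟨0, j⟩ + ∑ p, F (sigmaSucc p) := by
  rw [Fintype.sum_sigma, Fin.sum_univ_succ, Fintype.sum_sigma]
  rfl

variable (q : ℂ) (T : ∀ z, Monodromy (N + 2) (H z)) (t : Z → Params r)

/-- The family of nested monodromy matrices. -/
def nestedFam (z : Z) : Monodromy (N + 1) ((Fin (r 0) → Fin (N + 1)) → H z) :=
  nestedMonodromy q (T z) (t z 0)

/-- The parameters of colours `2, …, N`. -/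
def tailFam (z : Z) : Params fun k : Fin N => r k.succ := fun k => t z k.succ

variable {q T t}

lemma RegularAt.tail (hx : RegularAt R q (pts t)) : RegularAt R q (pts (tailFam t)) :=
  fun _ _ hp n i j => hx _ _ (fun hh => hp (sigmaSucc_injective hh)) n i j

lemma inhom_mem (hx : RegularAt R q (pts t)) {n : ℕ} (p : Σ k : Fin N, Fin (r k.succ))
    (a b : Fin n) (κ κ' : Fin (r 0) → Fin n) :
    (fun z => inhomogeneous n q (t z 0) (t z p.1.succ p.2) a b κ κ') ∈ R :=
  inhomogeneous_mem hx (sigmaSucc p) a (pt := fun j => ⟨0, j⟩)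
    (fun _ hh => Fin.succ_ne_zero p.1 (congrArg Sigma.fst hh)) b κ κ'

lemma nestedFam_op_apply (hx : RegularAt R q (pts t)) (p : Σ k : Fin N, Fin (r k.succ))
    (a b : Fin (N + 1)) (ψ : ∀ z, (Fin (r 0) → Fin (N + 1)) → H z) (κ : Fin (r 0) → Fin (N + 1)) :
    (fun z => famOp R (nestedFam q T t) (pts (tailFam t)) p a b ψ z κ)
      = ∑ l, ∑ κ', (⟨_, inhom_mem hx p l b κ κ'⟩ : R) •
          famOp R T (pts t) (sigmaSucc p) a.succ l.succ (fun z => ψ z κ') := by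
  funext z
  simp only [Finset.sum_apply, fam_smul_apply, famOp_apply]
  exact nested_apply q (T z) (t z 0) _ a b (ψ z) κ

section components
variable (R T t) (ω₁ : (Σ k, Fin (r k)) → A) (ω₂ ω₃ : Fin (N + 2) → A)
  (β : Set (A × (∀ z, H z)))

/-- The weight of a letter. -/
def letterWt {ι : Type*} {m : ℕ} (ω₁ : ι → A) (ω₂ ω₃ : Fin m → A) (p : ι) (a b : Fin m) : A :=
  ω₁ p + ω₂ a + ω₃ b

/-- The component of a vector of the nested model. -/
def compMap {ρ : Type} (H : Z → Type u) [∀ z, AddCommGroup (H z)] [∀ z, Module ℂ (H z)] (κ : ρ) :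
    (∀ z, ρ → H z) →ₗ[R] (∀ z, H z) where
  toFun ψ z := ψ z κ
  map_add' _ _ := rfl
  map_smul' _ _ := rfl

/-- Vectors of the nested model all whose components are combinations of words. -/
def compSpan (g : A) : Submodule R (∀ z, (Fin (r 0) → Fin (N + 1)) → H z) :=
  ⨅ κ : Fin (r 0) → Fin (N + 1),
    (wordSpan (famOp R T (pts t)) (letterWt ω₁ ω₂ ω₃) β
      fun g' => g' + ∑ j, ω₃ (κ j).succ = g).comap (compMap R H κ)

variable {R T t ω₁ ω₂ ω₃ β}

lemma mem_compSpan {g : A} {ψ : ∀ z, (Fin (r 0) → Fin (N + 1)) → H z} :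
    ψ ∈ compSpan R T t ω₁ ω₂ ω₃ β g ↔ ∀ κ, (fun z => ψ z κ) ∈
      wordSpan (famOp R T (pts t)) (letterWt ω₁ ω₂ ω₃) β fun g' => g' + ∑ j, ω₃ (κ j).succ = g := by
  simp only [compSpan, Submodule.mem_iInf, Submodule.mem_comap]
  rfl

/-- When a nested letter is expanded in letters of `T`, the change of its column index is
compensated by the change of the site indices. Hence column weight of the word plus weight of the
component is conserved. -/
lemma wordSpan_le_compSpan (hx : RegularAt R q (pts t))
    {β' : Set (A × (∀ z, (Fin (r 0) → Fin (N + 1)) → H z))}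
    (hβ : ∀ b ∈ β', b.2 ∈ compSpan R T t ω₁ ω₂ ω₃ β b.1) (g : A) :
    wordSpan (famOp R (nestedFam q T t) (pts (tailFam t)))
      (letterWt (ω₁ ∘ sigmaSucc) (ω₂ ∘ Fin.succ) (ω₃ ∘ Fin.succ)) β' (· = g)
      ≤ compSpan R T t ω₁ ω₂ ω₃ β g := by
  refine wordSpan_le hβ (fun g p a b ψ hψ => mem_compSpan.2 fun κ => ?_) g
  rw [mem_compSpan] at hψ
  rw [nestedFam_op_apply hx]
  refine Submodule.sum_mem _ fun l _ => Submodule.sum_mem _ fun κ' _ => ?_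
  by_cases h0 : (⟨_, inhom_mem hx p l b κ κ'⟩ : R) = 0
  · rw [h0, zero_smul]
    exact Submodule.zero_mem _
  · obtain ⟨z, hz⟩ : ∃ z, inhomogeneous (N + 1) q (t z 0) (t z p.1.succ p.2) l b κ κ' ≠ 0 := by
      by_contra! hh
      exact h0 (Subtype.ext (funext hh))
    have hc := inhomogeneous_conserve (ω₃ ∘ Fin.succ) l hz
    refine Submodule.smul_mem _ _ (op_mem_wordSpan (hψ κ') _ _ _ ?_)
    rintro g' rfl
    simp only [letterWt, Function.comp_apply] at hc ⊢
    rw [add_right_comm, add_assoc (ω₁ _ + ω₂ _), hc]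
    abel

lemma contr_fam (ρ : Fin (r 0) → Fin (N + 2)) (ψ : ∀ z, (Fin (r 0) → Fin (N + 1)) → H z) :
    (fun z => contr (T z) (t z 0) ρ (ψ z)) = ∑ κ : Fin (r 0) → Fin (N + 1),
      (List.ofFn fun j => famOp R T (pts t) ⟨0, j⟩ (ρ j) (κ j).succ).prod (fun z => ψ z κ) := by
  funext z
  rw [contr_apply, Finset.sum_apply]
  exact Finset.sum_congr rfl fun κ _ => (famOp_list_prod_apply R T (pts t) (fun j => ⟨0, j⟩)
    ρ (fun j => (κ j).succ) (fun z => ψ z κ) z).symm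

lemma contr_mem_wordSpan {g : A} {ψ : ∀ z, (Fin (r 0) → Fin (N + 1)) → H z}
    (hψ : ψ ∈ compSpan R T t ω₁ ω₂ ω₃ β g) :
    (fun z => contr (T z) (t z 0) 0 (ψ z)) ∈ wordSpan (famOp R T (pts t)) (letterWt ω₁ ω₂ ω₃) β
      (· = ∑ j, (ω₁ ⟨0, j⟩ + ω₂ 0) + g) := by
  rw [contr_fam (R := R)]
  rw [mem_compSpan] at hψ
  refine Submodule.sum_mem _ fun κ _ => ?_
  have key : ∀ g' : A, g' + ∑ j, ω₃ (κ j).succ = g →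
      ∑ j, letterWt ω₁ ω₂ ω₃ (⟨0, j⟩ : Σ k, Fin (r k)) 0 (κ j).succ + g'
        = ∑ j, (ω₁ ⟨0, j⟩ + ω₂ 0) + g := by
    rintro g' rfl
    simp only [letterWt, Finset.sum_add_distrib]
    abel
  exact list_prod_mem_wordSpan (op := famOp R T (pts t)) (ω := letterWt ω₁ ω₂ ω₃) (β := β)
    (fun j => ⟨0, j⟩) (fun _ => 0) (fun j => (κ j).succ) (hψ κ) key

end components
end steps

/-- The weights are arbitrary, so with free ones this says that every word contains each parameter
once, has row `k` exactly `r_k` times and column `k + 1` exactly `r_k` times. The induction follows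
the nesting: indices of the sites become column indices of the letters `T_{1,κ}` of the first
colour. -/
theorem preBethe_mem_wordSpan {Z : Type*} {R : Subalgebra ℂ (Z → ℂ)} {A : Type*} [AddCommMonoid A]
    {q : ℂ} : ∀ {N : ℕ} {H : Z → Type u} [∀ z, AddCommGroup (H z)] [∀ z, Module ℂ (H z)]
    {r : Fin N → ℕ} {T : ∀ z, Monodromy (N + 1) (H z)} {t : Z → Params r},
    RegularAt R q (pts t) → ∀ (v : ∀ z, H z) (ω₁ : (Σ k, Fin (r k)) → A) (ω₂ ω₃ : Fin (N + 1) → A),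
    (fun z => preBethe q N (T z) (t z) (v z)) ∈ wordSpan (famOp R T (pts t)) (letterWt ω₁ ω₂ ω₃)
      {(0, v)} (· = ∑ p : Σ k, Fin (r k), (ω₁ p + ω₂ p.1.castSucc + ω₃ p.1.succ))
  | 0, H, _, _, r, T, t, hx, v, ω₁, ω₂, ω₃ =>
    base_mem_wordSpan (b := (0, v)) rfl (by simp)
  | N + 1, H, _, _, r, T, t, hx, v, ω₁, ω₂, ω₃ => by
    simp only [preBethe_succ]
    have ih := preBethe_mem_wordSpan (T := nestedFam q T t) hx.tail
      (fun z => vacTensor (r 0) (v z)) (ω₁ ∘ sigmaSucc) (ω₂ ∘ Fin.succ) (ω₃ ∘ Fin.succ)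
    let v' : ∀ z, (Fin (r 0) → Fin (N + 1)) → H z := fun z => vacTensor (r 0) (v z)
    -- The weight of the base vector may be shifted freely.
    have hsub : ∀ (g c : A),
        wordSpan (famOp R (nestedFam q T t) (pts (tailFam t)))
          (letterWt (ω₁ ∘ sigmaSucc) (ω₂ ∘ Fin.succ) (ω₃ ∘ Fin.succ)) {(0, v')} (· = g)
        ≤ wordSpan (famOp R (nestedFam q T t) (pts (tailFam t)))
          (letterWt (ω₁ ∘ sigmaSucc) (ω₂ ∘ Fin.succ) (ω₃ ∘ Fin.succ)) {(c, v')} (· = g + c) := by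
      intro g c
      refine Submodule.span_mono ?_
      rintro _ ⟨w, b, rfl, rfl, rfl⟩
      exact ⟨w, (c, v'), rfl, by simp, rfl⟩
    -- The nested vacuum carries column weight `ω₃ 1` at each site (the second colour, in zero-based
    -- indexing), so it is given that weight.
    have h2 := wordSpan_le_compSpan (T := T) (ω₁ := ω₁) (ω₂ := ω₂) (ω₃ := ω₃) (β := {(0, v)}) hx
      (β' := {(∑ _ : Fin (r 0), ω₃ 1, v')}) ?_ _ (hsub _ _ ih)
    · refine (?_ : wordSpan (famOp R T (pts t)) (letterWt ω₁ ω₂ ω₃) {(0, v)} _ = _) ▸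
        contr_mem_wordSpan h2
      congr 1
      funext g
      rw [sum_sigma_succ]
      simp only [sigmaSucc, Function.comp_apply, Finset.sum_add_distrib, Fin.castSucc_zero,
        Fin.succ_zero_eq_one, Fin.succ_castSucc]
      congr 1
      abel
    · rintro _ rfl
      refine mem_compSpan.2 fun κ => ?_
      by_cases hκ : κ = 0
      · subst hκ
        have : (fun z => v' z 0) = v := by
          funext z; simp [v', vacTensor_apply]
        simp only [this]
        exact base_mem_wordSpan (b := (0, v)) rfl (by simp)
      · have : (fun z => v' z κ) = 0 := by
          funext z; simp [v', vacTensor_apply, hκ]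
        simp only [this]
        exact Submodule.zero_mem _

/-! ### Bethe vectors with the last parameter of a colour in the rightmost letter -/

lemma list_prod_mem_wordSpan_last {ι : Type*} {m : ℕ} {R F A : Type*} [CommRing R]
    [AddCommGroup F] [Module R F] [AddCommMonoid A] {op : ι → Fin m → Fin m → Module.End R F}
    {ω : ι → Fin m → Fin m → A} {β : Set (A × F)} {r : ℕ} (p : Fin r → ι) (a b : Fin r → Fin m)
    {ψ : F} {j : Fin r} (hj : (j : ℕ) + 1 = r)
    (hψ : op (p j) (a j) (b j) ψ ∈ wordSpan op ω β (· = ω (p j) (a j) (b j))) :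
    (List.ofFn fun j => op (p j) (a j) (b j)).prod ψ
      ∈ wordSpan op ω β (· = ∑ j, ω (p j) (a j) (b j)) := by
  obtain ⟨n, rfl⟩ : ∃ n, r = n + 1 := ⟨j, hj.symm⟩
  obtain rfl : j = Fin.last n := Fin.ext (by simpa using hj)
  rw [List.ofFn_succ', List.concat_eq_append, List.prod_append, List.prod_singleton,
    Module.End.mul_apply]
  refine list_prod_mem_wordSpan (fun j => p j.castSucc) (fun j => a j.castSucc)
    (fun j => b j.castSucc) hψ ?_
  rintro g rfl
  rw [Fin.sum_univ_castSucc]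

section steps
variable {Z : Type*} {H : Z → Type u} [∀ z, AddCommGroup (H z)] [∀ z, Module ℂ (H z)]
  (R : Subalgebra ℂ (Z → ℂ)) {A : Type*} [AddCommMonoid A]

/-- The vectors `T_{a,c}(t^k_j) v` with `k ≤ a ≤ c ≤ k + 1`. -/
def lastBase {N : ℕ} {r : Fin N → ℕ} (T : ∀ z, Monodromy (N + 1) (H z)) (t : Z → Params r)
    (ω₁ : (Σ k, Fin (r k)) → A) (v : ∀ z, H z) (k : Fin N) (j : Fin (r k)) :
    Set (A × ∀ z, H z) :=
  {b | ∃ a c, k.castSucc ≤ a ∧ a ≤ c ∧ c ≤ k.succ ∧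
    b = (ω₁ ⟨k, j⟩, famOp R T (pts t) ⟨k, j⟩ a c v)}

variable {R} {N : ℕ} {r : Fin (N + 1) → ℕ} {q : ℂ} {T : ∀ z, Monodromy (N + 2) (H z)}
  {t : Z → Params r}

lemma rtt_nestedFam (hq : q ≠ 0) (hinj : ∀ z, Function.Injective (pts t z))
    (hT : ∀ z p p', p ≠ p' → RTT q (T z) (pts t z p) (pts t z p')) (z : Z)
    (p p' : Σ k : Fin N, Fin (r k.succ)) (hp : p ≠ p') :
    RTT q (nestedFam q T t z) (pts (tailFam t) z p) (pts (tailFam t) z p') := by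
  have hne : ∀ (p : Σ k : Fin N, Fin (r k.succ)) j, pts (tailFam t) z p ≠ t z 0 j :=
    fun p j hh => Fin.succ_ne_zero p.1 (congrArg Sigma.fst
      (hinj z (a₁ := sigmaSucc p) (a₂ := ⟨0, j⟩) hh))
  exact rtt_nested hq (hT z _ _ (fun hh => hp (sigmaSucc_injective hh)))
    (fun hh => hp (sigmaSucc_injective (hinj z hh))) (hne p) (hne p')

/-- The contraction of a vector of the nested model with a product of entries of `T(t^1)`. -/
def contrMap (R : Subalgebra ℂ (Z → ℂ)) (T : ∀ z, Monodromy (N + 2) (H z)) (t : Z → Params r)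
    (ρ : Fin (r 0) → Fin (N + 2)) :
    (∀ z, (Fin (r 0) → Fin (N + 1)) → H z) →ₗ[R] (∀ z, H z) where
  toFun ψ z := contr (T z) (t z 0) ρ (ψ z)
  map_add' φ ψ := by funext z; exact map_add _ _ _
  map_smul' c ψ := by funext z; exact map_smul (contr (T z) (t z 0) ρ) ((c : Z → ℂ) z) (ψ z)

/-- Vectors of the nested model all whose contractions are combinations of words. -/
def contrSpan (R : Subalgebra ℂ (Z → ℂ)) (T : ∀ z, Monodromy (N + 2) (H z)) (t : Z → Params r)
    (ω₁ : (Σ k, Fin (r k)) → A) (β : Set (A × (∀ z, H z))) (g : A) :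
    Submodule R (∀ z, (Fin (r 0) → Fin (N + 1)) → H z) :=
  ⨅ ρ : Fin (r 0) → Fin (N + 2),
    (wordSpan (famOp R T (pts t)) (letterWt ω₁ 0 0) β
      (· = ∑ j, ω₁ ⟨0, j⟩ + g)).comap (contrMap R T t ρ)

lemma mem_contrSpan {ω₁ : (Σ k, Fin (r k)) → A} {β : Set (A × (∀ z, H z))} {g : A}
    {ψ : ∀ z, (Fin (r 0) → Fin (N + 1)) → H z} :
    ψ ∈ contrSpan R T t ω₁ β g ↔ ∀ ρ, (fun z => contr (T z) (t z 0) ρ (ψ z)) ∈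
      wordSpan (famOp R T (pts t)) (letterWt ω₁ 0 0) β (· = ∑ j, ω₁ ⟨0, j⟩ + g) := by
  simp only [contrSpan, Submodule.mem_iInf, Submodule.mem_comap]
  rfl

lemma contr_op (hx : RegularAt R q (pts t))
    (hT : ∀ z p p', p ≠ p' → RTT q (T z) (pts t z p) (pts t z p'))
    (p : Σ k : Fin N, Fin (r k.succ)) (a b : Fin (N + 1)) (ρ : Fin (r 0) → Fin (N + 2))
    (ψ : ∀ z, (Fin (r 0) → Fin (N + 1)) → H z) :
    (fun z => contr (T z) (t z 0) ρ (famOp R (nestedFam q T t) (pts (tailFam t)) p a b ψ z))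
      = ∑ l, ∑ ρ', (⟨_, inhom_mem hx p a.succ l ρ ρ'⟩ : R) •
          famOp R T (pts t) (sigmaSucc p) l b.succ (fun z => contr (T z) (t z 0) ρ' (ψ z)) := by
  funext z
  simp only [Finset.sum_apply, fam_smul_apply, famOp_apply]
  exact contr_nested (fun j => hT z (sigmaSucc p) ⟨0, j⟩
    fun hh => Fin.succ_ne_zero p.1 (congrArg Sigma.fst hh)) ρ a b (ψ z)

lemma wordSpan_le_contrSpan (hx : RegularAt R q (pts t))
    (hT : ∀ z p p', p ≠ p' → RTT q (T z) (pts t z p) (pts t z p'))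
    {ω₁ : (Σ k, Fin (r k)) → A} {β : Set (A × (∀ z, H z))}
    {β' : Set (A × (∀ z, (Fin (r 0) → Fin (N + 1)) → H z))}
    (hβ : ∀ b ∈ β', b.2 ∈ contrSpan R T t ω₁ β b.1) (g : A) :
    wordSpan (famOp R (nestedFam q T t) (pts (tailFam t)))
      (letterWt (ω₁ ∘ sigmaSucc) 0 0) β' (· = g) ≤ contrSpan R T t ω₁ β g := by
  refine wordSpan_le hβ (fun g p a b ψ hψ => mem_contrSpan.2 fun ρ => ?_) g
  rw [mem_contrSpan] at hψ
  rw [contr_op hx hT]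
  refine Submodule.sum_mem _ fun l _ => Submodule.sum_mem _ fun ρ' _ =>
    Submodule.smul_mem _ _ (op_mem_wordSpan (hψ ρ') _ _ _ ?_)
  rintro g' rfl
  simp only [letterWt, Function.comp_apply, Pi.zero_apply, add_zero]
  abel

end steps

/-- For the first colour, the nested letters are pulled to the left through the contraction by
`contr_nested`, leaving `T_{ρ_1,2}(t_1) ⋯ T_{ρ_r,2}(t_r)` on the vacuum; triangularity bounds the
last row index. For higher colours, induction applies in the nested model: its letters on the nested
vacuum give letters of `T` on `v` whose column index either is unchanged or drops to the first
nested colour. -/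
theorem preBethe_mem_wordSpan_last {Z : Type*} {R : Subalgebra ℂ (Z → ℂ)} {A : Type*}
    [AddCommMonoid A] {q : ℂ} (hq : q ≠ 0) :
    ∀ {N : ℕ} {H : Z → Type u} [∀ z, AddCommGroup (H z)] [∀ z, Module ℂ (H z)]
    {r : Fin N → ℕ} {T : ∀ z, Monodromy (N + 1) (H z)} {t : Z → Params r},
    RegularAt R q (pts t) → (∀ z, Function.Injective (pts t z)) →
    (∀ z p p', p ≠ p' → RTT q (T z) (pts t z p) (pts t z p')) →
    ∀ (k : Fin N) (j : Fin (r k)), (j : ℕ) + 1 = r k → ∀ (v : ∀ z, H z),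
    (∀ a b, b < a → famOp R T (pts t) ⟨k, j⟩ a b v = 0) → ∀ (ω₁ : (Σ k, Fin (r k)) → A),
    (fun z => preBethe q N (T z) (t z) (v z)) ∈ wordSpan (famOp R T (pts t)) (letterWt ω₁ 0 0)
      (lastBase R T t ω₁ v k j) (· = ∑ p : Σ k, Fin (r k), ω₁ p)
  | 0, _, _, _, _, _, _, _, _, _, k, _, _, _, _, _ => k.elim0
  | N + 1, H, _, _, r, T, t, hx, hinj, hT, k, j, hj, v, hv, ω₁ => by
    simp only [preBethe_succ]
    let v' : ∀ z, (Fin (r 0) → Fin (N + 1)) → H z := fun z => vacTensor (r 0) (v z)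
    have hv0 : (fun z => v' z 0) = v := by
      funext z; simp [v', vacTensor_apply]
    have hvκ : ∀ κ, κ ≠ 0 → (fun z => v' z κ) = 0 := by
      intro κ hκ
      funext z; simp [v', vacTensor_apply, hκ]
    induction k using Fin.cases with
    | zero =>
      have h1 := preBethe_mem_wordSpan (T := nestedFam q T t) hx.tail v' (ω₁ ∘ sigmaSucc) 0 0
      have h2 := wordSpan_le_contrSpan (T := T) hx hT (ω₁ := ω₁) (β := lastBase R T t ω₁ v 0 j)
        (β' := {(0, v')}) ?_ _ h1
      · refine (?_ : wordSpan (famOp R T (pts t)) (letterWt ω₁ 0 0) _ _ = _) ▸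
          mem_contrSpan.1 h2 0
        congr 1
        funext g
        rw [sum_sigma_succ]
        simp
      · rintro _ rfl
        refine mem_contrSpan.2 fun ρ => ?_
        -- Only the component `κ = 0` of the nested vacuum is non-zero, so all column indices are
        -- `Fin.succ 0`.
        rw [contr_fam (R := R), Finset.sum_eq_single (0 : Fin (r 0) → Fin (N + 1))]
        · have key := list_prod_mem_wordSpan_last (op := famOp R T (pts t))
            (ω := letterWt ω₁ 0 0) (β := lastBase R T t ω₁ v 0 j) (fun j => ⟨0, j⟩) ρ
            (fun _ => Fin.succ 0) (ψ := v) hj ?_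
          · simp only [letterWt, Pi.zero_apply, add_zero] at key ⊢
            simpa only [hv0] using key
          · rcases le_or_gt (ρ j) (Fin.succ 0) with h | h
            · exact base_mem_wordSpan
                (b := (ω₁ ⟨0, j⟩, famOp R T (pts t) ⟨0, j⟩ (ρ j) (Fin.succ 0) v))
                ⟨_, _, Fin.zero_le _, h, le_rfl, rfl⟩ (by simp [letterWt])
            · rw [hv _ _ h]
              exact Submodule.zero_mem _
        · intro κ _ hκ
          rw [hvκ κ hκ, map_zero]
        · exact fun hh => absurd (Finset.mem_univ _) hh
    | succ k =>
      have hopv : ∀ (a b : Fin (N + 1)) (κ : Fin (r 0) → Fin (N + 1)),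
          (fun z => famOp R (nestedFam q T t) (pts (tailFam t)) ⟨k, j⟩ a b v' z κ)
            = ∑ l, (⟨_, inhom_mem hx ⟨k, j⟩ l b κ 0⟩ : R) •
              famOp R T (pts t) ⟨k.succ, j⟩ a.succ l.succ v := by
        intro a b κ
        rw [nestedFam_op_apply hx]
        refine Finset.sum_congr rfl fun l _ => ?_
        rw [Finset.sum_eq_single 0]
        · rw [hv0]; rfl
        · intro κ' _ hκ'
          rw [hvκ κ' hκ', map_zero, smul_zero]
        · exact fun hh => absurd (Finset.mem_univ _) hh
      have hcoef : ∀ (l b : Fin (N + 1)) (κ : Fin (r 0) → Fin (N + 1)),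
          (⟨_, inhom_mem hx ⟨k, j⟩ l b κ 0⟩ : R) = 0 ∨ l = b ∨ l = 0 := by
        intro l b κ
        by_cases h0 : (⟨_, inhom_mem hx ⟨k, j⟩ l b κ 0⟩ : R) = 0
        · exact Or.inl h0
        · obtain ⟨z, hz⟩ : ∃ z, inhomogeneous (N + 1) q (t z 0) (t z k.succ j) l b κ 0 ≠ 0 := by
            by_contra! hh
            exact h0 (Subtype.ext (funext hh))
          exact Or.inr (inhomogeneous_vac hz)
      have ih := preBethe_mem_wordSpan_last hq (T := nestedFam q T t) hx.tail
        (fun z p p' hp => sigmaSucc_injective (hinj z hp)) (rtt_nestedFam hq hinj hT) k j hj v' ?_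
        (ω₁ ∘ sigmaSucc)
      · have h2 := wordSpan_le_compSpan (T := T) (ω₁ := ω₁) (ω₂ := 0) (ω₃ := 0)
          (β := lastBase R T t ω₁ v k.succ j) hx ?_ _ ih
        · refine (?_ : wordSpan (famOp R T (pts t)) (letterWt ω₁ 0 0) _ _ = _) ▸
            contr_mem_wordSpan h2
          congr 1
          funext g
          rw [sum_sigma_succ]
          simp
        · rintro _ ⟨a, c, hka, hac, hck, rfl⟩
          refine mem_compSpan.2 fun κ => ?_
          dsimp only
          rw [hopv]
          refine Submodule.sum_mem _ fun l _ => ?_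
          rcases hcoef l c κ with h | h
          · rw [h, zero_smul]
            exact Submodule.zero_mem _
          · refine Submodule.smul_mem _ _ ?_
            rcases le_or_gt a l with hal | hal
            · refine base_mem_wordSpan (b := (ω₁ ⟨k.succ, j⟩,
                famOp R T (pts t) ⟨k.succ, j⟩ a.succ l.succ v)) ⟨_, _, ?_, ?_, ?_, rfl⟩ ?_
              · rw [Fin.le_def] at hka ⊢; simpa using hka
              · simpa using hal
              · rcases h with rfl | rfl
                · exact Fin.succ_le_succ_iff.2 hck
                · exact Fin.succ_le_succ_iff.2 (Fin.zero_le _)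
              · simp [sigmaSucc]
            · rw [hv _ _ (by simpa using hal)]
              exact Submodule.zero_mem _
      · intro a b hab
        funext z
        funext κ
        have := congrFun (hopv a b κ) z
        refine this.trans ?_
        refine congrFun (g := (0 : ∀ z, H z)) (Finset.sum_eq_zero fun l _ => ?_) z
        rcases hcoef l b κ with h | h
        · rw [h, zero_smul]
        · rw [hv _ _, smul_zero]
          rcases h with rfl | rfl
          · simpa using hab
          · exact Fin.succ_lt_succ_iff.2 (lt_of_le_of_lt (Fin.zero_le b) hab)

/-! ### Normal ordering -/

section normal
variable {ι : Type*} {m : ℕ} {R F A : Type*} [CommRing R] [AddCommGroup F] [Module R F]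
  [AddCommMonoid A]

/-- The exchange relations, up to coefficients. -/
def Exchanges (op : ι → Fin m → Fin m → Module.End R F) : Prop :=
  ∀ p p', p ≠ p' → ∀ a b c d ψ,
    (a ≠ c → op p a b (op p' c d ψ) ∈ Submodule.span R
      {op p c b (op p' a d ψ), op p' c d (op p a b ψ), op p' c b (op p a d ψ)}) ∧
    (b ≠ d → op p a b (op p' c d ψ) ∈ Submodule.span R
      {op p a d (op p' c b ψ), op p' c d (op p a b ψ), op p' a d (op p c b ψ)})

/-- The weight of a letter, given by its point and its row. -/
def rowWt (ω : Fin m → A) (p : ι) (a _b : Fin m) : Multiset ι × A := ({p}, ω a)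

/-- The span of the words without lower triangular letters. -/
def normalSpan (op : ι → Fin m → Fin m → Module.End R F) (ω : Fin m → A)
    (β : Set ((Multiset ι × A) × F)) (g : Multiset ι × A) : Submodule R F :=
  Submodule.span R {ψ | ∃ w, (∀ l ∈ w, l.2.1 ≤ l.2.2) ∧ ∃ b ∈ β,
    wt (rowWt ω) w + b.1 = g ∧ ψ = word op w b.2}

variable {op : ι → Fin m → Fin m → Module.End R F} {ω : Fin m → A}
  {β : Set ((Multiset ι × A) × F)}

lemma base_mem_normalSpan {b : (Multiset ι × A) × F} (hb : b ∈ β) :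
    b.2 ∈ normalSpan op ω β b.1 :=
  Submodule.subset_span ⟨[], by simp, b, hb, by simp [wt_nil], by simp [word_nil]⟩

lemma op_mem_normalSpan {g g' : Multiset ι × A} {ψ : F} (hψ : ψ ∈ normalSpan op ω β g) {p : ι}
    {a b : Fin m} (hab : a ≤ b) (hg : g' = ({p}, ω a) + g) :
    op p a b ψ ∈ normalSpan op ω β g' := by
  have : normalSpan op ω β g ≤ (normalSpan op ω β g').comap (op p a b) := by
    refine Submodule.span_le.2 ?_
    rintro _ ⟨w, hw, c, hc, rfl, rfl⟩
    refine Submodule.subset_span ⟨(p, a, b) :: w, ?_, c, hc, ?_, by simp [word_cons]⟩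
    · exact List.forall_mem_cons.2 ⟨hab, hw⟩
    · rw [hg, wt_cons, add_assoc]; rfl
  exact this hψ

lemma span_triple_le {x y z w : F} {D : Submodule R F} (h : w ∈ Submodule.span R {x, y, z})
    (hx : x ∈ D) (hy : y ∈ D) (hz : z ∈ D) : w ∈ D := by
  refine Submodule.span_le.2 ?_ h
  rintro _ (rfl | rfl | rfl) <;> assumption

/-- Double induction: on the number of points to the right, then on the distance `a - b` of the
letter from the diagonal. The relation used (exchanging rows or columns) is chosen so that each
resulting term has an upper triangular left letter or one closer to the diagonal. Points must be
distinct because the exchange relations hold only for distinct points. -/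
theorem op_mem_normalSpan_of_exchanges (hop : Exchanges op)
    (hβ : ∀ v ∈ β, ∀ p a b, b < a → p ∉ v.1.1 →
      op p a b v.2 ∈ normalSpan op ω β (({p}, ω a) + v.1)) :
    ∀ (c h : ℕ) (g : Multiset ι × A) (p : ι) (a b : Fin m), g.1.card = c → (a : ℕ) - b = h →
      (p ::ₘ g.1).Nodup → ∀ ψ ∈ normalSpan op ω β g,
      op p a b ψ ∈ normalSpan op ω β (({p}, ω a) + g) := by
  intro c
  induction c using Nat.strong_induction_on with
  | _ c ihc =>
  intro h
  induction h using Nat.strong_induction_on with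
  | _ h ihh =>
  intro g p a b hc hh hnd ψ hψ
  rcases le_or_gt a b with hab | hab
  · exact op_mem_normalSpan hψ hab rfl
  suffices hle : normalSpan op ω β g ≤ (normalSpan op ω β (({p}, ω a) + g)).comap (op p a b) from
    hle hψ
  refine Submodule.span_le.2 ?_
  rintro _ ⟨w, hw, v, hv, hg, rfl⟩
  rw [SetLike.mem_coe, Submodule.mem_comap]
  cases w with
  | nil =>
    have hg' : v.1 = g := by simpa [wt_nil] using hg
    subst hg'
    rw [word_nil, Module.End.one_apply]
    exact hβ v hv p a b hab (Multiset.nodup_cons.1 hnd).1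
  | cons l w =>
    obtain ⟨p', c', d'⟩ := l
    have hcd : c' ≤ d' := hw (p', c', d') (by simp)
    have hw' : ∀ l ∈ w, l.2.1 ≤ l.2.2 := fun l hl => hw l (by simp [hl])
    set g' := wt (rowWt ω) w + v.1 with hg'
    have hgg : g = ({p'}, ω c') + g' := by
      rw [← hg, wt_cons, add_assoc]; rfl
    have hφ : word op w v.2 ∈ normalSpan op ω β g' :=
      Submodule.subset_span ⟨w, hw', v, hv, rfl, rfl⟩
    set φ := word op w v.2
    have hcard : g'.1.card < c := by
      rw [← hc, hgg]; simp
    rw [hgg] at hnd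
    have hnd' : (p ::ₘ p' ::ₘ g'.1).Nodup := hnd
    have hnd2 : (p' ::ₘ p ::ₘ g'.1).Nodup := by rwa [Multiset.cons_swap]
    have hpp : p ≠ p' := by
      rintro rfl
      simp at hnd'
    have hndp : (p ::ₘ g'.1).Nodup := (Multiset.nodup_cons.1 hnd2).2
    have hndp' : (p' ::ₘ g'.1).Nodup := (Multiset.nodup_cons.1 hnd').2
    have inner : ∀ x y, op p x y φ ∈ normalSpan op ω β (({p}, ω x) + g') := fun x y =>
      ihc _ hcard _ _ _ _ _ rfl rfl hndp _ hφ
    have inner' : ∀ x y, op p' x y φ ∈ normalSpan op ω β (({p'}, ω x) + g') := fun x y =>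
      ihc _ hcard _ _ _ _ _ rfl rfl hndp' _ hφ
    have hc1 : ∀ x, (({p'}, ω x) + g' : Multiset ι × A).1.card = c := fun x => by
      rw [← hc, hgg]; simp
    have hc2 : ∀ x, (({p}, ω x) + g' : Multiset ι × A).1.card = c := fun x => by
      rw [← hc, hgg]; simp
    have e1 : (({p}, ω a) + g : Multiset ι × A) = ({p}, ω a) + (({p'}, ω c') + g') := by rw [hgg]
    have e2 : (({p}, ω a) + g : Multiset ι × A) = ({p'}, ω c') + (({p}, ω a) + g') := by
      rw [hgg, add_left_comm]
    have e3 : (({p}, ω a) + g : Multiset ι × A) = ({p}, ω c') + (({p'}, ω a) + g') := by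
      rw [hgg]
      refine Prod.ext rfl ?_
      exact add_left_comm _ _ _
    have e4 : (({p}, ω a) + g : Multiset ι × A) = ({p'}, ω a) + (({p}, ω c') + g') := by
      rw [hgg]
      refine Prod.ext ?_ rfl
      exact add_left_comm _ _ _
    rw [word_cons, Module.End.mul_apply]
    rcases lt_or_ge b c' with hbc | hcb
    -- Exchanging columns replaces the column `b` of the left letter by `d' > b`; the truncated
    -- difference drops, whether or not the letter becomes upper triangular.
    · have hbd : b < d' := hbc.trans_le hcd
      have hlt : (a : ℕ) - d' < h := by
        rw [Fin.lt_def] at hab hbd; omega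
      refine span_triple_le ((hop p p' hpp a b c' d' φ).2 hbd.ne) ?_ ?_ ?_
      · rw [e1]
        exact ihh _ hlt _ _ _ _ (hc1 _) rfl hnd' _ (inner' _ _)
      · exact op_mem_normalSpan (inner _ _) hcd e2
      · rw [e4]
        exact ihh _ hlt _ _ _ _ (hc2 _) rfl hnd2 _ (inner _ _)
    · rcases lt_or_ge d' a with hda | had
      -- Exchanging rows makes every left letter upper triangular.
      · refine span_triple_le ((hop p p' hpp a b c' d' φ).1 (hcb.trans_lt hab).ne') ?_ ?_ ?_
        · exact op_mem_normalSpan (inner' _ _) hcb e3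
        · exact op_mem_normalSpan (inner _ _) hcd e2
        · refine op_mem_normalSpan (inner _ _) hcb (e2.trans ?_)
          rfl
      -- Here `c' ≤ b < a ≤ d'`, and exchanging columns makes every left letter upper triangular.
      · refine span_triple_le ((hop p p' hpp a b c' d' φ).2 (hab.trans_le had).ne) ?_ ?_ ?_
        · exact op_mem_normalSpan (inner' _ _) had e1
        · exact op_mem_normalSpan (inner _ _) hcd e2
        · exact op_mem_normalSpan (inner _ _) had e4

theorem word_mem_normalSpan (hop : Exchanges op)
    (hβ : ∀ v ∈ β, ∀ p a b, b < a → p ∉ v.1.1 →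
      op p a b v.2 ∈ normalSpan op ω β (({p}, ω a) + v.1)) {g : Multiset ι × A} (hg : g.1.Nodup) :
    wordSpan op (rowWt ω) β (· = g) ≤ normalSpan op ω β g := by
  refine Submodule.span_le.2 ?_
  rintro _ ⟨w, b, hb, rfl, rfl⟩
  induction w with
  | nil => simpa [word_nil, wt_nil] using base_mem_normalSpan hb
  | cons l w ih =>
    rw [wt_cons, add_assoc] at hg ⊢
    rw [word_cons]
    have hg' : (l.1 ::ₘ (wt (rowWt ω) w + b.1).1).Nodup := hg
    exact op_mem_normalSpan_of_exchanges hop hβ _ _ _ _ _ _ rfl rfl hg' _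
      (ih (Multiset.nodup_cons.1 hg').2)

/-- The vectors `T_{a,c}(p) v` with `k ≤ a ≤ c ≤ k'`. -/
def pairBase (op : ι → Fin m → Fin m → Module.End R F) (v : F) (z : ι) (k k' : Fin m) :
    Set ((Multiset ι × A) × F) :=
  {b | ∃ a c, k ≤ a ∧ a ≤ c ∧ c ≤ k' ∧ b = (({z}, 0), op z a c v)}

/-- This is the initial step of normal ordering when the rightmost letter is kept attached to the
vacuum. Diagonal base letters give multiples of the vacuum; for `T_{k,k+1}(z)` the exchange
relations leave only terms whose letter at `z` is `T_{k+1,k+1}` or `T_{k,k}`, again base vectors. -/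
lemma pairBase_normal (hop : Exchanges op) {v : F} (z : ι) {k k' : Fin m} (hk : (k' : ℕ) = k + 1)
    (hv : ∀ p a b, b < a → op p a b v = 0)
    (hdiag : ∀ p a b c, b < a → op p a b (op z c c v) = 0)
    (hcomm : ∀ p c d, op z c c (op p d d v) = op p d d (op z c c v)) :
    ∀ b₀ ∈ pairBase (A := A) op v z k k', ∀ p a b, b < a → p ∉ b₀.1.1 →
      op p a b b₀.2 ∈ normalSpan op 0 (pairBase op v z k k') (({p}, (0 : Fin m → A) a) + b₀.1) := by
  rintro _ ⟨c, d, hkc, hcd, hdk, rfl⟩ p a b hab hp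
  have hpz : p ≠ z := by simpa using hp
  dsimp only
  rcases hcd.eq_or_lt with rfl | hcd'
  · rw [hdiag _ _ _ _ hab]
    exact Submodule.zero_mem _
  have hc : c = k := by
    rw [Fin.le_def] at hkc hdk; rw [Fin.lt_def] at hcd'; ext; omega
  have hd : d = k' := by
    rw [Fin.le_def] at hkc hdk; rw [Fin.lt_def] at hcd'; ext; omega
  subst hc hd
  rcases lt_or_ge b c with hbc | hcb
  · refine span_triple_le ((hop p z hpz a b c d v).2 (hbc.trans hcd').ne) ?_ ?_ ?_
    · rw [hv z c b hbc, map_zero]; exact Submodule.zero_mem _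
    · rw [hv p a b hab, map_zero]; exact Submodule.zero_mem _
    · rw [hv p c b hbc, map_zero]; exact Submodule.zero_mem _
  · refine span_triple_le ((hop p z hpz a b c d v).1 (hcb.trans_lt hab).ne') ?_ ?_ ?_
    · rcases lt_or_ge d a with hda | had
      · rw [hv z a d hda, map_zero]; exact Submodule.zero_mem _
      · have ha : a = d := by
          rw [Fin.le_def] at hcb had; rw [Fin.lt_def] at hab; ext; omega
        subst ha
        refine op_mem_normalSpan (base_mem_normalSpan (β := pairBase op v z c a)
          (b := (({z}, 0), op z a a v)) ⟨a, a, hcd, le_rfl, le_rfl, rfl⟩) hcb rfl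
    · rw [hv p a b hab, map_zero]; exact Submodule.zero_mem _
    · rcases lt_or_ge d a with hda | had
      · rw [hv p a d hda, map_zero]; exact Submodule.zero_mem _
      · have ha : a = d := by
          rw [Fin.le_def] at hcb had; rw [Fin.lt_def] at hab; ext; omega
        have hb : b = c := by
          rw [Fin.le_def] at hcb had; rw [Fin.lt_def] at hab; ext; omega
        subst ha hb
        -- Here `a = k'` and `b = k`, and the two diagonal letters commute on the vacuum, so the
        -- letter at `z` can be put back in the rightmost place.
        rw [hcomm]
        exact op_mem_normalSpan (base_mem_normalSpan (β := pairBase op v z b a)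
          (b := (({z}, 0), op z b b v)) ⟨b, b, le_rfl, le_rfl, hcd, rfl⟩) le_rfl rfl

end normal

/-! ### Exchange relations for families of models -/

section exchange
variable {Z : Type*} {H : Z → Type u} [∀ z, AddCommGroup (H z)] [∀ z, Module ℂ (H z)]
  {R : Subalgebra ℂ (Z → ℂ)} {ι : Type*} {m : ℕ} {q : ℂ} {T : ∀ z, Monodromy m (H z)}
  {x : Z → ι → ℂ}

lemma h_mem (hx : RegularAt R q x) {p p' : ι} (hp : p ≠ p') {a b : Fin m} (hab : a ≠ b) :
    (fun z => h q (x z p) (x z p') a b) ∈ R := by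
  have := hx p p' hp m (a, b) (b, a)
  simpa [Rmat_apply, hab, hab.symm] using this

lemma f_mem (hx : RegularAt R q x) {p p' : ι} (hp : p ≠ p') (a : Fin m) :
    (fun z => f q (x z p) (x z p')) ∈ R := by
  have := hx p p' hp m (a, a) (a, a)
  simpa [Rmat_apply] using this

lemma Exch.row {q u v : ℂ} {A : Type*} [Ring A] [Algebra ℂ A] {X Y : Matrix (Fin m) (Fin m) A}
    (hXY : Exch q u v X Y) {a c : Fin m} (hac : a ≠ c) (b d : Fin m) :
    X a b * Y c d = - h q u v a c • (X c b * Y a d) + if b = d then f q u v • (Y c b * X a b)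
      else Y c d * X a b + h q u v d b • (Y c b * X a d) := by
  have := hXY a c b d
  rw [sum_Rmat_row (fun a' c' => X a' b * Y c' d), sum_Rmat_col (fun b' d' => Y c d' * X a b'),
    if_neg hac] at this
  rw [← this, neg_smul]
  abel

lemma Exch.col {q u v : ℂ} {A : Type*} [Ring A] [Algebra ℂ A] {X Y : Matrix (Fin m) (Fin m) A}
    (hXY : Exch q u v X Y) (a c : Fin m) {b d : Fin m} (hbd : b ≠ d) :
    Y c d * X a b = - h q u v d b • (Y c b * X a d) + if a = c then f q u v • (X a b * Y a d)
      else X a b * Y c d + h q u v a c • (X c b * Y a d) := by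
  have := hXY a c b d
  rw [sum_Rmat_row (fun a' c' => X a' b * Y c' d), sum_Rmat_col (fun b' d' => Y c d' * X a b'),
    if_neg hbd] at this
  rw [this, neg_smul]
  abel

/-- The row relation is the RTT-relation at `(p, p')` solved for one product, and the column
relation is the one at `(p', p)`; the coefficients are entries of `R` at two distinct points. -/
lemma exchanges_famOp (hx : RegularAt R q x)
    (hT : ∀ z p p', p ≠ p' → RTT q (T z) (x z p) (x z p')) : Exchanges (famOp R T x) := by
  intro p p' hp a b c d ψ
  have hmem : ∀ {V X Y W : ∀ z, H z} (α β γ : R), V = α • X + (β • Y + γ • W) →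
      V ∈ Submodule.span R {X, Y, W} := by
    rintro V X Y W α β γ rfl
    exact Submodule.add_mem _ (Submodule.smul_mem _ _ (Submodule.subset_span (by simp)))
      (Submodule.add_mem _ (Submodule.smul_mem _ _ (Submodule.subset_span (by simp)))
        (Submodule.smul_mem _ _ (Submodule.subset_span (by simp))))
  refine ⟨fun hac => ?_, fun hbd => ?_⟩
  · by_cases hbd : b = d
    · refine hmem (-⟨_, h_mem hx hp hac⟩) (⟨_, f_mem hx hp a⟩) (0) ?_
      funext z
      have := congrArg (fun X : Module.End ℂ (H z) => X (ψ z))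
        ((rtt_iff.1 (hT z p p' hp)).row hac b d)
      simp only [if_pos hbd] at this
      subst hbd
      rw [zero_smul, add_zero]
      exact this
    · refine hmem (-⟨_, h_mem hx hp hac⟩) (1) (⟨_, h_mem hx hp (Ne.symm hbd)⟩) ?_
      funext z
      have := congrArg (fun X : Module.End ℂ (H z) => X (ψ z))
        ((rtt_iff.1 (hT z p p' hp)).row hac b d)
      simp only [if_neg hbd] at this
      rw [one_smul]
      exact this
  · by_cases hac : a = c
    · refine hmem (-⟨_, h_mem hx hp.symm hbd⟩) (⟨_, f_mem hx hp.symm a⟩) (0) ?_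
      funext z
      have := congrArg (fun X : Module.End ℂ (H z) => X (ψ z))
        ((rtt_iff.1 (hT z p' p hp.symm)).col c a (Ne.symm hbd))
      simp only [if_pos hac.symm] at this
      subst hac
      rw [zero_smul, add_zero]
      exact this
    · refine hmem (-⟨_, h_mem hx hp.symm hbd⟩) (1) (⟨_, h_mem hx hp.symm (Ne.symm hac)⟩) ?_
      funext z
      have := congrArg (fun X : Module.End ℂ (H z) => X (ψ z))
        ((rtt_iff.1 (hT z p' p hp.symm)).col c a (Ne.symm hbd))
      simp only [if_neg (Ne.symm hac)] at this
      rw [one_smul]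
      exact this

end exchange

/-! ### Vacuum expectation values of normally ordered words -/

lemma exists_labelling {ι κ : Type*} [Fintype ι] [DecidableEq ι] (L : List (ι × κ))
    (hL : (L.map Prod.fst : Multiset ι) = Finset.univ.val) :
    ∃ φ : ι → κ, (L : Multiset (ι × κ)) = Finset.univ.val.map fun p => (p, φ p) := by
  have hex : ∀ p : ι, ∃ a, (p, a) ∈ L := by
    intro p
    have : p ∈ (L.map Prod.fst : Multiset ι) := by rw [hL]; simp
    simpa using this
  choose φ hφ using hex
  refine ⟨φ, (Multiset.eq_of_le_of_card_le ((Multiset.le_iff_subset ?_).2 ?_) ?_).symm⟩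
  · exact Finset.univ.nodup.map fun p p' hp => congrArg Prod.fst hp
  · intro l hl
    obtain ⟨p, -, rfl⟩ := Multiset.mem_map.1 hl
    exact hφ p
  · have := congrArg Multiset.card hL
    simp only [Multiset.coe_card, List.length_map] at this
    simp [this]

lemma wt_rowWt {ι : Type*} {m : ℕ} {A : Type*} [AddCommMonoid A] (ω : Fin m → A)
    (w : List (ι × Fin m × Fin m)) :
    wt (rowWt ω) w = ((w.map Prod.fst : Multiset ι), (w.map fun l => ω l.2.1).sum) := by
  induction w with
  | nil => rfl
  | cons l w ih =>
    rw [wt_cons, ih]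
    refine Prod.ext ?_ ?_
    · simp [rowWt]
    · simp [rowWt]

section expansion
variable {Z : Type*} {H : Z → Type u} [∀ z, AddCommGroup (H z)] [∀ z, Module ℂ (H z)]
  (R : Subalgebra ℂ (Z → ℂ)) {ι : Type*} [Fintype ι] [DecidableEq ι] {m : ℕ} {q : ℂ}
  (M : ∀ z, Model m q (H z)) (x : Z → ι → ℂ)

/-- Vectors whose pairing with the dual vacuum is a combination of the monomials
`∏ p, λ_{φ p}(x_p)`, with `φ ∈ S`. -/
def vacExp (S : Set (ι → Fin m)) : Submodule R (∀ z, H z) where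
  carrier := {ψ | ∃ C : (ι → Fin m) → R, (∀ φ, φ ∉ S → C φ = 0) ∧
    ∀ z, (M z).covac (ψ z) = ∑ φ, (C φ : Z → ℂ) z * ∏ p, (M z).lam (φ p) (x z p)}
  add_mem' := by
    rintro ψ₁ ψ₂ ⟨C₁, h1, e1⟩ ⟨C₂, h2, e2⟩
    refine ⟨C₁ + C₂, fun φ hφ => by simp [h1 φ hφ, h2 φ hφ], fun z => ?_⟩
    simp [e1, e2, add_mul, Finset.sum_add_distrib]
  zero_mem' := ⟨0, by simp, by simp⟩
  smul_mem' := by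
    rintro c ψ ⟨C, h, e⟩
    refine ⟨fun φ => c * C φ, fun φ hφ => by simp [h φ hφ], fun z => ?_⟩
    rw [fam_smul_apply, map_smul, e, smul_eq_mul, Finset.mul_sum]
    exact Finset.sum_congr rfl fun φ _ => (mul_assoc _ _ _).symm

variable {R M x}

open Classical in
lemma covac_word (hx : ∀ z p, x z p ∈ (M z).dom) (ψ : ∀ z, H z) (z : Z) :
    ∀ w : List (ι × Fin m × Fin m), (∀ l ∈ w, l.2.1 ≤ l.2.2) →
    (M z).covac (word (famOp R (fun z => (M z).T) x) w ψ z) =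
      if ∀ l ∈ w, l.2.1 = l.2.2 then
        (w.map fun l => (M z).lam l.2.1 (x z l.1)).prod * (M z).covac (ψ z) else 0
  | [], _ => by simp [word_nil]
  | l :: w, hw => by
    obtain ⟨hl, hw⟩ := List.forall_mem_cons.1 hw
    rw [word_cons, Module.End.mul_apply, famOp_apply]
    by_cases hd : l.2.1 = l.2.2
    · have := LinearMap.congr_fun ((M z).covac_diag _ (hx z l.1) l.2.1)
        (word (famOp R (fun z => (M z).T) x) w ψ z)
      simp only [LinearMap.comp_apply, LinearMap.smul_apply, smul_eq_mul] at this
      rw [← hd, this, covac_word hx ψ z w hw]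
      simp [hd, mul_assoc]
    · have := LinearMap.congr_fun ((M z).covac_upper _ (hx z l.1) l.2.1 l.2.2
        (lt_of_le_of_ne hl hd))
        (word (famOp R (fun z => (M z).T) x) w ψ z)
      simp only [LinearMap.comp_apply, LinearMap.zero_apply] at this
      rw [this, if_neg]
      exact fun hh => hd (hh l (by simp))

/-- The dual vacuum annihilates a word as soon as one letter is strictly upper triangular. Otherwise
it yields the product of eigenvalues, and since each point occurs once, the indices of the diagonal
letters define one labelling `φ`. -/
lemma word_mem_vacExp (hx : ∀ z p, x z p ∈ (M z).dom) {w : List (ι × Fin m × Fin m)}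
    (hw : ∀ l ∈ w, l.2.1 ≤ l.2.2) (hp : (w.map Prod.fst : Multiset ι) = Finset.univ.val)
    {S : Set (ι → Fin m)}
    (hS : ∀ φ : ι → Fin m, (∀ l ∈ w, l.2.1 = l.2.2) → (∀ l ∈ w, φ l.1 = l.2.1) →
      (w.map fun l => l.2.1 : Multiset (Fin m)) = Finset.univ.val.map φ → φ ∈ S) :
    word (famOp R (fun z => (M z).T) x) w (fun z => (M z).vac) ∈ vacExp R M x S := by
  classical
  by_cases hd : ∀ l ∈ w, l.2.1 = l.2.2
  · obtain ⟨φ, hφ⟩ := exists_labelling (w.map fun l => (l.1, l.2.1))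
      (by simpa [Function.comp_def] using hp)
    have h1 : ∀ l ∈ w, φ l.1 = l.2.1 := by
      intro l hl
      have : (l.1, l.2.1) ∈ ((w.map fun l => (l.1, l.2.1) : List _) : Multiset (ι × Fin m)) := 
        Multiset.mem_coe.2 (List.mem_map.2 ⟨l, hl, rfl⟩)
      rw [hφ] at this
      obtain ⟨p, -, hp⟩ := Multiset.mem_map.1 this
      rw [← congrArg Prod.fst hp]
      exact congrArg Prod.snd hp
    have h2 : ∀ {κ : Type} (F : ι × Fin m → κ), (w.map fun l => F (l.1, l.2.1) : Multiset κ)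
        = Finset.univ.val.map fun p => F (p, φ p) := by
      intro κ F
      have := congrArg (Multiset.map F) hφ
      simpa [Function.comp_def] using this
    refine ⟨fun φ' => if φ' = φ then 1 else 0, fun φ' hφ' => if_neg ?_, fun z => ?_⟩
    · rintro rfl
      exact hφ' (hS _ hd h1 (h2 Prod.snd))
    · rw [covac_word hx _ z w hw, if_pos hd, (M z).covac_vac, mul_one, Finset.sum_eq_single φ]
      · have := congrArg Multiset.prod (h2 fun l => (M z).lam l.2 (x z l.1))
        simp only [Multiset.prod_coe] at this
        rw [this]
        simp only [if_pos]
        exact (one_mul _).symm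
      · intro φ' _ hφ'
        simp only [if_neg hφ']
        exact zero_mul _
      · exact fun hh => absurd (Finset.mem_univ _) hh
  · refine ⟨0, fun _ _ => rfl, fun z => ?_⟩
    rw [covac_word hx _ z w hw, if_neg hd]
    simp

theorem normalSpan_vac_le (hx : ∀ z p, x z p ∈ (M z).dom) {A : Type*} [AddCommMonoid A]
    (ω : Fin m → A) {g : Multiset ι × A} (hg : g.1 = Finset.univ.val) :
    normalSpan (famOp R (fun z => (M z).T) x) ω {(0, fun z => (M z).vac)} g
      ≤ vacExp R M x {φ | ∑ p, ω (φ p) = g.2} := by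
  refine Submodule.span_le.2 ?_
  rintro _ ⟨w, hw, _, rfl, rfl, rfl⟩
  rw [wt_rowWt] at hg ⊢
  refine word_mem_vacExp hx hw (by simpa using hg) fun φ _ _ h3 => ?_
  have := congrArg (fun s => (Multiset.map ω s).sum) h3
  simp only [Multiset.map_coe, List.map_map, Multiset.sum_coe, Multiset.map_map] at this
  change (Finset.univ.val.map (ω ∘ φ)).sum = _
  rw [← this, add_zero]
  rfl

/-- The base letter is itself part of the word, so it must be diagonal in order to contribute, and
then its index is `k` or `k'`. -/
theorem normalSpan_pair_le (hx : ∀ z p, x z p ∈ (M z).dom) {A : Type*} [AddCommMonoid A]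
    {p₀ : ι} {k k' : Fin m} (hk : (k' : ℕ) = k + 1) {g : Multiset ι × A}
    (hg : g.1 = Finset.univ.val) :
    normalSpan (famOp R (fun z => (M z).T) x) 0
      (pairBase (famOp R (fun z => (M z).T) x) (fun z => (M z).vac) p₀ k k') g
      ≤ vacExp R M x {φ | φ p₀ = k ∨ φ p₀ = k'} := by
  refine Submodule.span_le.2 ?_
  rintro _ ⟨w, hw, _, ⟨a, c, hka, hac, hck, rfl⟩, rfl, rfl⟩
  rw [wt_rowWt] at hg
  have e : word (famOp R (fun z => (M z).T) x) w
      (famOp R (fun z => (M z).T) x p₀ a c fun z => (M z).vac)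
      = word (famOp R (fun z => (M z).T) x) (w ++ [(p₀, a, c)]) fun z => (M z).vac := by
    simp [word]
  dsimp only
  rw [SetLike.mem_coe, e]
  refine word_mem_vacExp hx ?_ ?_ fun φ h1 h2 _ => ?_
  · intro l hl
    rcases List.mem_append.1 hl with hl | hl
    · exact hw l hl
    · obtain rfl := List.mem_singleton.1 hl
      exact hac
  · rw [← hg, List.map_append]
    rfl
  · have ha := h2 (p₀, a, c) (by simp)
    rw [Set.mem_ofPred_eq, ha]
    have hc := h1 (p₀, a, c) (by simp)
    simp only at hc ⊢
    rw [Fin.le_def] at hka hck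
    rw [Fin.ext_iff, Fin.ext_iff]
    rw [Fin.ext_iff] at hc
    omega

end expansion

/-! ### The transposed model -/

lemma f_inv {q u v : ℂ} (hu : u ≠ 0) (hv : v ≠ 0) : f q⁻¹ u v = f q u⁻¹ v⁻¹ := by
  rcases eq_or_ne u v with rfl | huv
  · simp [f]
  · have h1 : u - v ≠ 0 := sub_ne_zero.2 huv
    have h2 : u⁻¹ - v⁻¹ ≠ 0 := sub_ne_zero.2 fun hh => huv (inv_injective hh)
    rw [f, f, div_eq_div_iff h1 h2, inv_inv]
    field_simp
    ring

lemma g_inv {q u v : ℂ} (hu : u ≠ 0) (hv : v ≠ 0) : g q⁻¹ u v * u = g q u⁻¹ v⁻¹ * v⁻¹ := by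
  rcases eq_or_ne u v with rfl | huv
  · simp [g]
  · have h1 : u - v ≠ 0 := sub_ne_zero.2 huv
    have h2 : u⁻¹ - v⁻¹ ≠ 0 := sub_ne_zero.2 fun hh => huv (inv_injective hh)
    rw [g, g, div_mul_eq_mul_div, div_mul_eq_mul_div, div_eq_div_iff h1 h2, inv_inv]
    field_simp
    ring

lemma g_swap (q u v : ℂ) : g q v u = - g q u v := by
  rw [g, g, ← neg_sub u v, div_neg]

lemma h_inv {m : ℕ} {q u v : ℂ} (hu : u ≠ 0) (hv : v ≠ 0) {a b : Fin m} (hab : a ≠ b) :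
    h q⁻¹ u v a b = h q u⁻¹ v⁻¹ b a := by
  rcases lt_or_gt_of_ne hab with hlt | hlt
  · rw [h, h, if_pos hlt, if_neg hlt.not_gt, g_inv hu hv]
  · have := g_inv (q := q) hv hu
    rw [h, h, if_pos hlt, if_neg hlt.not_gt]
    rw [g_swap q⁻¹, g_swap q, neg_mul, neg_mul] at this
    rwa [neg_inj] at this

/-- Inverting `q` and both spectral parameters preserves `f` and interchanges the two exchange
amplitudes, which transposes `R`; therefore transposed operators form a model. -/
lemma Rmat_inv {m : ℕ} {q u v : ℂ} (hu : u ≠ 0) (hv : v ≠ 0) (i j : Fin m × Fin m) :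
    Rmat m q⁻¹ u v i j = Rmat m q u⁻¹ v⁻¹ j i := by
  obtain ⟨a, b⟩ := i
  obtain ⟨c, d⟩ := j
  rw [Rmat_apply, Rmat_apply, f_inv hu hv]
  by_cases hab : a = b
  · subst hab
    by_cases hcd : c = d
    · subst hcd; simp [eq_comm]
    · have h1 : ¬ (c = a ∧ d = a) := fun hh => hcd (hh.1.trans hh.2.symm)
      have h2 : ¬ (a = c ∧ a = d) := fun hh => hcd (hh.1.symm.trans hh.2)
      have h3 : ¬ (a = d ∧ a = c) := fun hh => h2 hh.symm
      simp [hcd, h1, h2, h3]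
  · by_cases hcd : c = d
    · subst hcd
      have h1 : ¬ (c = a ∧ c = b) := fun hh => hab (hh.1.symm.trans hh.2)
      have h2 : ¬ (c = b ∧ c = a) := fun hh => h1 hh.symm
      have h3 : ¬ (a = c ∧ b = c) := fun hh => h1 ⟨hh.1.symm, hh.2.symm⟩
      simp [hab, h1, h2, h3]
    · by_cases h1 : c = a ∧ d = b
      · obtain ⟨rfl, rfl⟩ := h1
        simp [hab]
      · by_cases h2 : c = b ∧ d = a
        · obtain ⟨rfl, rfl⟩ := h2
          simp [hab, hcd, h_inv hu hv hab]
        · have h3 : ¬ (a = c ∧ b = d) := fun hh => h1 ⟨hh.1.symm, hh.2.symm⟩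
          have h4 : ¬ (a = d ∧ b = c) := fun hh => h2 ⟨hh.2.symm, hh.1.symm⟩
          simp [hab, hcd, h1, h2, h3, h4]

section dual
variable {m : ℕ} {q : ℂ} {H : Type u} [AddCommGroup H] [Module ℂ H]

/-- The transposed monodromy matrix. -/
def dualT (T : Monodromy m H) : Monodromy m (Module.Dual ℂ H) := fun u a b => (T u⁻¹ b a).dualMap

lemma rtt_dualT {T : Monodromy m H} {u v : ℂ} (hu : u ≠ 0) (hv : v ≠ 0)
    (hT : RTT q T u⁻¹ v⁻¹) : RTT q⁻¹ (dualT T) u v := by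
  rw [rtt_iff] at hT ⊢
  intro a c b d
  have key := congrArg Module.Dual.transpose (hT b d a c)
  simp only [map_sum, map_smul] at key
  have hm : ∀ X Y : Module.End ℂ H, Module.Dual.transpose (X * Y)
      = (LinearMap.dualMap Y * LinearMap.dualMap X : Module.End ℂ (Module.Dual ℂ H)) :=
    fun _ _ => rfl
  simp only [Rmat_inv hu hv]
  simp only [hm] at key
  exact key.symm

/-- The model of the transposed operators, for the deformation parameter `q⁻¹`. -/
def Model.dual (M : Model m q H) : Model m q⁻¹ (Module.Dual ℂ H) where
  dom := {u | u ≠ 0 ∧ u⁻¹ ∈ M.dom}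
  T := dualT M.T
  rtt u hu v hv huv := rtt_dualT hu.1 hv.1
    (M.rtt _ hu.2 _ hv.2 fun hh => huv (inv_injective hh))
  vac := M.covac
  covac := Module.Dual.eval ℂ H M.vac
  lam i u := M.lam i u⁻¹
  diag_vac u hu i := M.covac_diag _ hu.2 i
  lower_vac u hu i j hij := M.covac_upper _ hu.2 j i hij
  covac_diag u hu i := by
    ext ξ
    change ξ (M.T u⁻¹ i i M.vac) = _
    rw [M.diag_vac _ hu.2, map_smul]
    rfl
  covac_upper u hu i j hij := by
    ext ξ
    change ξ (M.T u⁻¹ j i M.vac) = _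
    rw [M.lower_vac _ hu.2 _ _ hij, map_zero]
    rfl
  covac_vac := M.covac_vac

end dual

/-! ### Scalar products as pairings of words -/

section pairing
variable {N : ℕ} {q : ℂ} {H : Type u} [AddCommGroup H] [Module ℂ H] {r : Fin N → ℕ}

/-- The inverses of the Bethe parameters. -/
def invParams (t : Params r) : Params r := fun k j => (t k j)⁻¹

/-- The scalar product without normalization. -/
def preScalar (M : Model (N + 1) q H) (s t : Params r) : ℂ :=
  preBethe q⁻¹ N M.dual.T (invParams s) M.covac (preBethe q N M.T t M.vac)

lemma invParams_invParams (t : Params r) : invParams (invParams t) = t := by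
  funext k j; exact inv_inv _

/-- Evaluation into the bidual intertwines `T` with its double transpose. This exchanges the roles
of `s` and `t`, so results about the `t`-parameters apply to the `s`-parameters. -/
lemma preScalar_dual (M : Model (N + 1) q H) (s t : Params r) :
    preScalar M.dual (invParams t) (invParams s) = preScalar M s t := by
  have := preBethe_map (q := q) (T := M.T) (T' := dualT (dualT M.T)) (Module.Dual.eval ℂ H) t
    (fun k j a b ψ => ?_) M.vac
  · rw [preScalar, preScalar, invParams_invParams]
    change preBethe q⁻¹⁻¹ N (dualT (dualT M.T)) t (Module.Dual.eval ℂ H M.vac)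
      (preBethe q⁻¹ N M.dual.T (invParams s) M.covac) = _
    rw [inv_inv]
    exact LinearMap.congr_fun this.symm _
  · ext ξ
    change ξ (M.T (t k j) a b ψ) = ξ (M.T (t k j)⁻¹⁻¹ a b ψ)
    rw [inv_inv]

lemma scalarProduct_eq (M : Model (N + 1) q H) (s t : Params r) (hs : ∀ k j, s k j ≠ 0) :
    M.scalarProduct s t =
      ((∏ k, ∏ j, M.lam k.succ (s k j)) * ∏ k : Fin N, ∏ l : Fin N,
        if (l : ℕ) = k + 1 then ∏ a, ∏ b, f q (s l a) (s k b) else 1)⁻¹ *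
      (((∏ k, ∏ j, M.lam k.succ (t k j)) * ∏ k : Fin N, ∏ l : Fin N,
        if (l : ℕ) = k + 1 then ∏ a, ∏ b, f q (t l a) (t k b) else 1)⁻¹ * preScalar M s t) := by
  unfold Model.scalarProduct Model.dualBethe Model.bethe betheVector
  rw [LinearMap.smul_apply, map_smul, smul_eq_mul, smul_eq_mul]
  have hf : ∀ k l a b, f q⁻¹ (s l a)⁻¹ (s k b)⁻¹ = f q (s l a) (s k b) := fun k l a b => by
    rw [f_inv (inv_ne_zero (hs l a)) (inv_ne_zero (hs k b)), inv_inv, inv_inv]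
  simp only [hf, inv_inv]
  rfl

end pairing

section pairing
variable {Z : Type*} {H : Z → Type u} [∀ z, AddCommGroup (H z)] [∀ z, Module ℂ (H z)]
  {R : Subalgebra ℂ (Z → ℂ)} {ι : Type*} {m : ℕ} {q : ℂ} {A : Type*} [AddCommMonoid A]

/-- Families of linear forms whose pairing with a combination of words is the pairing of the dual
vacuum with a combination of words. -/
def pairSpan (R : Subalgebra ℂ (Z → ℂ)) (M : ∀ z, Model m q (H z)) (x : Z → ι → ℂ)
    (ω : ι → Fin m → Fin m → A) (β : Set (A × (∀ z, H z))) (g : A) :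
    Submodule R (∀ z, Module.Dual ℂ (H z)) where
  carrier := {ξ | ∀ g', ∀ ψ ∈ wordSpan (famOp R (fun z => (M z).T) x) ω β (· = g'),
    ∃ ψ' ∈ wordSpan (famOp R (fun z => (M z).T) x) ω β (· = g + g'),
      ∀ z, ξ z (ψ z) = (M z).covac (ψ' z)}
  add_mem' := by
    intro ξ₁ ξ₂ h1 h2 g' ψ hψ
    obtain ⟨ψ₁, hψ₁, e1⟩ := h1 g' ψ hψ
    obtain ⟨ψ₂, hψ₂, e2⟩ := h2 g' ψ hψ
    refine ⟨ψ₁ + ψ₂, Submodule.add_mem _ hψ₁ hψ₂, fun z => ?_⟩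
    rw [Pi.add_apply, Pi.add_apply, map_add, LinearMap.add_apply, e1, e2]
  zero_mem' := fun g' ψ _ => ⟨0, Submodule.zero_mem _, fun z => by
    rw [Pi.zero_apply, Pi.zero_apply, map_zero, LinearMap.zero_apply]⟩
  smul_mem' := by
    intro c ξ h1 g' ψ hψ
    obtain ⟨ψ₁, hψ₁, e1⟩ := h1 g' ψ hψ
    refine ⟨c • ψ₁, Submodule.smul_mem _ c hψ₁, fun z => ?_⟩
    rw [fam_smul_apply, fam_smul_apply, map_smul, LinearMap.smul_apply, e1]

variable {M : ∀ z, Model m q (H z)} {x : Z → ι → ℂ} {ω : ι → Fin m → Fin m → A}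
  {β : Set (A × (∀ z, H z))}

/-- A letter of the dual model is the transpose of a letter of `T` with row and column interchanged,
so it can be moved across the pairing onto the vector, one letter at a time. -/
theorem wordSpan_dual_le {ι' : Type*} {x' : Z → ι' → ℂ} (e : ι' → ι)
    (hx' : ∀ z p, x' z p = (x z (e p))⁻¹) (g : A) :
    wordSpan (famOp R (fun z => (M z).dual.T) x') (fun p a b => ω (e p) b a)
      {(0, fun z => (M z).covac)} (· = g) ≤ pairSpan R M x ω β g := by
  refine wordSpan_le (D := pairSpan R M x ω β) ?_ (fun g p a b ξ hξ g' ψ hψ => ?_) g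
  · rintro _ rfl g' ψ hψ
    exact ⟨ψ, by simpa using hψ, fun z => rfl⟩
  · have h1 := op_mem_wordSpan hψ (e p) b a (Q := (· = ω (e p) b a + g'))
      (by rintro _ rfl; rfl)
    obtain ⟨ψ', hψ', e'⟩ := hξ _ _ h1
    refine ⟨ψ', ?_, fun z => ?_⟩
    · rwa [add_left_comm, ← add_assoc] at hψ'
    · rw [← e', famOp_apply, famOp_apply, hx']
      change ξ z ((M z).T (x z (e p))⁻¹⁻¹ b a (ψ z)) = _
      rw [inv_inv]

end pairing

lemma wordSpan_reindex {ι ι' : Type*} {m : ℕ} {R F A : Type*} [CommRing R] [AddCommGroup F]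
    [Module R F] [AddCommMonoid A] (op : ι → Fin m → Fin m → Module.End R F)
    (ω : ι → Fin m → Fin m → A) (β : Set (A × F)) (P : A → Prop) (e : ι' → ι) :
    wordSpan (fun p => op (e p)) (fun p => ω (e p)) β P ≤ wordSpan op ω β P := by
  refine Submodule.span_mono ?_
  rintro _ ⟨w, b, hb, hP, rfl⟩
  refine ⟨w.map fun l => (e l.1, l.2), b, hb, ?_, ?_⟩
  · simpa [wt, Function.comp_def] using hP
  · simp [word, Function.comp_def]

lemma wordSpan_congr {ι : Type*} {m : ℕ} {R F A : Type*} [CommRing R] [AddCommGroup F]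
    [Module R F] [AddCommMonoid A] {op : ι → Fin m → Fin m → Module.End R F}
    {ω ω' : ι → Fin m → Fin m → A} {β : Set (A × F)} {g g' : A} (hω : ∀ p a b, ω p a b = ω' p a b)
    (hg : g = g') {ψ : F} (hψ : ψ ∈ wordSpan op ω β (· = g)) : ψ ∈ wordSpan op ω' β (· = g') := by
  obtain rfl : ω = ω' := by
    funext p a b; exact hω p a b
  exact hg ▸ hψ

/-! ### Expansion of the scalar product in monomials of the vacuum eigenvalues -/

section expansion
variable {Z : Type*} {H : Z → Type u} [∀ z, AddCommGroup (H z)] [∀ z, Module ℂ (H z)]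
  {R : Subalgebra ℂ (Z → ℂ)} {N : ℕ} {q : ℂ} {M : ∀ z, Model (N + 1) q (H z)} {r : Fin N → ℕ}
  {s t : Z → Params r}

/-- The index set of all the Bethe parameters of a scalar product. -/
abbrev Idx {N : ℕ} (r : Fin N → ℕ) : Type := (Σ k, Fin (r k)) ⊕ (Σ k, Fin (r k))

/-- All the Bethe parameters of a scalar product. -/
def pairPts (s t : Params r) : Idx r → ℂ :=
  Sum.elim (fun p => s p.1 p.2) (fun p => t p.1 p.2)

/-- The hypotheses on a family of models and Bethe parameters. -/
structure Suitable (R : Subalgebra ℂ (Z → ℂ)) (M : ∀ z, Model (N + 1) q (H z))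
    (s t : Z → Params r) : Prop where
  ne_zero : ∀ z p, pairPts (s z) (t z) p ≠ 0
  mem_dom : ∀ z p, pairPts (s z) (t z) p ∈ (M z).dom
  inj : ∀ z, Function.Injective (pairPts (s z) (t z))
  regular : RegularAt R q fun z => pairPts (s z) (t z)

namespace Suitable
lemma rtt (hS : Suitable R M s t) (z : Z) (p p' : Idx r) (hp : p ≠ p') :
    RTT q (M z).T (pairPts (s z) (t z) p) (pairPts (s z) (t z) p') :=
  (M z).rtt _ (hS.mem_dom z p) _ (hS.mem_dom z p') fun hh => hp (hS.inj z hh)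

lemma regular_right (hS : Suitable R M s t) : RegularAt R q (pts t) := fun p p' hp =>
  hS.regular (Sum.inr p) (Sum.inr p') fun hh => hp (Sum.inr_injective hh)

lemma dual (hS : Suitable R M s t) : Suitable R (fun z => (M z).dual) (fun z => invParams (t z))
    (fun z => invParams (s z)) := by
  have e : ∀ z p, pairPts (invParams (t z)) (invParams (s z)) p
      = (pairPts (s z) (t z) p.swap)⁻¹ := by
    rintro z (p | p) <;> rfl
  refine ⟨fun z p => ?_, fun z p => ?_, fun z p p' hp => ?_, fun p p' hp n i j => ?_⟩
  · rw [e]; exact inv_ne_zero (hS.ne_zero z _)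
  · rw [e]
    exact ⟨inv_ne_zero (hS.ne_zero z _), by rw [inv_inv]; exact hS.mem_dom z _⟩
  · rw [e, e] at hp
    exact Sum.swap_leftInverse.injective (hS.inj z (inv_injective hp))
  · have := hS.regular p.swap p'.swap (fun hh => hp (Sum.swap_leftInverse.injective hh)) n j i
    simp only [e]
    convert this using 2 with z
    rw [Rmat_inv (inv_ne_zero (hS.ne_zero z _)) (inv_ne_zero (hS.ne_zero z _)), inv_inv, inv_inv]

/-- Combines the three ingredients: the words of the dual Bethe vector are moved onto the Bethe
vector and the result is normally ordered. All parameters are distinct points, each occurring once.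
-/
lemma exists_pairing (hS : Suitable R M s t) {A : Type*} [AddCommMonoid A] (ω : Fin (N + 1) → A)
    {β : Set ((Multiset (Idx r) × A) × ∀ z, H z)} {g : A}
    (hβ : ∀ v ∈ β, ∀ p a b, b < a → p ∉ v.1.1 →
      famOp R (fun z => (M z).T) (fun z => pairPts (s z) (t z)) p a b v.2 ∈
        normalSpan (famOp R (fun z => (M z).T) (fun z => pairPts (s z) (t z))) ω β
          (({p}, ω a) + v.1))
    (hψ : (fun z => preBethe q N (M z).T (t z) (M z).vac) ∈
      wordSpan (famOp R (fun z => (M z).T) (fun z => pairPts (s z) (t z))) (rowWt ω) β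
        (· = (∑ p, {Sum.inr p}, g))) :
    ∃ ψ ∈ normalSpan (famOp R (fun z => (M z).T) (fun z => pairPts (s z) (t z))) ω β
        (Finset.univ.val, ∑ p : Σ k, Fin (r k), ω p.1.succ + g),
      ∀ z, preScalar (M z) (s z) (t z) = (M z).covac (ψ z) := by
  -- The row weight is placed on the columns, since columns of dual letters are rows of `T`.
  have h1 := preBethe_mem_wordSpan (T := fun z => (M z).dual.T) hS.dual.regular_right
    (fun z => (M z).covac) (fun p => (({Sum.inl p}, 0) : Multiset (Idx r) × A)) 0
    (fun b => (0, ω b))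
  have h1' : (fun z => preBethe q⁻¹ N (M z).dual.T (invParams (s z)) (M z).covac) ∈
      wordSpan (famOp R (fun z => (M z).dual.T) (pts fun z => invParams (s z)))
        (fun p a b => rowWt ω (Sum.inl p) b a) {(0, fun z => (M z).covac)}
        (· = ∑ p : Σ k, Fin (r k), (({Sum.inl p}, ω p.1.succ) : Multiset (Idx r) × A)) := by
    refine wordSpan_congr (fun p a b => ?_) ?_ h1
    · simp [letterWt, rowWt]
    · simp
  obtain ⟨ψ, hψ, e⟩ := wordSpan_dual_le (R := R) (M := M) (x := fun z => pairPts (s z) (t z))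
    (ω := rowWt ω) (β := β) Sum.inl (fun z p => rfl) _ h1' _ _ hψ
  refine ⟨ψ, ?_, e⟩
  have hg : (∑ p : Σ k, Fin (r k), (({Sum.inl p}, ω p.1.succ) : Multiset (Idx r) × A))
      + (∑ p, {Sum.inr p}, g) = (Finset.univ.val, ∑ p : Σ k, Fin (r k), ω p.1.succ + g) := by
    refine Prod.ext ?_ ?_
    · rw [Prod.fst_add, Prod.fst_sum, ← Finset.sum_multiset_singleton, Fintype.sum_sum_type]
    · rw [Prod.snd_add, Prod.snd_sum]
  rw [hg] at hψ
  exact word_mem_normalSpan (exchanges_famOp hS.regular hS.rtt) hβ Finset.univ.nodup hψ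

/-- The Bethe vector contributes the rows `k` and the dual one the rows `k + 1`; normal ordering
preserves their multiset, which constrains the labels. -/
theorem exists_expansion (hS : Suitable R M s t) : ∃ C : (Idx r → Fin (N + 1)) → R,
    (∀ φ, (∑ p, ({φ p} : Multiset (Fin (N + 1))) ≠ ∑ p : Σ k, Fin (r k), {p.1.succ} +
      ∑ p : Σ k, Fin (r k), {p.1.castSucc}) → C φ = 0) ∧
    ∀ z, preScalar (M z) (s z) (t z) = ∑ φ, (C φ : Z → ℂ) z *
      ∏ p, (M z).lam (φ p) (pairPts (s z) (t z) p) := by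
  have h0 := hS.exists_pairing (fun a => ({a} : Multiset (Fin (N + 1))))
    (β := {(0, fun z => (M z).vac)}) (g := ∑ p : Σ k, Fin (r k), {p.1.castSucc}) ?_ ?_
  · obtain ⟨ψ, hψ, e⟩ := h0
    obtain ⟨C, hC, e'⟩ := normalSpan_vac_le hS.mem_dom _ rfl hψ
    exact ⟨C, fun φ hφ => hC φ hφ, fun z => (e z).trans (e' z)⟩
  · rintro _ rfl p a b hab _
    have : famOp R (fun z => (M z).T) (fun z => pairPts (s z) (t z)) p a b
        (fun z => (M z).vac) = 0 := by
      funext z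
      exact (M z).lower_vac _ (hS.mem_dom z p) _ _ hab
    dsimp only
    rw [this]
    exact Submodule.zero_mem _
  · have h1 := preBethe_mem_wordSpan (T := fun z => (M z).T) hS.regular_right
      (fun z => (M z).vac)
      (fun p => (({Sum.inr p}, 0) : Multiset (Idx r) × Multiset (Fin (N + 1))))
      (fun b => (0, {b})) 0
    refine wordSpan_reindex _ _ _ _ Sum.inr ?_
    refine wordSpan_congr (fun p a b => ?_) ?_ h1
    · simp [letterWt, rowWt]
    · rw [← Prod.mk.eta (p := ∑ p, _), Prod.fst_sum, Prod.snd_sum]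
      simp

/-- Same computation, starting from the words whose rightmost letter is attached to the last
parameter of colour `k`. The row weight is irrelevant here and is taken trivial. -/
theorem exists_expansion_right (hS : Suitable R M s t) (hq : q ≠ 0) (k : Fin N) (j : Fin (r k))
    (hj : (j : ℕ) + 1 = r k) :
    ∃ C : (Idx r → Fin (N + 1)) → R,
    (∀ φ, ¬ (φ (Sum.inr ⟨k, j⟩) = k.castSucc ∨ φ (Sum.inr ⟨k, j⟩) = k.succ) → C φ = 0) ∧
    ∀ z, preScalar (M z) (s z) (t z) = ∑ φ, (C φ : Z → ℂ) z *
      ∏ p, (M z).lam (φ p) (pairPts (s z) (t z) p) := by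
  have hv : ∀ p a b, b < a → famOp R (fun z => (M z).T) (fun z => pairPts (s z) (t z)) p a b
      (fun z => (M z).vac) = 0 := by
    intro p a b hab
    funext z
    exact (M z).lower_vac _ (hS.mem_dom z p) _ _ hab
  have hd : ∀ z p a, (M z).T (pairPts (s z) (t z) p) a a (M z).vac
      = (M z).lam a (pairPts (s z) (t z) p) • (M z).vac := fun z p a =>
    (M z).diag_vac _ (hS.mem_dom z p) a
  have h0 := hS.exists_pairing (A := PUnit) 0
    (β := pairBase (famOp R (fun z => (M z).T) (fun z => pairPts (s z) (t z)))
      (fun z => (M z).vac) (Sum.inr ⟨k, j⟩) k.castSucc k.succ) (g := 0)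
    (pairBase_normal (exchanges_famOp hS.regular hS.rtt) _ (by simp) hv ?_ ?_) ?_
  · obtain ⟨ψ, hψ, e⟩ := h0
    obtain ⟨C, hC, e'⟩ := normalSpan_pair_le hS.mem_dom (by simp) rfl hψ
    exact ⟨C, fun φ hφ => hC φ hφ, fun z => (e z).trans (e' z)⟩
  · intro p a b c hab
    funext z
    rw [famOp_apply, famOp_apply, hd, map_smul, (M z).lower_vac _ (hS.mem_dom z p) _ _ hab,
      smul_zero]
    rfl
  · intro p c d
    funext z
    simp only [famOp_apply]
    rw [hd, hd, map_smul, map_smul, hd, hd, smul_comm]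
  · have h1 := preBethe_mem_wordSpan_last hq (T := fun z => (M z).T) hS.regular_right
      (fun z p p' hp => Sum.inr_injective (hS.inj z (a₁ := Sum.inr p) (a₂ := Sum.inr p') hp))
      (fun z p p' hp => hS.rtt z (Sum.inr p) (Sum.inr p') fun hh => hp (Sum.inr_injective hh))
      k j hj (fun z => (M z).vac) (fun a b hab => hv (Sum.inr ⟨k, j⟩) a b hab)
      (fun p => (({Sum.inr p}, 0) : Multiset (Idx r) × PUnit))
    refine wordSpan_reindex _ _ _ _ Sum.inr ?_
    refine wordSpan_congr (fun p a b => ?_) ?_ h1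
    · simp [letterWt, rowWt]
    · rw [← Prod.mk.eta (p := ∑ p, _), Prod.fst_sum]

end Suitable
end expansion

/-! ### `q`-antisymmetric functions -/

section anti
variable {n : ℕ} {K : Type u} [AddCommGroup K] [Module ℂ K]

/-- The `q`-antisymmetry in the first two arguments. -/
def AntiFirst (q : ℂ) {r : ℕ} (ψ : (Fin (r + 2) → Fin n) → K) : Prop :=
  ∀ (κ : Fin r → Fin n) (a b : Fin n), (a = b → ψ (Fin.cons a (Fin.cons b κ)) = 0) ∧
    (a < b → ψ (Fin.cons b (Fin.cons a κ)) = -q⁻¹ • ψ (Fin.cons a (Fin.cons b κ)))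

/-- The `q`-antisymmetric functions of `r` indices. -/
def anti (n : ℕ) (K : Type u) [AddCommGroup K] [Module ℂ K] (q : ℂ) :
    (r : ℕ) → Submodule ℂ ((Fin r → Fin n) → K)
  | 0 => ⊤
  | 1 => ⊤
  | r + 2 =>
    { carrier := {ψ | (∀ α, (fun κ => ψ (Fin.cons α κ)) ∈ anti n K q (r + 1)) ∧ AntiFirst q ψ}
      add_mem' := fun {ψ φ} h1 h2 => ⟨fun α => Submodule.add_mem _ (h1.1 α) (h2.1 α), fun κ a b =>
        ⟨fun hab => by simp [(h1.2 κ a b).1 hab, (h2.2 κ a b).1 hab],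
          fun hab => by simp [(h1.2 κ a b).2 hab, (h2.2 κ a b).2 hab]⟩⟩
      zero_mem' := ⟨fun α => Submodule.zero_mem _, fun κ a b => ⟨fun _ => rfl, fun _ => by simp⟩⟩
      smul_mem' := fun c ψ h1 => ⟨fun α => Submodule.smul_mem _ c (h1.1 α), fun κ a b =>
        ⟨fun hab => by simp [(h1.2 κ a b).1 hab],
          fun hab => by simp [(h1.2 κ a b).2 hab, smul_comm c]⟩⟩ }

lemma anti_cons {q : ℂ} : ∀ {r : ℕ} {ψ : (Fin (r + 1) → Fin n) → K}, ψ ∈ anti n K q (r + 1) →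
    ∀ α, (fun κ => ψ (Fin.cons α κ)) ∈ anti n K q r
  | 0, _, _, _ => Submodule.mem_top
  | _ + 1, _, hψ, α => hψ.1 α

/-- Increasing tuples determine a `q`-antisymmetric function. Slices by the first index are treated
in increasing order: if the second index is smaller than the first, antisymmetry passes to a slice
already known to vanish. -/
lemma anti_eq_zero {q : ℂ} : ∀ {r : ℕ} {ψ : (Fin r → Fin n) → K}, ψ ∈ anti n K q r →
    (∀ κ, StrictMono κ → ψ κ = 0) → ψ = 0
  | 0, ψ, _, h0 => by
    funext κ
    exact h0 κ fun i => i.elim0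
  | 1, ψ, _, h0 => by
    funext κ
    exact h0 κ fun i j hij => absurd (Subsingleton.elim i j) hij.ne
  | r + 2, ψ, hψ, h0 => by
    have key : ∀ α : Fin n, (fun κ => ψ (Fin.cons α κ)) = 0 := by
      intro α
      induction α using WellFoundedLT.induction with
      | _ α ih =>
      refine anti_eq_zero (anti_cons hψ α) fun κ hκ => ?_
      obtain ⟨β, κ, rfl⟩ := exists_cons κ
      rcases lt_trichotomy α β with hlt | rfl | hlt
      · refine h0 _ ?_
        rw [Fin.strictMono_iff_lt_succ]
        intro i
        induction i using Fin.cases with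
        | zero => simpa using hlt
        | succ i => exact hκ (Fin.castSucc_lt_succ (i := i))
      · exact (hψ.2 κ α α).1 rfl
      · rw [(hψ.2 κ β α).2 hlt]
        have := congrFun (ih β hlt) (Fin.cons α κ)
        simp only [Pi.zero_apply] at this
        rw [this, smul_zero]
    funext κ
    obtain ⟨α, κ, rfl⟩ := exists_cons κ
    exact congrFun (key α) κ

/-- The multiset of the values of a tuple. -/
def content {r : ℕ} (κ : Fin r → Fin n) : Multiset (Fin n) := ∑ j, {κ j}

lemma content_cons {r : ℕ} (α : Fin n) (κ : Fin r → Fin n) :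
    content (Fin.cons α κ : Fin (r + 1) → Fin n) = {α} + content κ := by
  simp [content, Fin.sum_univ_succ]

lemma mem_content {r : ℕ} {κ : Fin r → Fin n} {a : Fin n} : a ∈ content κ ↔ ∃ j, κ j = a := by
  simp [content, Multiset.mem_sum, eq_comm]

lemma content_eq_map {r : ℕ} (κ : Fin r → Fin n) : content κ = Finset.univ.val.map κ := by
  rw [← Finset.sum_multiset_singleton, ← Multiset.coe_mapAddMonoidHom, map_sum]
  simp [content]

lemma nodup_content {r : ℕ} {κ : Fin r → Fin n} : (content κ).Nodup ↔ Function.Injective κ := by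
  rw [content_eq_map]
  refine ⟨fun hh i j hij => ?_, fun hh => Finset.univ.nodup.map hh⟩
  exact Multiset.inj_on_of_nodup_map hh i (Finset.mem_univ i) j (Finset.mem_univ j) hij

/-- The content is invariant under exchanging two entries, so restricting the support by content
preserves antisymmetry. -/
lemma anti_mask {q : ℂ} : ∀ {r : ℕ} {ψ : (Fin r → Fin n) → K}, ψ ∈ anti n K q r →
    ∀ (P : Multiset (Fin n) → Prop) [DecidablePred P],
      (fun κ => if P (content κ) then ψ κ else 0) ∈ anti n K q r
  | 0, _, _, _, _ => Submodule.mem_top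
  | 1, _, _, _, _ => Submodule.mem_top
  | r + 2, ψ, hψ, P, _ => by
    refine ⟨fun α => ?_, fun κ a b => ⟨fun hab => ?_, fun hab => ?_⟩⟩
    · simp only [content_cons]
      exact anti_mask (hψ.1 α) fun s => P ({α} + s)
    · simp only [(hψ.2 κ a b).1 hab, ite_self]
    · have e : content (Fin.cons b (Fin.cons a κ) : Fin (r + 2) → Fin n)
          = content (Fin.cons a (Fin.cons b κ) : Fin (r + 2) → Fin n) := by
        simp only [content_cons]
        exact add_left_comm _ _ _
      simp only [(hψ.2 κ a b).2 hab, e]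
      split_ifs
      · rfl
      · simp

/-- At `z = q² y` the `R`-matrix degenerates: `f` vanishes and the exchange amplitudes become `-q⁻¹`
and `-q`, so values at exchanged indices are proportional. With the next lemma, the image of the
intertwiner is exactly the antisymmetric functions. -/
lemma swapFirst_anti {q y z : ℂ} (hq : q ≠ 0) (hy : y ≠ 0) (hyz : z = q ^ 2 * y) (hne : y ≠ z)
    {r : ℕ} (φ : (Fin (r + 2) → Fin n) → K) : AntiFirst q (swapFirst q y z r φ) := by
  have hf : f q y z = 0 := by
    rw [f, hyz]
    have : q * y - q⁻¹ * (q ^ 2 * y) = 0 := by field_simp; ring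
    rw [this, zero_div]
  have hd : y - z ≠ 0 := sub_ne_zero.2 hne
  have hg1 : g q y z * y = - q⁻¹ := by
    rw [g, div_mul_eq_mul_div, div_eq_iff hd, hyz]
    field_simp
    ring
  have hg2 : g q y z * z = - q := by
    rw [g, div_mul_eq_mul_div, div_eq_iff hd, hyz]
    field_simp
    ring
  refine fun κ a b => ⟨fun hab => ?_, fun hab => ?_⟩
  · rw [swapFirst_cons, sum_Rmat_row (fun c d => φ (Fin.cons c (Fin.cons d κ))), if_pos hab.symm,
      hf, zero_smul]
  · rw [swapFirst_cons, sum_Rmat_row (fun c d => φ (Fin.cons c (Fin.cons d κ))), if_neg hab.ne,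
      swapFirst_cons, sum_Rmat_row (fun c d => φ (Fin.cons c (Fin.cons d κ))), if_neg hab.ne',
      h, h, if_pos hab, if_neg hab.not_gt, hg1, hg2, smul_add, smul_smul]
    have : -q⁻¹ * -q = 1 := by field_simp
    rw [this, one_smul, add_comm]

lemma exists_swapFirst {q y z : ℂ} (hq : q ≠ 0) (hy : y ≠ 0) (hyz : z = q ^ 2 * y) (hne : y ≠ z)
    {r : ℕ} {ψ : (Fin (r + 2) → Fin n) → K} (hψ : AntiFirst q ψ) :
    ∃ φ, swapFirst q y z r φ = ψ := by
  have hf : f q y z = 0 := by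
    rw [f, hyz]
    have : q * y - q⁻¹ * (q ^ 2 * y) = 0 := by field_simp; ring
    rw [this, zero_div]
  have hd : y - z ≠ 0 := sub_ne_zero.2 hne
  have hg1 : g q y z * y = - q⁻¹ := by
    rw [g, div_mul_eq_mul_div, div_eq_iff hd, hyz]
    field_simp
    ring
  -- A preimage can be supported on pairs in decreasing order; the exchange term then supplies the
  -- other order with the factor `-q⁻¹`.
  refine ⟨fun κ => if κ 1 < κ 0 then ψ (Fin.cons (κ 1) (Fin.cons (κ 0) (Fin.tail (Fin.tail κ))))
    else 0, ?_⟩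
  have e : ∀ (c d : Fin n) (κ : Fin r → Fin n), (fun κ : Fin (r + 2) → Fin n => if κ 1 < κ 0 then
      ψ (Fin.cons (κ 1) (Fin.cons (κ 0) (Fin.tail (Fin.tail κ)))) else 0)
      (Fin.cons c (Fin.cons d κ)) = if d < c then ψ (Fin.cons d (Fin.cons c κ)) else 0 :=
    fun c d κ => rfl
  funext κ
  obtain ⟨a, κ, rfl⟩ := exists_cons κ
  obtain ⟨b, κ, rfl⟩ := exists_cons κ
  rw [swapFirst_cons]
  simp only [e]
  rw [sum_Rmat_row (fun c d => if d < c then ψ (Fin.cons d (Fin.cons c κ)) else 0)]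
  rcases lt_trichotomy a b with hab | hab | hab
  · rw [if_neg hab.ne', if_pos hab, if_neg hab.not_gt, smul_zero, add_zero]
  · rw [if_pos hab.symm, hf, zero_smul, (hψ κ a b).1 hab]
  · rw [if_neg hab.ne, if_neg hab.not_gt, if_pos hab, zero_add, h, if_pos hab, hg1,
      (hψ κ b a).2 hab]

/-- The inhomogeneities `q^{2(r-1)} ξ, …, q² ξ, ξ`. -/
def chain (q ξ : ℂ) : (r : ℕ) → Fin r → ℂ
  | 0 => Fin.elim0
  | r + 1 => Fin.cons (q ^ (2 * r) * ξ) (chain q ξ r)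

/-- Fusion: the degenerate intertwiner maps the model with inhomogeneities `(y, q² y, …)` to the one
with `(q² y, y, …)`, so its image is invariant under the latter, which has the order of `chain`.
Antisymmetry in further sites comes from the recursion in the first site. -/
lemma nested_mem_anti {q ξ : ℂ} (hq : q ≠ 0) (hq2 : q ^ 2 ≠ 1) (hξ : ξ ≠ 0)
    (T : Monodromy (n + 1) K) {w : ℂ} (a b : Fin n) : ∀ {r : ℕ}, (∀ j, w ≠ chain q ξ r j) →
    ∀ {ψ : (Fin r → Fin n) → K}, ψ ∈ anti n K q r →
      nestedMonodromy q T (chain q ξ r) w a b ψ ∈ anti n K q r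
  | 0, _, _, _ => Submodule.mem_top
  | 1, _, _, _ => Submodule.mem_top
  | r + 2, hw, ψ, hψ => by
    refine ⟨fun α => ?_, ?_⟩
    · have : (fun κ => nestedMonodromy q T (chain q ξ (r + 2)) w a b ψ (Fin.cons α κ))
          = ∑ l, ∑ β, Rmat n q w (chain q ξ (r + 2) 0) (l, α) (b, β) •
            nestedMonodromy q T (chain q ξ (r + 1)) w a l (fun κ' => ψ (Fin.cons β κ')) := by
        funext κ
        rw [nested_cons]
        simp only [Finset.sum_apply, Pi.smul_apply]
        rfl
      rw [this]
      exact Submodule.sum_mem _ fun l _ => Submodule.sum_mem _ fun β _ => Submodule.smul_mem _ _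
        (nested_mem_anti hq hq2 hξ T a l (fun j => hw j.succ) (hψ.1 β))
    · have hy : q ^ (2 * r) * ξ ≠ 0 := mul_ne_zero (pow_ne_zero _ hq) hξ
      have hyz : q ^ (2 * (r + 1)) * ξ = q ^ 2 * (q ^ (2 * r) * ξ) := by ring
      have hne : q ^ (2 * r) * ξ ≠ q ^ (2 * (r + 1)) * ξ := by
        rw [hyz]
        intro hh
        exact hq2 (mul_right_cancel₀ hy (hh.symm.trans (one_mul _).symm))
      obtain ⟨φ, rfl⟩ := exists_swapFirst hq hy hyz hne hψ.2
      have := swapFirst_nested hq T (y := q ^ (2 * r) * ξ) (z := q ^ (2 * (r + 1)) * ξ) (hw 1)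
        (hw 0) hne (chain q ξ r) a b φ
      change AntiFirst q (nestedMonodromy q T (Fin.cons (q ^ (2 * (r + 1)) * ξ)
        (Fin.cons (q ^ (2 * r) * ξ) (chain q ξ r)) : Fin (r + 2) → ℂ) w a b _)
      rw [← this]
      exact swapFirst_anti hq hy hyz hne _

end anti

lemma rtt_of_injective {m : ℕ} {H H' : Type*} [AddCommGroup H] [Module ℂ H] [AddCommGroup H']
    [Module ℂ H'] (e : H' →ₗ[ℂ] H) (he : Function.Injective e) {q : ℂ} {T : Monodromy m H}
    {T' : Monodromy m H'} {u v : ℂ} (hT : RTT q T u v)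
    (hu : ∀ i j ψ, e (T' u i j ψ) = T u i j (e ψ)) (hv : ∀ i j ψ, e (T' v i j ψ) = T v i j (e ψ)) :
    RTT q T' u v := by
  rw [rtt_iff] at hT ⊢
  intro a c b d
  ext ψ
  apply he
  have := congrArg (fun X : Module.End ℂ H => X (e ψ)) (hT a c b d)
  simpa [hu, hv] using this

/-! ### The standard `q`-antisymmetric function -/

section vacuum
variable {n : ℕ}

/-- The sign of a pair in a `q`-antisymmetric function. -/
def qsign (q : ℂ) (a b : Fin n) : ℂ := if a < b then 1 else if b < a then -q⁻¹ else 0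

/-- The standard `q`-antisymmetric function. -/
def asym (q : ℂ) : (r : ℕ) → (Fin r → Fin n) → ℂ
  | 0, _ => 1
  | r + 1, κ => (∏ j : Fin r, qsign q (κ 0) (κ j.succ)) * asym q r (Fin.tail κ)

lemma asym_cons (q : ℂ) {r : ℕ} (α : Fin n) (κ : Fin r → Fin n) :
    asym q (r + 1) (Fin.cons α κ) = (∏ j, qsign q α (κ j)) * asym q r κ := rfl

/-- The twist `c` closes the induction: fixing the first index `α` gives a function of the same form
with `c β` replaced by `c β * qsign q α β`. -/
lemma asym_mem {K : Type u} [AddCommGroup K] [Module ℂ K] {q : ℂ} (e₀ : K) :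
    ∀ {r : ℕ} (c : Fin n → ℂ),
    (fun κ : Fin r → Fin n => ((∏ j, c (κ j)) * asym q r κ) • e₀) ∈ anti n K q r
  | 0, _ => Submodule.mem_top
  | 1, _ => Submodule.mem_top
  | r + 2, c => by
    refine ⟨fun α => ?_, fun κ a b => ⟨fun hab => ?_, fun hab => ?_⟩⟩
    · have : (fun κ : Fin (r + 1) → Fin n => ((∏ j, c ((Fin.cons α κ : Fin (r + 2) → Fin n) j)) *
          asym q (r + 2) (Fin.cons α κ)) • e₀)
          = c α • fun κ : Fin (r + 1) → Fin n =>
            ((∏ j, (c (κ j) * qsign q α (κ j))) * asym q (r + 1) κ) • e₀ := by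
        funext κ
        rw [Pi.smul_apply, smul_smul, Fin.prod_univ_succ, asym_cons, Finset.prod_mul_distrib]
        congr 1
        simp only [Fin.cons_zero, Fin.cons_succ]
        ring
      rw [this]
      exact Submodule.smul_mem _ _ (asym_mem e₀ fun β => c β * qsign q α β)
    · simp [asym_cons, Fin.prod_univ_succ, qsign, hab]
    · rw [smul_smul]
      simp only [asym_cons, Fin.prod_univ_succ, Fin.cons_zero, Fin.cons_succ]
      have h1 : qsign q b a = -q⁻¹ := by rw [qsign, if_neg hab.not_gt, if_pos hab]
      have h2 : qsign q a b = 1 := by rw [qsign, if_pos hab]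
      rw [h1, h2]
      congr 1
      ring

lemma asym_ne_zero {q : ℂ} (hq : q ≠ 0) : ∀ {r : ℕ} {κ : Fin r → Fin n}, Function.Injective κ →
    asym q r κ ≠ 0
  | 0, _, _ => one_ne_zero
  | r + 1, κ, hκ => by
    refine mul_ne_zero (Finset.prod_ne_zero_iff.2 fun j _ => ?_)
      (asym_ne_zero hq (hκ.comp (Fin.succ_injective r)))
    rw [qsign]
    split_ifs with h1 h2
    · exact one_ne_zero
    · exact neg_ne_zero.2 (inv_ne_zero hq)
    · exact absurd (hκ (le_antisymm (not_lt.1 h2) (not_lt.1 h1))) (Fin.succ_ne_zero j).symm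

lemma asym_strictMono {q : ℂ} : ∀ {r : ℕ} {κ : Fin r → Fin n}, StrictMono κ → asym q r κ = 1
  | 0, _, _ => rfl
  | r + 1, κ, hκ => by
    rw [asym, asym_strictMono (κ := Fin.tail κ) (hκ.comp Fin.strictMono_succ), mul_one]
    exact Finset.prod_eq_one fun j _ => by rw [qsign, if_pos (hκ (Fin.succ_pos j))]

end vacuum

/-! ### Entries of the inhomogeneous monodromy matrix on repetition-free tuples -/

section entries
variable {n : ℕ} {q u : ℂ}

lemma Rmat_apply_of_ne {v : ℂ} {a α b β : Fin n} (hα : α ≠ a) (hβ : β ≠ a) :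
    Rmat n q u v (a, α) (b, β) = if b = a ∧ β = α then 1 else 0 := by
  rw [Rmat_apply, if_neg hα.symm]
  split_ifs with h1 h2
  · rfl
  · exact absurd h2.2 hβ
  · rfl

lemma inhomogeneous_of_notMem (a : Fin n) : ∀ {r : ℕ} {x : Fin r → ℂ} (b : Fin n)
    {κ κ' : Fin r → Fin n}, (∀ j, κ j ≠ a) → (∀ j, κ' j ≠ a) →
    inhomogeneous n q x u a b κ κ' = if b = a ∧ κ' = κ then 1 else 0
  | 0, x, b, κ, κ', _, _ => by
    rw [inhomogeneous_zero, Matrix.one_apply, Subsingleton.elim κ' κ]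
    by_cases hab : a = b
    · simp [hab]
    · simp [hab, Ne.symm hab]
  | r + 1, x, b, κ, κ', h1, h2 => by
    obtain ⟨α, κ, rfl⟩ := exists_cons κ
    obtain ⟨β, κ', rfl⟩ := exists_cons κ'
    have hα : α ≠ a := h1 0
    have hβ : β ≠ a := h2 0
    have ih := fun l => inhomogeneous_of_notMem a (x := Fin.tail x) l (κ := κ) (κ' := κ')
      (fun j => h1 j.succ) (fun j => h2 j.succ)
    rw [inhomogeneous_cons, Finset.sum_eq_single a]
    · rw [ih, Rmat_apply_of_ne hα hβ]
      simp only [Fin.cons_inj, true_and, mul_ite, mul_one, mul_zero, ← ite_and]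
      congr 1
      exact propext ⟨fun hh => ⟨hh.2.1, hh.2.2, hh.1⟩, fun hh => ⟨hh.2.2, hh.1, hh.2.1⟩⟩
    · intro l _ hl
      rw [ih, if_neg fun hh => hl hh.1, mul_zero]
    · exact fun hh => absurd (Finset.mem_univ _) hh

/-- The row index `a` meets the last site first, where it finds the same colour and picks up `f`; no
other site contains `a`, so there it passes with amplitude `1`. -/
lemma inhomogeneous_of_last (a : Fin n) : ∀ {r : ℕ} {x : Fin (r + 1) → ℂ} (b : Fin n)
    {κ κ' : Fin (r + 1) → Fin n}, Function.Injective κ → Function.Injective κ' →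
    κ (Fin.last r) = a → inhomogeneous n q x u a b κ κ' =
      if b = a ∧ κ' = κ then f q u (x (Fin.last r)) else 0
  | 0, x, b, κ, κ', _, _, hlast => by
    obtain ⟨α, κ, rfl⟩ := exists_cons κ
    obtain ⟨β, κ', rfl⟩ := exists_cons κ'
    obtain rfl : α = a := hlast
    rw [inhomogeneous_cons, Finset.sum_eq_single α, inhomogeneous_zero, Rmat_apply, if_pos rfl,
      Subsingleton.elim κ' κ]
    · simp [Fin.cons_inj]
    · intro l _ hl
      simp [inhomogeneous_zero, Ne.symm hl]
    · exact fun hh => absurd (Finset.mem_univ _) hh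
  | r + 1, x, b, κ, κ', h1, h2, hlast => by
    obtain ⟨α, κ, rfl⟩ := exists_cons κ
    obtain ⟨β, κ', rfl⟩ := exists_cons κ'
    have h1' : Function.Injective κ := fun i j hij =>
      Fin.succ_injective _ (h1 (a₁ := i.succ) (a₂ := j.succ) hij)
    have h2' : Function.Injective κ' := fun i j hij =>
      Fin.succ_injective _ (h2 (a₁ := i.succ) (a₂ := j.succ) hij)
    have hα : α ≠ a := by
      intro hh
      have := h1 (a₁ := 0) (a₂ := Fin.last (r + 1)) (hh.trans hlast.symm)
      exact absurd this (Fin.last_pos).ne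
    have ih := fun l => inhomogeneous_of_last a (x := Fin.tail x) l h1' h2' hlast
    rw [inhomogeneous_cons, Finset.sum_eq_single a]
    · rw [ih]
      by_cases hκ : κ' = κ
      · subst hκ
        have hβ : β ≠ a := by
          intro hh
          have := h2 (a₁ := 0) (a₂ := Fin.last (r + 1)) (hh.trans hlast.symm)
          exact absurd this (Fin.last_pos).ne
        rw [if_pos ⟨rfl, rfl⟩, Rmat_apply_of_ne hα hβ, ite_mul, one_mul, zero_mul]
        simp only [Fin.cons_inj, and_true]
        rfl
      · rw [if_neg fun hh => hκ hh.2, mul_zero, if_neg]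
        exact fun hh => hκ (Fin.cons_inj.1 hh.2).2
    · intro l _ hl
      rw [ih, if_neg fun hh => hl hh.1, mul_zero]
    · exact fun hh => absurd (Finset.mem_univ _) hh

end entries

lemma chain_last (q ξ : ℂ) : ∀ r : ℕ, chain q ξ (r + 1) (Fin.last r) = ξ
  | 0 => by simp [chain]
  | r + 1 => chain_last q ξ r

lemma chain_apply (q ξ : ℂ) : ∀ (r : ℕ) (j : Fin r), ∃ i < r, chain q ξ r j = q ^ (2 * i) * ξ
  | r + 1, j => by
    induction j using Fin.cases with
    | zero => exact ⟨r, by omega, rfl⟩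
    | succ j =>
      obtain ⟨i, hi, e⟩ := chain_apply q ξ r j
      exact ⟨i, by omega, e⟩

/-! ### Fused models on `q`-antisymmetric functions -/

section chainModel
variable {n : ℕ} {q ξ : ℂ} {r : ℕ}

/-- The tuple `0, 1, …, r - 1`. -/
def baseTuple (hr : r ≤ n) : Fin r → Fin n := Fin.castLE hr

lemma baseTuple_strictMono (hr : r ≤ n) : StrictMono (baseTuple hr) := Fin.strictMono_castLE hr

lemma mem_content_baseTuple (hr : r ≤ n) {a : Fin n} :
    a ∈ content (baseTuple hr) ↔ (a : ℕ) < r := by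
  rw [mem_content]
  constructor
  · rintro ⟨j, rfl⟩
    exact j.2
  · exact fun hh => ⟨⟨a, hh⟩, rfl⟩

lemma eq_baseTuple (hr : r ≤ n) {κ : Fin r → Fin n} (hκ : StrictMono κ)
    (hc : content κ = content (baseTuple hr)) : κ = baseTuple hr := by
  refine (hκ.range_inj (baseTuple_strictMono hr)).1 (Set.ext fun a => ?_)
  rw [Set.mem_range, Set.mem_range, ← mem_content, hc, mem_content]

/-- If `a` lies among the first `r` indices then so does `b < a`, and `b` occurs twice on the right
but at most once on the left. This is the triangularity argument for both vacua. -/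
lemma content_add_ne (hr : r ≤ n) {κ : Fin r → Fin n} (hκ : Function.Injective κ) {a b : Fin n}
    (hba : b < a) : {a} + content κ ≠ {b} + content (baseTuple hr) := by
  intro hh
  have h1 : a ∈ {b} + content (baseTuple hr) := hh ▸ by simp
  have ha : (a : ℕ) < r := by
    rcases Multiset.mem_add.1 h1 with h1 | h1
    · exact absurd (Multiset.mem_singleton.1 h1) hba.ne'
    · exact (mem_content_baseTuple hr).1 h1
  have hb : b ∈ content (baseTuple hr) := (mem_content_baseTuple hr).2 (lt_trans hba ha)
  have h2 := congrArg (Multiset.count b) hh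
  have h3 := Multiset.nodup_iff_count_le_one.1 (nodup_content.2 hκ) b
  have h4 := Multiset.one_le_count_iff_mem.2 hb
  rw [Multiset.count_add, Multiset.count_add, Multiset.count_singleton_self,
    Multiset.count_singleton, if_neg hba.ne] at h2
  omega

/-- The entries of the inhomogeneous monodromy matrix, as operators. -/
def chainOp (n : ℕ) (q ξ : ℂ) (r : ℕ) : Monodromy n ((Fin r → Fin n) → ULift.{u} ℂ) :=
  nestedMonodromy q (fun _ => 1) (chain q ξ r)

lemma chainOp_apply (w : ℂ) (a b : Fin n) (ψ : (Fin r → Fin n) → ULift.{u} ℂ)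
    (κ : Fin r → Fin n) : chainOp n q ξ r w a b ψ κ
      = ∑ κ', inhomogeneous n q (chain q ξ r) w a b κ κ' • ψ κ' := by
  rw [chainOp, nested_apply, Finset.sum_eq_single a]
  · simp
  · intro l _ hl
    refine Finset.sum_eq_zero fun κ' _ => ?_
    rw [Matrix.one_apply_ne fun hh => hl (Fin.succ_injective _ hh).symm]
    simp
  · exact fun hh => absurd (Finset.mem_univ _) hh

lemma chainOp_content {w : ℂ} {a b : Fin n} {κ κ' : Fin r → Fin n}
    (hne : inhomogeneous n q (chain q ξ r) w a b κ κ' ≠ 0) :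
    {a} + content κ = {b} + content κ' :=
  inhomogeneous_conserve (fun i => ({i} : Multiset (Fin n))) a hne

lemma chainOp_mask {w : ℂ} {a b : Fin n} (ψ : (Fin r → Fin n) → ULift.{u} ℂ)
    (κ : Fin r → Fin n) : chainOp n q ξ r w a b ψ κ = chainOp n q ξ r w a b
      (fun κ' => if {a} + content κ = {b} + content κ' then ψ κ' else 0) κ := by
  rw [chainOp_apply, chainOp_apply]
  refine Finset.sum_congr rfl fun κ' _ => ?_
  by_cases h0 : inhomogeneous n q (chain q ξ r) w a b κ κ' = 0
  · rw [h0, zero_smul, zero_smul]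
  · rw [if_pos (chainOp_content h0)]

/-- The pseudovacuum. -/
def chainVac (q : ℂ) (hr : r ≤ n) : (Fin r → Fin n) → ULift.{u} ℂ := fun κ =>
  if content κ = content (baseTuple hr) then asym q r κ • ULift.up 1 else 0

lemma chainVac_mem (hr : r ≤ n) : chainVac q hr ∈ anti n (ULift.{u} ℂ) q r := by
  have h1 := anti_mask (asym_mem (q := q) (r := r) (n := n) (ULift.up.{u} (1 : ℂ)) 1)
    fun s => s = content (baseTuple hr)
  simp only [Pi.one_apply, Finset.prod_const_one, one_mul] at h1
  exact h1

lemma chainVac_base (hr : r ≤ n) : chainVac.{u} q hr (baseTuple hr) = ULift.up 1 := by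
  rw [chainVac, if_pos rfl, asym_strictMono (baseTuple_strictMono hr), one_smul]

lemma chainVac_content {hr : r ≤ n} {κ : Fin r → Fin n} (hκ : chainVac.{u} q hr κ ≠ 0) :
    content κ = content (baseTuple hr) := by
  by_contra hh
  exact hκ (if_neg hh)

variable {w : ℂ}

lemma chainOp_mem (hw : ∀ j, w ≠ chain q ξ r j) (hq : q ≠ 0) (hq2 : q ^ 2 ≠ 1) (hξ : ξ ≠ 0)
    (a b : Fin n) {ψ : (Fin r → Fin n) → ULift.{u} ℂ} (hψ : ψ ∈ anti n (ULift.{u} ℂ) q r) :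
    chainOp n q ξ r w a b ψ ∈ anti n (ULift.{u} ℂ) q r :=
  nested_mem_anti hq hq2 hξ _ a b hw hψ

lemma chainOp_lower (hw : ∀ j, w ≠ chain q ξ r j) (hq : q ≠ 0) (hq2 : q ^ 2 ≠ 1) (hξ : ξ ≠ 0)
    (hr : r ≤ n) {a b : Fin n} (hba : b < a) :
    chainOp n q ξ r w a b (chainVac.{u} q hr) = 0 := by
  refine anti_eq_zero (chainOp_mem hw hq hq2 hξ a b (chainVac_mem hr)) fun κ hκ => ?_
  change chainOp n q ξ r w a b (chainVac.{u} q hr) κ = 0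
  rw [chainOp_apply]
  refine Finset.sum_eq_zero fun κ' _ => ?_
  by_contra hne
  have h1 := chainOp_content (left_ne_zero_of_smul hne)
  rw [chainVac_content (right_ne_zero_of_smul hne)] at h1
  exact content_add_ne hr hκ.injective hba h1

/-- By conservation only one content contributes, and no increasing tuple has it; the corresponding
part of `ψ` is still antisymmetric, hence zero. -/
lemma chainOp_upper (hr : r ≤ n) {a b : Fin n} (hab : a < b)
    {ψ : (Fin r → Fin n) → ULift.{u} ℂ} (hψ : ψ ∈ anti n (ULift.{u} ℂ) q r) :
    chainOp n q ξ r w a b ψ (baseTuple hr) = 0 := by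
  have h0 : (fun κ => if {a} + content (baseTuple hr) = {b} + content κ then ψ κ else 0) = 0 :=
    anti_eq_zero (anti_mask hψ fun s => {a} + content (baseTuple hr) = {b} + s)
      fun κ hκ => if_neg fun hh => content_add_ne hr hκ.injective hab hh.symm
  rw [chainOp_mask, h0, map_zero]
  rfl

lemma up_eq_smul (k : ULift.{u} ℂ) : k = k.down • ULift.up 1 := by
  ext
  simp

/-- Only one increasing tuple has the base content, so antisymmetric functions of that content form
a line. Hence the vacuum is an eigenvector of diagonal entries. -/
lemma mask_eq_smul_chainVac (hr : r ≤ n) {ψ : (Fin r → Fin n) → ULift.{u} ℂ}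
    (hψ : ψ ∈ anti n (ULift.{u} ℂ) q r) :
    (fun κ => if content κ = content (baseTuple hr) then ψ κ else 0)
      = (ψ (baseTuple hr)).down • chainVac q hr := by
  rw [← sub_eq_zero]
  have h1 := anti_mask hψ fun s => s = content (baseTuple hr)
  refine anti_eq_zero (q := q) (Submodule.sub_mem _ h1
    (Submodule.smul_mem _ _ (chainVac_mem hr))) fun κ hκ => ?_
  by_cases hc : content κ = content (baseTuple hr)
  · obtain rfl := eq_baseTuple hr hκ hc
    simp only [Pi.sub_apply, Pi.smul_apply, if_true, chainVac_base]
    rw [← up_eq_smul, sub_self]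
  · simp [chainVac, hc]

lemma chainOp_diag (hw : ∀ j, w ≠ chain q ξ r j) (hq : q ≠ 0) (hq2 : q ^ 2 ≠ 1) (hξ : ξ ≠ 0)
    (hr : r ≤ n) (a : Fin n) : chainOp n q ξ r w a a (chainVac.{u} q hr)
      = (chainOp n q ξ r w a a (chainVac.{u} q hr) (baseTuple hr)).down • chainVac q hr := by
  rw [← mask_eq_smul_chainVac hr (chainOp_mem hw hq hq2 hξ a a (chainVac_mem hr))]
  funext κ
  split_ifs with hc
  · rfl
  · rw [chainOp_apply]
    refine Finset.sum_eq_zero fun κ' _ => ?_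
    by_contra hne
    have h1 := chainOp_content (left_ne_zero_of_smul hne)
    rw [chainVac_content (right_ne_zero_of_smul hne)] at h1
    exact hc (add_left_cancel h1)

lemma chainOp_diag_base (hr : r ≤ n) (a : Fin n) {ψ : (Fin r → Fin n) → ULift.{u} ℂ}
    (hψ : ψ ∈ anti n (ULift.{u} ℂ) q r) : (chainOp n q ξ r w a a ψ (baseTuple hr)).down
      = (chainOp n q ξ r w a a (chainVac.{u} q hr) (baseTuple hr)).down *
        (ψ (baseTuple hr)).down := by
  rw [chainOp_mask]
  have : (fun κ' => if {a} + content (baseTuple hr) = {a} + content κ' then ψ κ' else 0)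
      = (ψ (baseTuple hr)).down • chainVac q hr := by
    rw [← mask_eq_smul_chainVac hr hψ]
    funext κ
    congr 1
    exact propext ⟨fun hh => (add_left_cancel hh).symm, fun hh => by rw [hh]⟩
  rw [this, map_smul, Pi.smul_apply, ULift.smul_down, smul_eq_mul, mul_comm]

lemma chainVac_injective {hr : r ≤ n} {κ : Fin r → Fin n} (hκ : chainVac.{u} q hr κ ≠ 0) :
    Function.Injective κ := by
  rw [← nodup_content, chainVac_content hκ]
  exact nodup_content.2 (baseTuple_strictMono hr).injective

/-- The vacuum eigenvalues of the chain. -/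
lemma chainOp_eigenvalue (hw : ∀ j, w ≠ chain q ξ (r + 1) j) (hq : q ≠ 0) (hq2 : q ^ 2 ≠ 1)
    (hξ : ξ ≠ 0) (hr : r + 1 ≤ n) (a : Fin n) :
    (chainOp n q ξ (r + 1) w a a (chainVac.{u} q hr) (baseTuple hr)).down
      = if (a : ℕ) < r + 1 then f q w ξ else 1 := by
  -- The eigenvalue can be read off at any tuple of the vacuum content, where the vacuum does not
  -- vanish; it suffices to find one with a diagonal row of coefficients.
  have key : ∀ (κ : Fin (r + 1) → Fin n) (c : ℂ), Function.Injective κ →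
      content κ = content (baseTuple hr) →
      (∀ κ', chainVac.{u} q hr κ' ≠ 0 → inhomogeneous n q (chain q ξ (r + 1)) w a a κ κ'
        = if κ' = κ then c else 0) →
      (chainOp n q ξ (r + 1) w a a (chainVac.{u} q hr) (baseTuple hr)).down = c := by
    intro κ c hκ hc hκ'
    have h1 := congrFun (chainOp_diag.{u} hw hq hq2 hξ hr a) κ
    have h2 : chainOp n q ξ (r + 1) w a a (chainVac.{u} q hr) κ = c • chainVac q hr κ := by
      rw [chainOp_apply, Finset.sum_eq_single κ]
      · by_cases hv : chainVac.{u} q hr κ = 0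
        · rw [hv, smul_zero, smul_zero]
        · rw [hκ' κ hv, if_pos rfl]
      · intro κ' _ hne
        by_cases hv : chainVac.{u} q hr κ' = 0
        · rw [hv, smul_zero]
        · rw [hκ' κ' hv, if_neg hne, zero_smul]
      · exact fun hh => absurd (Finset.mem_univ _) hh
    rw [h2, Pi.smul_apply, chainVac, if_pos hc, smul_smul, smul_smul] at h1
    have h3 := congrArg ULift.down h1
    simp only [ULift.smul_down, smul_eq_mul, mul_one] at h3
    exact (mul_right_cancel₀ (asym_ne_zero hq hκ) h3).symm
  split_ifs with ha
  -- Placing `a` at the last site makes the relevant coefficients diagonal, with value `f(w, ξ)`,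
  -- since the last inhomogeneity is `ξ`.
  · set κ : Fin (r + 1) → Fin n := baseTuple hr ∘ Equiv.swap ⟨a, ha⟩ (Fin.last r) with hκdef
    have hκ : Function.Injective κ :=
      (baseTuple_strictMono hr).injective.comp (Equiv.injective _)
    refine key κ _ hκ ?_ fun κ' hκ' => ?_
    · exact Equiv.sum_comp (Equiv.swap (⟨a, ha⟩ : Fin (r + 1)) (Fin.last r))
        fun j => ({baseTuple hr j} : Multiset (Fin n))
    · rw [inhomogeneous_of_last a a hκ (chainVac_injective hκ'), chain_last]
      · simp
      · simp only [hκdef, Function.comp_apply, Equiv.swap_apply_right]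
        rfl
  · have h0 : ∀ κ : Fin (r + 1) → Fin n, content κ = content (baseTuple hr) → ∀ j, κ j ≠ a := by
      rintro κ hκ j rfl
      refine ha ((mem_content_baseTuple hr).1 ?_)
      rw [← hκ, mem_content]
      exact ⟨j, rfl⟩
    refine key (baseTuple hr) _ (baseTuple_strictMono hr).injective rfl fun κ' hκ' => ?_
    rw [inhomogeneous_of_notMem a a (h0 _ rfl) (h0 _ (chainVac_content hκ'))]
    simp

open Classical in
/-- The model on the `q`-antisymmetric functions of `r + 1` indices. -/
def chainModel (hq : q ≠ 0) (hq2 : q ^ 2 ≠ 1) (hξ : ξ ≠ 0) (hr : r + 1 ≤ n) :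
    Model n q (anti n (ULift.{u} ℂ) q (r + 1)) where
  dom := {w | ∀ j, w ≠ chain q ξ (r + 1) j}
  T w a b := if hw : ∀ j, w ≠ chain q ξ (r + 1) j then
    (chainOp n q ξ (r + 1) w a b).restrict fun _ hψ => chainOp_mem hw hq hq2 hξ a b hψ else 0
  rtt w hw v hv hwv := by
    refine rtt_of_injective (T := chainOp n q ξ (r + 1)) (Submodule.subtype _)
      (Submodule.subtype_injective _) (rtt_nested hq ?_ hwv hw hv) ?_ ?_
    · rw [RTT]
      simp
    · intro a b ψ
      rw [dif_pos (show ∀ j, w ≠ chain q ξ (r + 1) j from hw)]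
      rfl
    · intro a b ψ
      rw [dif_pos (show ∀ j, v ≠ chain q ξ (r + 1) j from hv)]
      rfl
  vac := ⟨chainVac q hr, chainVac_mem hr⟩
  covac := ULift.moduleEquiv.toLinearMap ∘ₗ LinearMap.proj (baseTuple hr) ∘ₗ Submodule.subtype _
  lam a w := if (a : ℕ) < r + 1 then f q w ξ else 1
  diag_vac w hw a := by
    rw [dif_pos (show ∀ j, w ≠ chain q ξ (r + 1) j from hw)]
    refine Subtype.ext ?_
    refine (chainOp_diag hw hq hq2 hξ hr a).trans ?_
    rw [chainOp_eigenvalue hw hq hq2 hξ hr a]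
    rfl
  lower_vac w hw a b hab := by
    rw [dif_pos (show ∀ j, w ≠ chain q ξ (r + 1) j from hw)]
    exact Subtype.ext (chainOp_lower hw hq hq2 hξ hr hab)
  covac_diag w hw a := by
    rw [dif_pos (show ∀ j, w ≠ chain q ξ (r + 1) j from hw)]
    ext ψ
    refine (chainOp_diag_base hr a ψ.2).trans ?_
    rw [chainOp_eigenvalue hw hq hq2 hξ hr a]
    rfl
  covac_upper w hw a b hab := by
    rw [dif_pos (show ∀ j, w ≠ chain q ξ (r + 1) j from hw)]
    ext ψ
    exact congrArg ULift.down (chainOp_upper hr hab ψ.2)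
  covac_vac := by
    change (chainVac q hr (baseTuple hr)).down = 1
    rw [chainVac_base]

end chainModel

open scoped Kronecker TensorProduct

/-! ### One-dimensional models and tensor products of models -/

section diagonal
variable {m : ℕ} {q : ℂ}

lemma exch_diagonal {A : Type*} [Ring A] [Algebra ℂ A] {u v : ℂ} {d d' : Fin m → ℂ}
    (hd : ∀ a b, a ≠ b → h q u v a b * (d a * d' b) = h q u v a b * (d b * d' a)) :
    Exch q u v (Matrix.diagonal fun a => algebraMap ℂ A (d a))
      (Matrix.diagonal fun a => algebraMap ℂ A (d' a)) := by
  intro a c b e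
  set X := Matrix.diagonal fun a => algebraMap ℂ A (d a)
  set Y := Matrix.diagonal fun a => algebraMap ℂ A (d' a)
  rw [sum_Rmat_row (fun a' c' => X a' b * Y c' e), sum_Rmat_col (fun b' d' => Y c d' * X a b')]
  have hX : ∀ i, X i i = algebraMap ℂ A (d i) := fun i => Matrix.diagonal_apply_eq _ i
  have hY : ∀ i, Y i i = algebraMap ℂ A (d' i) := fun i => Matrix.diagonal_apply_eq _ i
  have hX' : ∀ i j, i ≠ j → X i j = 0 := fun i j hij => Matrix.diagonal_apply_ne _ hij
  have hY' : ∀ i j, i ≠ j → Y i j = 0 := fun i j hij => Matrix.diagonal_apply_ne _ hij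
  by_cases hac : a = c
  · subst hac
    by_cases hbe : b = e
    · subst hbe
      by_cases hab : a = b
      · subst hab
        rw [if_pos rfl, if_pos rfl, hX, hY, ← map_mul, ← map_mul, mul_comm]
      · simp [hX' a b hab, hY' a b hab]
    · rw [if_pos rfl, if_neg hbe]
      by_cases hab : a = b
      · subst hab
        simp [hY' a e hbe, hX' a e hbe]
      · simp [hX' a b hab, hY' a b hab]
  · rw [if_neg hac]
    by_cases hbe : b = e
    · subst hbe
      rw [if_pos rfl]
      by_cases hab : a = b
      · subst hab
        simp [hY' c a (Ne.symm hac), hX' c a (Ne.symm hac)]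
      · simp [hX' a b hab, hY' a b hab]
    · rw [if_neg hbe]
      by_cases hab : a = b
      · subst hab
        by_cases hce : c = e
        · subst hce
          simp [hX' c a (Ne.symm hac), hX' a c hac, hX, hY, ← map_mul, mul_comm]
        · simp [hX' c a (Ne.symm hac), hY' c e hce, hY' c a (Ne.symm hac)]
      · by_cases hcb : c = b
        · subst hcb
          by_cases hae : a = e
          · subst hae
            have := hd a c hac
            simp only [hX, hY, hX' a c hac, zero_mul, zero_add, hY' c a (Ne.symm hac),
              ← map_mul, Algebra.smul_def]
            exact congrArg (algebraMap ℂ A) (by linear_combination -this)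
          · simp [hX' a c hac, hY' a e hae, hX' a e hae, hY' c e hbe]
        · simp [hX' a b hab, hX' c b hcb, hY' c b hcb]

/-- A one-dimensional model. -/
def diagModel (dom : Set ℂ) (lam : Fin m → ℂ → ℂ)
    (hlam : ∀ u ∈ dom, ∀ v ∈ dom, ∀ a b, a ≠ b → u ≠ v →
      h q u v a b * (lam a u * lam b v) = h q u v a b * (lam b u * lam a v)) :
    Model m q (ULift.{u} ℂ) where
  dom := dom
  T u := Matrix.diagonal fun a => algebraMap ℂ (Module.End ℂ (ULift.{u} ℂ)) (lam a u)
  rtt u hu v hv huv := rtt_iff.2 (exch_diagonal fun a b hab => hlam u hu v hv a b hab huv)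
  vac := ULift.up 1
  covac := ULift.moduleEquiv.toLinearMap
  lam := lam
  diag_vac u _ a := by rw [Matrix.diagonal_apply_eq]; rfl
  lower_vac u _ a b hab := by rw [Matrix.diagonal_apply_ne _ hab.ne']; rfl
  covac_diag u _ a := by
    rw [Matrix.diagonal_apply_eq]
    ext
    simp
  covac_upper u _ a b hab := by
    rw [Matrix.diagonal_apply_ne _ hab.ne, LinearMap.comp_zero]
  covac_vac := rfl

end diagonal

section tensor
variable {m : ℕ} {q : ℂ} {H₁ H₂ : Type u} [AddCommGroup H₁] [Module ℂ H₁] [AddCommGroup H₂]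
  [Module ℂ H₂]

/-- The monodromy matrix of the tensor product of two models. -/
def tensorT (T₁ : Monodromy m H₁) (T₂ : Monodromy m H₂) : Monodromy m (H₁ ⊗[ℂ] H₂) := fun u =>
  (T₁ u).map (Module.End.rTensorAlgHom ℂ H₁ H₂) * (T₂ u).map (Module.End.lTensorAlgHom ℂ H₂ H₁)

lemma tensorT_tmul (T₁ : Monodromy m H₁) (T₂ : Monodromy m H₂) (u : ℂ) (a b : Fin m) (φ : H₁)
    (ψ : H₂) : tensorT T₁ T₂ u a b (φ ⊗ₜ ψ) = ∑ l, T₁ u a l φ ⊗ₜ T₂ u l b ψ := by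
  rw [tensorT, Matrix.mul_apply, LinearMap.sum_apply]
  rfl

/-- The tensor product of two models. -/
def Model.tensor (M₁ : Model m q H₁) (M₂ : Model m q H₂) : Model m q (H₁ ⊗[ℂ] H₂) where
  dom := M₁.dom ∩ M₂.dom
  T := tensorT M₁.T M₂.T
  rtt u hu v hv huv := by
    refine rtt_iff.2 (Exch.mul ((rtt_iff.1 (M₁.rtt u hu.1 v hv.1 huv)).map _)
      ((rtt_iff.1 (M₂.rtt u hu.2 v hv.2 huv)).map _) ?_ ?_) <;>
    · intro a b c d
      exact TensorProduct.ext' fun φ ψ => rfl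
  vac := M₁.vac ⊗ₜ M₂.vac
  covac := LinearMap.mul' ℂ ℂ ∘ₗ TensorProduct.map M₁.covac M₂.covac
  lam a u := M₁.lam a u * M₂.lam a u
  diag_vac u hu a := by
    rw [tensorT_tmul, Finset.sum_eq_single a]
    · rw [M₁.diag_vac u hu.1, M₂.diag_vac u hu.2, TensorProduct.smul_tmul_smul]
    · intro l _ hl
      rcases lt_or_gt_of_ne hl with hl | hl
      · rw [M₁.lower_vac u hu.1 _ _ hl, TensorProduct.zero_tmul]
      · rw [M₂.lower_vac u hu.2 _ _ hl, TensorProduct.tmul_zero]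
    · exact fun hh => absurd (Finset.mem_univ _) hh
  lower_vac u hu a b hab := by
    rw [tensorT_tmul]
    refine Finset.sum_eq_zero fun l _ => ?_
    rcases lt_or_ge l a with hl | hl
    · rw [M₁.lower_vac u hu.1 _ _ hl, TensorProduct.zero_tmul]
    · rw [M₂.lower_vac u hu.2 _ _ (hab.trans_le hl), TensorProduct.tmul_zero]
  covac_diag u hu a := by
    refine TensorProduct.ext' fun φ ψ => ?_
    have h1 := LinearMap.congr_fun (M₁.covac_diag u hu.1 a) φ
    have h2 := LinearMap.congr_fun (M₂.covac_diag u hu.2 a) ψ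
    simp only [LinearMap.comp_apply, LinearMap.smul_apply, smul_eq_mul] at h1 h2
    rw [LinearMap.comp_apply, tensorT_tmul, map_sum, Finset.sum_eq_single a]
    · simp [h1, h2]
      ring
    · intro l _ hl
      rcases lt_or_gt_of_ne hl with hl | hl
      · have := LinearMap.congr_fun (M₂.covac_upper u hu.2 _ _ hl) ψ
        simp only [LinearMap.comp_apply, LinearMap.zero_apply] at this
        simp [this]
      · have := LinearMap.congr_fun (M₁.covac_upper u hu.1 _ _ hl) φ
        simp only [LinearMap.comp_apply, LinearMap.zero_apply] at this
        simp [this]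
    · exact fun hh => absurd (Finset.mem_univ _) hh
  covac_upper u hu a b hab := by
    refine TensorProduct.ext' fun φ ψ => ?_
    rw [LinearMap.comp_apply, tensorT_tmul, map_sum]
    refine Finset.sum_eq_zero fun l _ => ?_
    rcases lt_or_ge l b with hl | hl
    · have := LinearMap.congr_fun (M₂.covac_upper u hu.2 _ _ hl) ψ
      simp only [LinearMap.comp_apply, LinearMap.zero_apply] at this
      simp [this]
    · have := LinearMap.congr_fun (M₁.covac_upper u hu.1 _ _ (hab.trans_le hl)) φ
      simp only [LinearMap.comp_apply, LinearMap.zero_apply] at this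
      simp [this]
  covac_vac := by simp [M₁.covac_vac, M₂.covac_vac]

end tensor

/-! ### Realizable vacuum eigenvalues and independence of the monomials -/

section realizable
variable {m : ℕ} {q : ℂ} {ι : Type*} {x : ι → ℂ}

/-- The vacuum eigenvalues at the points `x`, for all models. -/
def realizable (m : ℕ) (q : ℂ) (x : ι → ℂ) : Submonoid (ι → Fin m → ℂ) where
  carrier := {Λ | ∃ (H : Type u) (_ : AddCommGroup H) (_ : Module ℂ H) (M : Model m q H),
    ∀ p, x p ∈ M.dom ∧ ∀ a, M.lam a (x p) = Λ p a}
  one_mem' := ⟨ULift.{u} ℂ, inferInstance, inferInstance,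
    diagModel Set.univ (fun _ _ => 1) (fun _ _ _ _ _ _ _ _ => rfl),
    fun _ => ⟨Set.mem_univ _, fun _ => rfl⟩⟩
  mul_mem' := by
    rintro Λ₁ Λ₂ ⟨H₁, _, _, M₁, h₁⟩ ⟨H₂, _, _, M₂, h₂⟩
    refine ⟨H₁ ⊗[ℂ] H₂, inferInstance, inferInstance, M₁.tensor M₂,
      fun p => ⟨⟨(h₁ p).1, (h₂ p).1⟩, fun a => ?_⟩⟩
    rw [Pi.mul_apply, Pi.mul_apply, ← (h₁ p).2 a, ← (h₂ p).2 a]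
    rfl

/-- Here `q = q⁻¹`, so the exchange amplitudes vanish and scalar diagonal matrices with arbitrary
entries satisfy the RTT-relation. -/
lemma mem_realizable_of_sq (hq2 : q ^ 2 = 1) (hx : Function.Injective x) (Λ : ι → Fin m → ℂ) :
    Λ ∈ realizable.{u} m q x := by
  classical
  have hg : ∀ u v, g q u v = 0 := by
    intro u v
    have : q - q⁻¹ = 0 := sub_eq_zero.2 (eq_inv_of_mul_eq_one_left (by rw [← sq, hq2]))
    rw [g, this, zero_div]
  refine ⟨ULift.{u} ℂ, inferInstance, inferInstance,
    diagModel Set.univ (fun a u => if hu : ∃ p, x p = u then Λ hu.choose a else 0)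
      (fun u _ v _ a b _ _ => by simp [h, hg]), fun p => ⟨Set.mem_univ _, fun a => ?_⟩⟩
  have hu : ∃ p', x p' = x p := ⟨p, rfl⟩
  change (if hu : ∃ p', x p' = x p then Λ hu.choose a else 0) = _
  rw [dif_pos hu, hx hu.choose_spec]

lemma mem_realizable_chain (hq : q ≠ 0) (hq2 : q ^ 2 ≠ 1) {ξ : ℂ} (hξ : ξ ≠ 0) {r : ℕ}
    (hr : r + 1 ≤ m) (hx : ∀ p, ∀ i < r + 1, x p ≠ q ^ (2 * i) * ξ) :
    (fun p (a : Fin m) => if (a : ℕ) < r + 1 then f q (x p) ξ else 1)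
      ∈ realizable.{u} m q x := by
  refine ⟨_, inferInstance, inferInstance, chainModel.{u} hq hq2 hξ hr, fun p => ⟨fun j => ?_,
    fun a => rfl⟩⟩
  obtain ⟨i, hi, e⟩ := chain_apply q ξ (r + 1) j
  rw [e]
  exact hx p i hi

variable [Fintype ι]

/-- For `q² ≠ 1`, let `r + 1 = φ' p₀` and use the fused models with parameter `ξ`. The monomial of
`φ` contains `f(x_{p₀}, ξ)` and has a pole at `ξ = x_{p₀}`, which no zero of another factor can
cancel, while the monomial of `φ'` is regular there. -/
lemma exists_separating (hq : q ≠ 0) (hx : Function.Injective x)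
    (hU : q ^ 2 ≠ 1 → ∀ p p', q ^ 2 * x p ≠ x p') {φ φ' : ι → Fin m} {p₀ : ι}
    (hφ : φ p₀ < φ' p₀) :
    ∃ Λ ∈ realizable.{u} m q x, ∏ p, Λ p (φ p) ≠ ∏ p, Λ p (φ' p) := by
  classical
  by_cases hq2 : q ^ 2 = 1
  · refine ⟨fun p a => if p = p₀ ∧ a = φ p₀ then 2 else 1, mem_realizable_of_sq hq2 hx _, ?_⟩
    rw [Finset.prod_eq_single p₀, Finset.prod_eq_one]
    · simp
    · intro p _
      by_cases hp : p = p₀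
      · subst hp
        simp [hφ.ne']
      · simp [hp]
    · intro p _ hp
      simp [hp]
    · exact fun hh => absurd (Finset.mem_univ _) hh
  · by_contra! hall
    obtain ⟨r, hr⟩ : ∃ r, (φ' p₀ : ℕ) = r + 1 :=
      Nat.exists_eq_succ_of_ne_zero (lt_of_le_of_lt (Nat.zero_le _) hφ).ne'
    have hrm : r + 1 ≤ m := hr ▸ (φ' p₀).2.le
    -- The finitely many `ξ` at which the fused model is undefined at some `x p`, or `ξ = 0`.
    let S : Set ℂ := insert 0 (Set.range fun y : ι × Fin (r + 1) => x y.1 / q ^ (2 * (y.2 : ℕ)))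
    have hSfin : S.Finite := (Set.finite_range _).insert _
    let num : (ι → Fin m) → ℂ → ℂ := fun φ ξ =>
      ∏ p, if (φ p : ℕ) < r + 1 then q * x p - q⁻¹ * ξ else 1
    let den : (ι → Fin m) → ℂ → ℂ := fun φ ξ =>
      ∏ p, if (φ p : ℕ) < r + 1 then x p - ξ else 1
    have key : ∀ ξ ∉ S, num φ ξ * den φ' ξ = num φ' ξ * den φ ξ := by
      intro ξ hξ
      have hξ0 : ξ ≠ 0 := fun hh => hξ (Set.mem_insert_iff.2 (Or.inl hh))
      have hξx : ∀ p, ∀ i < r + 1, x p ≠ q ^ (2 * i) * ξ := by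
        intro p i hi hh
        refine hξ (Set.mem_insert_iff.2 (Or.inr ⟨(p, ⟨i, hi⟩), ?_⟩))
        simp only [hh]
        exact mul_div_cancel_left₀ _ (pow_ne_zero _ hq)
      have hden : ∀ φ, den φ ξ ≠ 0 := by
        intro φ
        refine Finset.prod_ne_zero_iff.2 fun p _ => ?_
        split_ifs
        · refine sub_ne_zero.2 ?_
          have := hξx p 0 (Nat.succ_pos _)
          simpa using this
        · exact one_ne_zero
      have hdiv : ∀ φ : ι → Fin m, ∏ p, (if (φ p : ℕ) < r + 1 then f q (x p) ξ else 1)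
          = num φ ξ / den φ ξ := by
        intro φ
        rw [← Finset.prod_div_distrib]
        refine Finset.prod_congr rfl fun p _ => ?_
        split_ifs
        · rfl
        · rw [div_one]
      have := hall _ (mem_realizable_chain hq hq2 hξ0 hrm hξx)
      rw [hdiv, hdiv, div_eq_div_iff (hden _) (hden _)] at this
      exact this
    have hcn : ∀ φ, Continuous (num φ) := fun φ => continuous_finsetProd _ fun p _ => by
      split_ifs <;> fun_prop
    have hcd : ∀ φ, Continuous (den φ) := fun φ => continuous_finsetProd _ fun p _ => by
      split_ifs <;> fun_prop
    -- After clearing denominators both sides are continuous in `ξ`, so the identity extends to the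
    -- excluded value `ξ = x p₀`.
    have hdense : Dense Sᶜ := hSfin.countable.dense_compl ℂ
    have hfun : (fun ξ => num φ ξ * den φ' ξ) = fun ξ => num φ' ξ * den φ ξ :=
      Continuous.ext_on hdense ((hcn _).mul (hcd _)) ((hcn _).mul (hcd _)) fun ξ hξ => key ξ hξ
    have h0 := congrFun hfun (x p₀)
    have hz : den φ (x p₀) = 0 := by
      refine Finset.prod_eq_zero (Finset.mem_univ p₀) ?_
      rw [if_pos (by rw [Fin.lt_def] at hφ; omega), sub_self]
    simp only [hz, mul_zero] at h0
    rcases mul_eq_zero.1 h0 with h1 | h1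
    · obtain ⟨p, -, hp⟩ := Finset.prod_eq_zero_iff.1 h1
      split_ifs at hp
      · refine hU hq2 p p₀ ?_
        have := congrArg (q * ·) hp
        simp only [mul_zero, mul_sub] at this
        rw [mul_inv_cancel_left₀ hq, ← mul_assoc, ← sq] at this
        exact sub_eq_zero.1 this
      · exact one_ne_zero hp
    · obtain ⟨p, -, hp⟩ := Finset.prod_eq_zero_iff.1 h1
      split_ifs at hp with hlt
      · have := hx (sub_eq_zero.1 hp)
        subst this
        omega
      · exact one_ne_zero hp

/-- Tensor products make the realizable eigenvalues a monoid and each labelling a multiplicative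
character of it; distinct characters are linearly independent. -/
theorem coeff_eq_zero [DecidableEq ι] (hq : q ≠ 0) (hx : Function.Injective x)
    (hU : q ^ 2 ≠ 1 → ∀ p p', q ^ 2 * x p ≠ x p') {C : (ι → Fin m) → ℂ}
    (hC : ∀ Λ ∈ realizable.{u} m q x, ∑ φ, C φ * ∏ p, Λ p (φ p) = 0) : C = 0 := by
  classical
  let χ : (ι → Fin m) → (realizable.{u} m q x →* ℂ) := fun φ =>
    { toFun := fun Λ => ∏ p, Λ.1 p (φ p)
      map_one' := by simp
      map_mul' := fun Λ₁ Λ₂ => by simp [Finset.prod_mul_distrib] }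
  have hinj : Function.Injective χ := by
    intro φ φ' hφ
    by_contra hne
    obtain ⟨p₀, hp₀⟩ := Function.ne_iff.1 hne
    have hall : ∀ Λ ∈ realizable.{u} m q x, ∏ p, Λ p (φ p) = ∏ p, Λ p (φ' p) := fun Λ hΛ =>
      DFunLike.congr_fun hφ ⟨Λ, hΛ⟩
    rcases lt_or_gt_of_ne hp₀ with hlt | hlt
    · obtain ⟨Λ, hΛ, h1⟩ := exists_separating hq hx hU hlt
      exact h1 (hall Λ hΛ)
    · obtain ⟨Λ, hΛ, h1⟩ := exists_separating hq hx hU hlt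
      exact h1 (hall Λ hΛ).symm
  have hlin := (linearIndependent_monoidHom (realizable.{u} m q x) ℂ).comp χ hinj
  rw [Fintype.linearIndependent_iff] at hlin
  funext φ
  refine hlin C ?_ φ
  funext Λ
  simp only [Finset.sum_apply, Pi.smul_apply, smul_eq_mul]
  exact hC Λ.1 Λ.2

end realizable

/-! ### Coefficients rational in the parameters and common to all models -/

section rational
variable {σ Z : Type*} (G : Set (σ → ℂ)) (π : Z → σ → ℂ)

/-- The functions on `Z` which are rational in the coordinates `π`, and regular on `G`. -/
def ratSubalgebra (hπ : ∀ z, π z ∈ G) : Subalgebra ℂ (Z → ℂ) where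
  carrier := {F | ∃ P Q : MvPolynomial σ ℂ, (∀ x ∈ G, MvPolynomial.eval x Q ≠ 0) ∧
    ∀ z, F z = MvPolynomial.eval (π z) P / MvPolynomial.eval (π z) Q}
  mul_mem' := by
    rintro F₁ F₂ ⟨P₁, Q₁, h₁, e₁⟩ ⟨P₂, Q₂, h₂, e₂⟩
    refine ⟨P₁ * P₂, Q₁ * Q₂, fun x hx => ?_, fun z => ?_⟩
    · rw [map_mul]
      exact mul_ne_zero (h₁ x hx) (h₂ x hx)
    · rw [Pi.mul_apply, e₁, e₂, map_mul, map_mul, div_mul_div_comm]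
  add_mem' := by
    rintro F₁ F₂ ⟨P₁, Q₁, h₁, e₁⟩ ⟨P₂, Q₂, h₂, e₂⟩
    refine ⟨P₁ * Q₂ + Q₁ * P₂, Q₁ * Q₂, fun x hx => ?_, fun z => ?_⟩
    · rw [map_mul]
      exact mul_ne_zero (h₁ x hx) (h₂ x hx)
    · rw [Pi.add_apply, e₁, e₂, div_add_div _ _ (h₁ _ (hπ z)) (h₂ _ (hπ z))]
      simp only [map_add, map_mul]
  algebraMap_mem' c := ⟨MvPolynomial.C c, 1, fun x _ => by simp, fun z => by simp⟩

variable {G π}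

lemma regularAt_ratSubalgebra {q : ℂ} (hπ : ∀ z, π z ∈ G) (hG : ∀ x ∈ G, Function.Injective x) :
    RegularAt (ratSubalgebra G π hπ) q π := by
  intro p p' hp n i j
  obtain ⟨a, b⟩ := i
  obtain ⟨c, d⟩ := j
  have hQ : ∀ x ∈ G, MvPolynomial.eval x (MvPolynomial.X p - MvPolynomial.X p') ≠ 0 := by
    intro x hx
    simp only [map_sub, MvPolynomial.eval_X]
    exact sub_ne_zero.2 fun hh => hp (hG x hx hh)
  have h1 : ∀ c : ℂ, (fun _ => c) ∈ ratSubalgebra G π hπ := fun c =>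
    (ratSubalgebra G π hπ).algebraMap_mem c
  have h2 : (fun z => f q (π z p) (π z p')) ∈ ratSubalgebra G π hπ :=
    ⟨MvPolynomial.C q * MvPolynomial.X p - MvPolynomial.C q⁻¹ * MvPolynomial.X p', _, hQ,
      fun z => by simp [f]⟩
  have h3 : (fun z => h q (π z p) (π z p') a b) ∈ ratSubalgebra G π hπ := by
    refine ⟨MvPolynomial.C (q - q⁻¹) * if a < b then MvPolynomial.X p else MvPolynomial.X p', _, hQ,
      fun z => ?_⟩
    simp only [h, g]
    split_ifs <;> simp <;> ring
  simp only [Rmat_apply]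
  split_ifs
  exacts [h2, h1 0, h1 1, h3, h1 0]

end rational

section points
variable {N : ℕ} {r : Fin N → ℕ}

/-- The parameters `s`. -/
def sOf (x : Idx r → ℂ) : Params r := fun k j => x (Sum.inl ⟨k, j⟩)

/-- The parameters `t`. -/
def tOf (x : Idx r → ℂ) : Params r := fun k j => x (Sum.inr ⟨k, j⟩)

lemma pairPts_of (x : Idx r → ℂ) : pairPts (sOf x) (tOf x) = x := by
  funext p; rcases p with p | p <;> rfl

/-- The generic points. -/
def genericSet (q : ℂ) (r : Fin N → ℕ) : Set (Idx r → ℂ) := {x | Generic q (sOf x) (tOf x)}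

lemma genericSet.injective {q : ℂ} {x : Idx r → ℂ} (hx : x ∈ genericSet q r) :
    Function.Injective x := by
  have := hx.2.2.1
  exact pairPts_of x ▸ this

lemma genericSet.ne_zero {q : ℂ} {x : Idx r → ℂ} (hx : x ∈ genericSet q r) (p : Idx r) :
    x p ≠ 0 := by
  rcases p with p | p
  · exact hx.1 p.1 p.2
  · exact hx.2.1 p.1 p.2

/-- A model together with a generic point in its domain. -/
structure Datum {N : ℕ} (q : ℂ) (r : Fin N → ℕ) where
  x : Idx r → ℂ
  generic : x ∈ genericSet q r
  H : Type u
  [grp : AddCommGroup H]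
  [mod : Module ℂ H]
  M : Model (N + 1) q H
  mem_dom : ∀ p, x p ∈ M.dom

attribute [instance] Datum.grp Datum.mod

/-- The rational functions of the parameters, regular at the generic points. -/
abbrev Datum.rat (q : ℂ) (r : Fin N → ℕ) : Subalgebra ℂ (Datum.{u} q r → ℂ) :=
  ratSubalgebra (genericSet q r) Datum.x Datum.generic

lemma Datum.suitable (q : ℂ) (r : Fin N → ℕ) :
    Suitable (Datum.rat.{u} q r) (fun z => z.M) (fun z => sOf z.x) (fun z => tOf z.x) := by
  refine ⟨fun z p => ?_, fun z p => ?_, fun z => ?_, ?_⟩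
  · rw [pairPts_of]; exact genericSet.ne_zero z.generic p
  · rw [pairPts_of]; exact z.mem_dom p
  · rw [pairPts_of]; exact genericSet.injective z.generic
  · simp only [pairPts_of]
    exact regularAt_ratSubalgebra _ fun x hx => genericSet.injective hx

/-- A rational expansion of the scalar product over monomials in the vacuum eigenvalues. -/
structure Expansion {N : ℕ} (q : ℂ) (r : Fin N → ℕ) where
  num : (Idx r → Fin (N + 1)) → MvPolynomial (Idx r) ℂ
  den : (Idx r → Fin (N + 1)) → MvPolynomial (Idx r) ℂ
  den_ne : ∀ φ, ∀ x ∈ genericSet q r, MvPolynomial.eval x (den φ) ≠ 0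
  eq : ∀ (H : Type u) [AddCommGroup H] [Module ℂ H] (M : Model (N + 1) q H) (x : Idx r → ℂ),
    x ∈ genericSet q r → (∀ p, x p ∈ M.dom) → preScalar M (sOf x) (tOf x) =
      ∑ φ, MvPolynomial.eval x (num φ) / MvPolynomial.eval x (den φ) * ∏ p, M.lam (φ p) (x p)

/-- The coefficients of an expansion. -/
def Expansion.coeff {q : ℂ} {r : Fin N → ℕ} (X : Expansion.{u} q r) (φ : Idx r → Fin (N + 1))
    (x : Idx r → ℂ) : ℂ := MvPolynomial.eval x (X.num φ) / MvPolynomial.eval x (X.den φ)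

/-- The index `z` runs over all models and generic points together, so a coefficient in `Datum.rat`
is a quotient of two polynomials that serve every model. -/
lemma exists_expansion_of {q : ℂ} (S : (Idx r → Fin (N + 1)) → Prop)
    (hC : ∃ C : (Idx r → Fin (N + 1)) → Datum.rat.{u} q r, (∀ φ, ¬ S φ → C φ = 0) ∧
      ∀ z : Datum q r, preScalar z.M (sOf z.x) (tOf z.x) = ∑ φ, (C φ : Datum q r → ℂ) z *
        ∏ p, z.M.lam (φ p) (pairPts (sOf z.x) (tOf z.x) p)) :
    ∃ X : Expansion.{u} q r, ∀ φ, ¬ S φ → X.num φ = 0 := by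
  classical
  obtain ⟨C, hC, e⟩ := hC
  have hex : ∀ φ, ∃ P Q : MvPolynomial (Idx r) ℂ, (∀ x ∈ genericSet q r,
      MvPolynomial.eval x Q ≠ 0) ∧ (∀ z : Datum q r, (C φ : Datum q r → ℂ) z =
        MvPolynomial.eval z.x P / MvPolynomial.eval z.x Q) ∧ (¬ S φ → P = 0) := by
    intro φ
    by_cases hS : S φ
    · obtain ⟨P, Q, h1, h2⟩ := (C φ).2
      exact ⟨P, Q, h1, h2, fun hh => absurd hS hh⟩
    -- For excluded labels the numerator is chosen to be the zero polynomial, so that vanishing is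
    -- available without reference to the existence of a model.
    · refine ⟨0, 1, fun x _ => by simp, fun z => ?_, fun _ => rfl⟩
      rw [hC φ hS]
      simp
  choose P Q h1 h2 h3 using hex
  refine ⟨⟨P, Q, h1, fun H _ _ M x hx hM => ?_⟩, h3⟩
  have := e ⟨x, hx, H, M, hM⟩
  simp only [pairPts_of, h2] at this
  exact this

theorem exists_expansion (q : ℂ) (r : Fin N → ℕ) : ∃ X : Expansion.{u} q r, ∀ φ,
    ¬ (∑ p, ({φ p} : Multiset (Fin (N + 1))) = ∑ p : Σ k, Fin (r k), {p.1.succ} +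
      ∑ p : Σ k, Fin (r k), {p.1.castSucc}) → X.num φ = 0 :=
  exists_expansion_of _ (Datum.suitable.{u} q r).exists_expansion

theorem exists_expansion_right {q : ℂ} (hq : q ≠ 0) {r : Fin N → ℕ} (k : Fin N) (j : Fin (r k))
    (hj : (j : ℕ) + 1 = r k) : ∃ X : Expansion.{u} q r, ∀ φ,
    ¬ (φ (Sum.inr ⟨k, j⟩) = k.castSucc ∨ φ (Sum.inr ⟨k, j⟩) = k.succ) → X.num φ = 0 :=
  exists_expansion_of _ ((Datum.suitable.{u} q r).exists_expansion_right hq k j hj)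

end points

/-! ### Good points and their density -/

/-- Points which are distinct and non-zero, and at which the functions `f` do not vanish. -/
structure GoodPt {ι : Type*} (q : ℂ) (x : ι → ℂ) : Prop where
  ne_zero : ∀ p, x p ≠ 0
  inj : Function.Injective x
  ne : ∀ p p', p ≠ p' → q ^ 2 * x p ≠ x p'

namespace GoodPt
variable {ι ι' : Type*} {q : ℂ} {x : ι → ℂ}

lemma comp (hx : GoodPt q x) {e : ι' → ι} (he : Function.Injective e) : GoodPt q (x ∘ e) :=
  ⟨fun _ => hx.ne_zero _, hx.inj.comp he, fun _ _ hp => hx.ne _ _ (he.ne hp)⟩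

lemma inv (hx : GoodPt q x) : GoodPt q⁻¹ (fun p => (x p)⁻¹) := by
  refine ⟨fun p => inv_ne_zero (hx.ne_zero p), fun p p' hp => hx.inj (inv_injective hp),
    fun p p' hp hh => hx.ne p p' hp ?_⟩
  rw [inv_pow, ← mul_inv] at hh
  exact inv_injective hh

lemma f_ne (hq : q ≠ 0) (hx : GoodPt q x) {p p' : ι} (hp : p ≠ p') : f q (x p) (x p') ≠ 0 := by
  refine div_ne_zero (fun hh => hx.ne p p' hp ?_) (sub_ne_zero.2 (hx.inj.ne hp))
  field_simp at hh
  linear_combination hh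

lemma generic {N : ℕ} {r : Fin N → ℕ} {x : Idx r → ℂ} (hq : q ≠ 0) (hx : GoodPt q x) :
    x ∈ genericSet q r := by
  refine ⟨fun k j => hx.ne_zero _, fun k j => hx.ne_zero _, ?_, fun k l hkl a b => ?_,
    fun k l hkl a b => ?_⟩
  · have := hx.inj
    rwa [← pairPts_of x] at this
  · refine hx.f_ne hq fun hh => ?_
    have := congrArg Sigma.fst (Sum.inl_injective hh)
    simp only at this
    rw [this] at hkl
    omega
  · refine hx.f_ne hq fun hh => ?_
    have := congrArg Sigma.fst (Sum.inr_injective hh)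
    simp only at this
    rw [this] at hkl
    omega

end GoodPt

open MvPolynomial in
/-- The good points are Zariski dense. -/
lemma eq_zero_of_good {ι : Type*} [Fintype ι] {q : ℂ} (P : MvPolynomial ι ℂ)
    (hP : ∀ x, GoodPt q x → eval x P = 0) : P = 0 := by
  classical
  -- The second factor vanishes at every point that is not good, so the product vanishes everywhere.
  have key : P * ((∏ p, X p) * ∏ p, ∏ p', if p = p' then 1 else
      (X p - X p') * (C (q ^ 2) * X p - X p')) = 0 := by
    refine MvPolynomial.funext fun x => ?_
    rw [map_mul, map_zero]
    by_cases hx : GoodPt q x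
    · rw [hP x hx, zero_mul]
    · refine mul_eq_zero_of_right _ ?_
      by_contra hne
      rw [map_mul, map_prod, map_prod] at hne
      have h1 := Finset.prod_ne_zero_iff.1 (left_ne_zero_of_mul hne)
      have h2 : ∀ p p', p ≠ p' → x p - x p' ≠ 0 ∧ q ^ 2 * x p - x p' ≠ 0 := by
        intro p p' hp
        have := Finset.prod_ne_zero_iff.1 (right_ne_zero_of_mul hne) p (Finset.mem_univ _)
        rw [map_prod] at this
        have := Finset.prod_ne_zero_iff.1 this p' (Finset.mem_univ _)
        rw [if_neg hp] at this
        simpa [mul_ne_zero_iff] using this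
      refine hx ⟨fun p => by simpa using h1 p (Finset.mem_univ _), fun p p' hh => ?_,
        fun p p' hp => sub_ne_zero.1 (h2 p p' hp).2⟩
      by_contra hp
      exact sub_ne_zero.1 (h2 p p' hp).1 hh
  refine (mul_eq_zero.1 key).resolve_right ?_
  refine mul_ne_zero (Finset.prod_ne_zero_iff.2 fun p _ => X_ne_zero p)
    (Finset.prod_ne_zero_iff.2 fun p _ => Finset.prod_ne_zero_iff.2 fun p' _ => ?_)
  split_ifs with hp
  · exact one_ne_zero
  · refine mul_ne_zero (fun hh => ?_) (fun hh => ?_)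
    all_goals
      -- At this point both linear factors equal `-1`, whatever `q` is.
      have := congrArg (eval (Pi.single p' 1)) hh
      simp [hp] at this

/-! ### Uniqueness, symmetry and colour restriction of the coefficients -/

section
variable {N : ℕ} {q : ℂ} {r : Fin N → ℕ}

/-- The difference of the two expansions vanishes for all realizable eigenvalues at `x`, so
`coeff_eq_zero` applies. It allows properties to be transferred between expansions obtained in
different ways. -/
lemma Expansion.coeff_unique (hq : q ≠ 0) (Y : Expansion.{u} q r) {x : Idx r → ℂ}
    (hx : GoodPt q x) (D : (Idx r → Fin (N + 1)) → ℂ)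
    (hD : ∀ (H : Type u) [AddCommGroup H] [Module ℂ H] (M : Model (N + 1) q H),
      (∀ p, x p ∈ M.dom) → preScalar M (sOf x) (tOf x) = ∑ φ, D φ * ∏ p, M.lam (φ p) (x p))
    (φ : Idx r → Fin (N + 1)) : Y.coeff φ x = D φ := by
  classical
  have : (fun φ => Y.coeff φ x - D φ) = 0 := by
    refine coeff_eq_zero.{u} (m := N + 1) hq hx.inj (fun h1 p p' hh => ?_) ?_
    · rcases eq_or_ne p p' with rfl | hp
      · exact h1 ((mul_eq_right₀ (hx.ne_zero p)).1 hh)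
      · exact hx.ne p p' hp hh
    · rintro Λ ⟨H, _, _, M, hM⟩
      have e1 := hD H M fun p => (hM p).1
      rw [Y.eq H M x (hx.generic hq) fun p => (hM p).1] at e1
      simp only [(hM _).2] at e1
      simp only [sub_mul, Finset.sum_sub_distrib]
      exact sub_eq_zero.2 e1
  exact sub_eq_zero.1 (congrFun this φ)

/-- The permutation of the Bethe parameters within their colours. -/
def permIdx (σ τ : ∀ k, Equiv.Perm (Fin (r k))) : Equiv.Perm (Idx r) :=
  Equiv.sumCongr (Equiv.sigmaCongrRight σ) (Equiv.sigmaCongrRight τ)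

lemma preBethe_perm_good (hq : q ≠ 0) {H : Type u} [AddCommGroup H] [Module ℂ H]
    (M : Model (N + 1) q H) {t : Params r} (ht : GoodPt q fun p : Σ k, Fin (r k) => t p.1 p.2)
    (hM : ∀ k j, t k j ∈ M.dom) (σ : ∀ k, Equiv.Perm (Fin (r k))) (v : H) :
    preBethe q N M.T (fun k => t k ∘ σ k) v = preBethe q N M.T t v := by
  refine preBethe_perm hq ⟨ht.inj, fun p p' hp => M.rtt _ (hM _ _) _ (hM _ _) (ht.inj.ne hp)⟩
    (fun k i j hij => ht.f_ne hq (p := ⟨k, i⟩) (p' := ⟨k, j⟩) fun hh => hij ?_) σ v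
  simpa using hh

lemma preScalar_perm (hq : q ≠ 0) {H : Type u} [AddCommGroup H] [Module ℂ H]
    (M : Model (N + 1) q H) {x : Idx r → ℂ} (hx : GoodPt q x) (hM : ∀ p, x p ∈ M.dom)
    (σ τ : ∀ k, Equiv.Perm (Fin (r k))) :
    preScalar M (sOf (x ∘ permIdx σ τ)) (tOf (x ∘ permIdx σ τ)) =
      preScalar M (sOf x) (tOf x) := by
  have h1 := preBethe_perm_good hq M (t := tOf x) (hx.comp Sum.inr_injective) (fun k j => hM _) τ
    M.vac
  have h2 := preBethe_perm_good (inv_ne_zero hq) M.dual (t := invParams (sOf x))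
    ((hx.inv).comp Sum.inl_injective)
    (fun k j => ⟨inv_ne_zero (hx.ne_zero _), by
      change ((x _)⁻¹)⁻¹ ∈ M.dom
      rw [inv_inv]; exact hM _⟩) σ M.covac
  rw [preScalar, preScalar, ← h1, ← h2]
  rfl

/-- The scalar product is symmetric within each colour, so permuting parameters and labels gives
another expansion of the same quantity. -/
lemma Expansion.coeff_perm_good (hq : q ≠ 0) (Y : Expansion.{u} q r) {x : Idx r → ℂ}
    (hx : GoodPt q x) (σ τ : ∀ k, Equiv.Perm (Fin (r k))) (φ : Idx r → Fin (N + 1)) :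
    Y.coeff φ x = Y.coeff (φ ∘ permIdx σ τ) (x ∘ permIdx σ τ) := by
  refine Y.coeff_unique hq hx (fun φ => Y.coeff (φ ∘ permIdx σ τ) (x ∘ permIdx σ τ))
    (fun H _ _ M hM => ?_) φ
  rw [← preScalar_perm hq M hx hM σ τ, Y.eq H M _ ((hx.comp (permIdx σ τ).injective).generic hq)
    fun p => hM _]
  rw [← (Equiv.arrowCongr (permIdx σ τ).symm (Equiv.refl (Fin (N + 1)))).sum_comp]
  refine Finset.sum_congr rfl fun ψ _ => ?_
  congr 1
  exact Equiv.prod_comp (permIdx σ τ) fun p => M.lam (ψ p) (x p)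

lemma NormalizationRegular.perm {t : Params r} (ht : NormalizationRegular q t)
    (σ : ∀ k, Equiv.Perm (Fin (r k))) : NormalizationRegular q fun k => t k ∘ σ k :=
  fun k l hkl a b => ht k l hkl (σ l a) (σ k b)

lemma genericSet.perm {x : Idx r → ℂ} (hx : x ∈ genericSet q r)
    (σ τ : ∀ k, Equiv.Perm (Fin (r k))) : x ∘ permIdx σ τ ∈ genericSet q r := by
  refine ⟨fun k j => genericSet.ne_zero hx _, fun k j => genericSet.ne_zero hx _, ?_,
    hx.2.2.2.1.perm σ, hx.2.2.2.2.perm τ⟩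
  have := (genericSet.injective hx).comp (permIdx σ τ).injective
  rwa [← pairPts_of (x ∘ permIdx σ τ)] at this

-- After cross-multiplication the symmetry at good points is a polynomial identity, valid at all
-- generic points by density.
open MvPolynomial in
theorem Expansion.coeff_perm (hq : q ≠ 0) (Y : Expansion.{u} q r) {x : Idx r → ℂ}
    (hx : x ∈ genericSet q r) (σ τ : ∀ k, Equiv.Perm (Fin (r k))) (φ : Idx r → Fin (N + 1)) :
    Y.coeff φ x = Y.coeff (φ ∘ permIdx σ τ) (x ∘ permIdx σ τ) := by
  have key : Y.num φ * rename (permIdx σ τ) (Y.den (φ ∘ permIdx σ τ))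
      - rename (permIdx σ τ) (Y.num (φ ∘ permIdx σ τ)) * Y.den φ = 0 := by
    refine eq_zero_of_good (q := q) _ fun y hy => ?_
    have e := Y.coeff_perm_good hq hy σ τ φ
    rw [coeff, coeff, div_eq_div_iff (Y.den_ne _ _ (hy.generic hq))
      (Y.den_ne _ _ (genericSet.perm (hy.generic hq) σ τ))] at e
    simp only [map_sub, map_mul, eval_rename]
    exact sub_eq_zero.2 e
  have e := congrArg (eval x) key
  simp only [map_sub, map_mul, eval_rename, map_zero] at e
  rw [coeff, coeff, div_eq_div_iff (Y.den_ne _ _ hx) (Y.den_ne _ _ (genericSet.perm hx σ τ))]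
  exact sub_eq_zero.1 e

lemma Expansion.num_eq_zero (hq : q ≠ 0) (Y : Expansion.{u} q r) (φ : Idx r → Fin (N + 1))
    (h0 : ∀ x, GoodPt q x → Y.coeff φ x = 0) : Y.num φ = 0 :=
  eq_zero_of_good (q := q) _ fun x hx =>
    (div_eq_zero_iff.1 (h0 x hx)).resolve_right (Y.den_ne _ _ (hx.generic hq))

lemma Expansion.coeff_last_right (hq : q ≠ 0) (Y : Expansion.{u} q r) {k : Fin N} {j : Fin (r k)}
    (hj : (j : ℕ) + 1 = r k) {φ : Idx r → Fin (N + 1)}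
    (hφ : ¬ (φ (Sum.inr ⟨k, j⟩) = k.castSucc ∨ φ (Sum.inr ⟨k, j⟩) = k.succ)) {x : Idx r → ℂ}
    (hx : GoodPt q x) : Y.coeff φ x = 0 := by
  obtain ⟨Y', hY'⟩ := exists_expansion_right.{u} hq k j hj
  rw [Y.coeff_unique hq hx (fun φ => Y'.coeff φ x)
    (fun H _ _ M hM => Y'.eq H M x (hx.generic hq) hM) φ, coeff, hY' φ hφ, map_zero, zero_div]

/-- The dual model at `q⁻¹` and inverted parameters exchanges `s` and `t`, so its restricted
expansion is one for the original scalar product. -/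
lemma Expansion.coeff_last_left (hq : q ≠ 0) (Y : Expansion.{u} q r) {k : Fin N} {j : Fin (r k)}
    (hj : (j : ℕ) + 1 = r k) {φ : Idx r → Fin (N + 1)}
    (hφ : ¬ (φ (Sum.inl ⟨k, j⟩) = k.castSucc ∨ φ (Sum.inl ⟨k, j⟩) = k.succ)) {x : Idx r → ℂ}
    (hx : GoodPt q x) : Y.coeff φ x = 0 := by
  obtain ⟨Y', hY'⟩ := exists_expansion_right.{u} (inv_ne_zero hq) k j hj
  have hx' : GoodPt q⁻¹ (fun p => (x p)⁻¹) := hx.inv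
  have hy := hx'.comp (Equiv.sumComm (Σ k, Fin (r k)) (Σ k, Fin (r k))).injective
  rw [Y.coeff_unique hq hx (fun φ => Y'.coeff (φ ∘ Equiv.sumComm _ _)
    ((fun p => (x p)⁻¹) ∘ Equiv.sumComm _ _)) (fun H _ _ M hM => ?_) φ, coeff, hY' _ hφ, map_zero,
    zero_div]
  rw [← preScalar_dual]
  refine (Y'.eq _ M.dual _ (hy.generic (inv_ne_zero hq)) fun p =>
    ⟨hy.ne_zero p, ?_⟩).trans ?_
  · simp only [Function.comp_apply, inv_inv]
    exact hM _
  rw [← (Equiv.arrowCongr (Equiv.sumComm _ _) (Equiv.refl (Fin (N + 1)))).sum_comp]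
  refine Finset.sum_congr rfl fun ψ _ => ?_
  congr 1
  refine Eq.trans (Finset.prod_congr rfl fun p _ => ?_)
    ((Equiv.sumComm (Σ k, Fin (r k)) (Σ k, Fin (r k))).prod_comp fun p => M.lam (ψ p) (x p))
  change M.lam _ (x _)⁻¹⁻¹ = _
  rw [inv_inv]
  rfl

/-- Only the vacuum eigenvalues `λ_k`, `λ_{k+1}` of the parameters of colour `k` contribute. -/
theorem Expansion.num_eq_zero_of_colour (hq : q ≠ 0) (Y : Expansion.{u} q r)
    {φ : Idx r → Fin (N + 1)} {k : Fin N} {j : Fin (r k)}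
    (hφ : ¬ (φ (Sum.inr ⟨k, j⟩) = k.castSucc ∨ φ (Sum.inr ⟨k, j⟩) = k.succ) ∨
      ¬ (φ (Sum.inl ⟨k, j⟩) = k.castSucc ∨ φ (Sum.inl ⟨k, j⟩) = k.succ)) : Y.num φ = 0 := by
  have hr : 0 < r k := j.pos
  let l : Fin (r k) := ⟨r k - 1, by omega⟩
  have hl : (l : ℕ) + 1 = r k := Nat.sub_add_cancel hr
  -- Swap the given parameter into the last place of its colour, where the restriction is known.
  let σ : ∀ k, Equiv.Perm (Fin (r k)) := Function.update 1 k (Equiv.swap l j)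
  have hσ : σ k l = j := by simp [σ]
  refine Y.num_eq_zero hq φ fun x hx => ?_
  rw [Y.coeff_perm_good hq hx σ σ]
  have hx' := hx.comp (permIdx σ σ).injective
  have e1 : permIdx σ σ (Sum.inr ⟨k, l⟩) = Sum.inr ⟨k, j⟩ := by simp [permIdx, hσ]
  have e2 : permIdx σ σ (Sum.inl ⟨k, l⟩) = Sum.inl ⟨k, j⟩ := by simp [permIdx, hσ]
  rcases hφ with hφ | hφ
  · exact Y.coeff_last_right hq hl (by rwa [Function.comp_apply, e1]) hx'
  · exact Y.coeff_last_left hq hl (by rwa [Function.comp_apply, e2]) hx'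

end

/-! ### Partitions of the parameters as labellings -/

section labels
variable {N : ℕ} {r : Fin N → ℕ}

/-- The monomial in the vacuum eigenvalues of a partition of the Bethe parameters. -/
def lab (I J : ∀ k, Finset (Fin (r k))) : Idx r → Fin (N + 1) :=
  Sum.elim (fun p => if p.2 ∈ I p.1 then p.1.castSucc else p.1.succ)
    (fun p => if p.2 ∈ J p.1 then p.1.succ else p.1.castSucc)

lemma sum_sigma_mem (I : ∀ k, Finset (Fin (r k))) (k : Fin N) :
    (∑ p : Σ k, Fin (r k), if p.1 = k ∧ p.2 ∈ I p.1 then 1 else 0) = (I k).card := by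
  rw [Fintype.sum_sigma, Finset.sum_eq_single k]
  · simp
  · intro l _ hl
    simp [hl]
  · simp

/-- Count the labels `≤ k` on both sides. Relative to the reference multiset, the sets `I_k` add
`#I_k` such labels and the sets `J_k` remove `#J_k`; other colours do not change the count. -/
lemma card_eq_of_lab {I J : ∀ k, Finset (Fin (r k))}
    (hIJ : ∑ p, ({lab I J p} : Multiset (Fin (N + 1))) = ∑ p : Σ k, Fin (r k), {p.1.succ} +
      ∑ p : Σ k, Fin (r k), {p.1.castSucc}) (k : Fin N) : (I k).card = (J k).card := by
  have key := congrArg (Multiset.countPAddMonoidHom (· ≤ k.castSucc)) hIJ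
  simp only [map_add, map_sum, Fintype.sum_sum_type, Multiset.coe_countPAddMonoidHom,
    ← Multiset.cons_zero, Multiset.countP_cons, Multiset.countP_zero, zero_add] at key
  have h1 : ∀ p : Σ k, Fin (r k), (if lab I J (Sum.inl p) ≤ k.castSucc then 1 else 0) =
      (if p.1.succ ≤ k.castSucc then 1 else 0) + if p.1 = k ∧ p.2 ∈ I p.1 then 1 else 0 := by
    rintro ⟨l, j⟩
    by_cases hj : j ∈ I l <;>
      simp only [lab, Sum.elim_inl, hj, if_true, if_false, and_true, and_false, Fin.le_def,
        Fin.ext_iff, Fin.val_succ, Fin.val_castSucc]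
    · split_ifs <;> omega
    · rfl
  have h2 : ∀ p : Σ k, Fin (r k), (if p.1.castSucc ≤ k.castSucc then 1 else 0) =
      (if lab I J (Sum.inr p) ≤ k.castSucc then 1 else 0) +
        if p.1 = k ∧ p.2 ∈ J p.1 then 1 else 0 := by
    rintro ⟨l, j⟩
    by_cases hj : j ∈ J l <;>
      simp only [lab, Sum.elim_inr, hj, if_true, if_false, and_true, and_false, Fin.le_def,
        Fin.ext_iff, Fin.val_succ, Fin.val_castSucc]
    · split_ifs <;> omega
    · rfl
  simp only [h1, h2, Finset.sum_add_distrib, sum_sigma_mem] at key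
  omega

lemma lab_injective : Function.Injective fun P : (∀ k, Finset (Fin (r k))) ×
    (∀ k, Finset (Fin (r k))) => lab P.1 P.2 := by
  rintro ⟨I, J⟩ ⟨I', J'⟩ hh
  have hne : ∀ k : Fin N, k.castSucc ≠ k.succ := fun k => Fin.castSucc_lt_succ.ne
  refine Prod.ext (funext fun k => Finset.ext fun j => ?_) (funext fun k => Finset.ext fun j => ?_)
  · have := congrFun hh (Sum.inl ⟨k, j⟩)
    by_cases h1 : j ∈ I k <;> by_cases h2 : j ∈ I' k <;>
      simp_all [lab, (hne k).symm]
  · have := congrFun hh (Sum.inr ⟨k, j⟩)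
    by_cases h1 : j ∈ J k <;> by_cases h2 : j ∈ J' k <;>
      simp_all [lab, (hne k).symm]

lemma exists_lab_eq {φ : Idx r → Fin (N + 1)}
    (hs : ∀ k j, φ (Sum.inl ⟨k, j⟩) = k.castSucc ∨ φ (Sum.inl ⟨k, j⟩) = k.succ)
    (ht : ∀ k j, φ (Sum.inr ⟨k, j⟩) = k.castSucc ∨ φ (Sum.inr ⟨k, j⟩) = k.succ) :
    ∃ I J, lab I J = φ := by
  refine ⟨fun k => Finset.univ.filter fun j => φ (Sum.inl ⟨k, j⟩) = k.castSucc,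
    fun k => Finset.univ.filter fun j => φ (Sum.inr ⟨k, j⟩) = k.succ, ?_⟩
  funext p
  rcases p with ⟨k, j⟩ | ⟨k, j⟩
  · simp only [lab, Sum.elim_inl, Finset.mem_filter, Finset.mem_univ, true_and]
    split_ifs with hh
    exacts [hh.symm, ((hs k j).resolve_left hh).symm]
  · simp only [lab, Sum.elim_inr, Finset.mem_filter, Finset.mem_univ, true_and]
    split_ifs with hh
    exacts [hh.symm, ((ht k j).resolve_right hh).symm]

end labels

/-! ### The coefficients `W_part` and the sum formula -/

section weight
variable {N : ℕ}

/-- The product `∏_k f(t^{k+1}, t^k)`. -/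
def fProd {r : Fin N → ℕ} (q : ℂ) (t : Params r) : ℂ :=
  ∏ k : Fin N, ∏ l : Fin N, if (l : ℕ) = k + 1 then ∏ a, ∏ b, f q (t l a) (t k b) else 1

lemma fProd_perm {r : Fin N → ℕ} (q : ℂ) (t : Params r) (σ : ∀ k, Equiv.Perm (Fin (r k))) :
    fProd q (fun k => t k ∘ σ k) = fProd q t := by
  refine Finset.prod_congr rfl fun k _ => Finset.prod_congr rfl fun l _ => ?_
  congr 1
  refine Eq.trans ?_ (Equiv.prod_comp (σ l) fun a => ∏ b, f q (t l a) (t k b))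
  exact Finset.prod_congr rfl fun a _ => Equiv.prod_comp (σ k) fun b => f q (t l (σ l a)) (t k b)

/-- A chosen expansion of the scalar product. -/
def expansion (q : ℂ) (r : Fin N → ℕ) : Expansion.{u} q r := (exists_expansion q r).choose

/-- The coefficients `W_part` in terms of enumerations of the Bethe parameters. -/
def weight {r : Fin N → ℕ} (q : ℂ) (s t : Params r) (I J : ∀ k, Finset (Fin (r k))) : ℂ :=
  (fProd q s)⁻¹ * (fProd q t)⁻¹ * (expansion.{u} q r).coeff (lab I J) (pairPts s t)

lemma Generic.injective_left {q : ℂ} {r : Fin N → ℕ} {s t : Params r} (hst : Generic q s t)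
    (k : Fin N) : Function.Injective (s k) := fun i j hij => by
  simpa using hst.2.2.1 (a₁ := Sum.inl ⟨k, i⟩) (a₂ := Sum.inl ⟨k, j⟩) hij

lemma Generic.injective_right {q : ℂ} {r : Fin N → ℕ} {s t : Params r} (hst : Generic q s t)
    (k : Fin N) : Function.Injective (t k) := fun i j hij => by
  simpa using hst.2.2.1 (a₁ := Sum.inr ⟨k, i⟩) (a₂ := Sum.inr ⟨k, j⟩) hij

lemma card_subsets {r : Fin N → ℕ} {s : Params r} (hs : ∀ k, Function.Injective (s k))
    (I : ∀ k, Finset (Fin (r k))) (k : Fin N) :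
    (subsets s I k).card + (subsets s (fun k => (I k)ᶜ) k).card = r k := by
  rw [subsets, subsets, Finset.card_image_of_injective _ (hs k),
    Finset.card_image_of_injective _ (hs k), Finset.card_add_card_compl, Fintype.card_fin]

lemma exists_perm_of_subsets {r : Fin N → ℕ} {s s' : Params r}
    (hs : ∀ k, Function.Injective (s k))
    {I I' : ∀ k, Finset (Fin (r k))} (h1 : subsets s I = subsets s' I')
    (h2 : (subsets s fun k => (I k)ᶜ) = subsets s' fun k => (I' k)ᶜ) :
    ∃ σ : ∀ k, Equiv.Perm (Fin (r k)), (fun k => s' k ∘ σ k) = s ∧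
      ∀ k j, σ k j ∈ I' k ↔ j ∈ I k := by
  have hex : ∀ k j, ∃ i, s' k i = s k j ∧ (i ∈ I' k ↔ j ∈ I k) := by
    intro k j
    by_cases hj : j ∈ I k
    · have : s k j ∈ subsets s I k := Finset.mem_image_of_mem _ hj
      rw [h1] at this
      obtain ⟨i, hi, e⟩ := Finset.mem_image.1 this
      exact ⟨i, e, by simp [hi, hj]⟩
    · have : s k j ∈ subsets s (fun k => (I k)ᶜ) k :=
        Finset.mem_image_of_mem _ (Finset.mem_compl.2 hj)
      rw [h2] at this
      obtain ⟨i, hi, e⟩ := Finset.mem_image.1 this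
      exact ⟨i, e, by simp [Finset.mem_compl.1 hi, hj]⟩
  choose σ hσ hσ' using hex
  have hinj : ∀ k, Function.Injective (σ k) := fun k i j hij => hs k (by rw [← hσ, ← hσ, hij])
  exact ⟨fun k => Equiv.ofBijective (σ k) (Finite.injective_iff_bijective.1 (hinj k)),
    funext fun k => funext fun j => hσ k j, hσ'⟩

/-- Two enumerations of the same subsets differ by permutations within colours that respect the
partitions, and both `fProd` and the coefficients are symmetric. Hence `Wpart` does not depend on
the enumeration chosen in its definition. -/
theorem weight_congr {q : ℂ} (hq : q ≠ 0) {r r' : Fin N → ℕ} {s t : Params r} {s' t' : Params r'}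
    (hst : Generic q s t) (hst' : Generic q s' t') {I J : ∀ k, Finset (Fin (r k))}
    {I' J' : ∀ k, Finset (Fin (r' k))} (h1 : subsets s I = subsets s' I')
    (h2 : (subsets s fun k => (I k)ᶜ) = subsets s' fun k => (I' k)ᶜ)
    (h3 : subsets t J = subsets t' J')
    (h4 : (subsets t fun k => (J k)ᶜ) = subsets t' fun k => (J' k)ᶜ) :
    weight.{u} q s t I J = weight.{u} q s' t' I' J' := by
  obtain rfl : r = r' := by
    funext k
    rw [← card_subsets hst.injective_left I, ← card_subsets hst'.injective_left I', h1, h2]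
  obtain ⟨σ, rfl, hσ⟩ := exists_perm_of_subsets hst.injective_left h1 h2
  obtain ⟨τ, rfl, hτ⟩ := exists_perm_of_subsets hst.injective_right h3 h4
  rw [weight, weight, fProd_perm, fProd_perm,
    (expansion.{u} q r).coeff_perm hq (x := pairPts s' t') hst' σ τ]
  congr 2
  · funext p
    rcases p with ⟨k, j⟩ | ⟨k, j⟩
    · simp [lab, permIdx, hσ]
    · simp [lab, permIdx, hτ]
  · funext p
    rcases p with p | p <;> rfl

open Classical in
/-- The coefficients `W_part`, as functions of the sets of Bethe parameters. -/
def Wpart (q : ℂ) (A₁ A₂ B₁ B₂ : ParamSets N) : ℂ :=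
  if hA : ∃ w : ℂ, ∃ (r : Fin N → ℕ) (s t : Params r) (I J : ∀ k, Finset (Fin (r k))),
    Generic q s t ∧ subsets s I = A₁ ∧ (subsets s fun k => (I k)ᶜ) = A₂ ∧ subsets t J = B₁ ∧
      (subsets t fun k => (J k)ᶜ) = B₂ ∧ w = weight.{u} q s t I J
  then hA.choose else 0

theorem Wpart_eq {q : ℂ} (hq : q ≠ 0) {r : Fin N → ℕ} {s t : Params r} (hst : Generic q s t)
    (I J : ∀ k, Finset (Fin (r k))) :
    Wpart.{u} q (subsets s I) (subsets s fun k => (I k)ᶜ) (subsets t J)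
      (subsets t fun k => (J k)ᶜ) = weight.{u} q s t I J := by
  have hA : ∃ w : ℂ, ∃ (r' : Fin N → ℕ) (s' t' : Params r') (I' J' : ∀ k, Finset (Fin (r' k))),
      Generic q s' t' ∧ subsets s' I' = subsets s I ∧
      (subsets s' fun k => (I' k)ᶜ) = (subsets s fun k => (I k)ᶜ) ∧ subsets t' J' = subsets t J ∧
      (subsets t' fun k => (J' k)ᶜ) = (subsets t fun k => (J k)ᶜ) ∧
      w = weight.{u} q s' t' I' J' :=
    ⟨_, r, s, t, I, J, hst, rfl, rfl, rfl, rfl, rfl⟩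
  rw [Wpart, dif_pos hA]
  obtain ⟨r', s', t', I', J', hst', h1, h2, h3, h4, e⟩ := hA.choose_spec
  rw [e]
  exact weight_congr hq hst' hst h1 h2 h3 h4

lemma f_inv_mem_rat {q : ℂ} {r : Fin N → ℕ} (p p' : Idx r)
    (hp : ∀ x ∈ genericSet q r, f q (x p) (x p') ≠ 0) :
    (fun z : genericSet q r => (f q (z.1 p) (z.1 p'))⁻¹) ∈
      ratSubalgebra (genericSet q r) Subtype.val fun z => z.2 := by
  refine ⟨MvPolynomial.X p - MvPolynomial.X p',
    MvPolynomial.C q * MvPolynomial.X p - MvPolynomial.C q⁻¹ * MvPolynomial.X p',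
    fun x hx hh => hp x hx ?_, fun z => ?_⟩
  · simp only [map_sub, map_mul, MvPolynomial.eval_C, MvPolynomial.eval_X] at hh
    rw [f, hh, zero_div]
  · simp [f]

lemma fProd_inv_mem_rat {q : ℂ} {r : Fin N → ℕ} (e : (Σ k, Fin (r k)) → Idx r)
    (he : ∀ x ∈ genericSet q r, NormalizationRegular q fun k j => x (e ⟨k, j⟩)) :
    (fun z : genericSet q r => (fProd q fun k j => z.1 (e ⟨k, j⟩))⁻¹) ∈
      ratSubalgebra (genericSet q r) Subtype.val fun z => z.2 := by
  have : (fun z : genericSet q r => (fProd q fun k j => z.1 (e ⟨k, j⟩))⁻¹) =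
      ∏ k : Fin N, ∏ l : Fin N, if (l : ℕ) = k + 1 then
        ∏ a, ∏ b, fun z : genericSet q r => (f q (z.1 (e ⟨l, a⟩)) (z.1 (e ⟨k, b⟩)))⁻¹ else 1 := by
    funext z
    simp only [fProd, Finset.prod_apply, ← Finset.prod_inv_distrib]
    refine Finset.prod_congr rfl fun k _ => Finset.prod_congr rfl fun l _ => ?_
    split_ifs
    · simp only [Finset.prod_apply, Finset.prod_inv_distrib]
    · simp
  rw [this]
  refine Subalgebra.prod_mem _ fun k _ => Subalgebra.prod_mem _ fun l _ => ?_
  split_ifs with hkl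
  · exact Subalgebra.prod_mem _ fun a _ => Subalgebra.prod_mem _ fun b _ =>
      f_inv_mem_rat _ _ fun x hx => he x hx k l hkl a b
  · exact Subalgebra.one_mem _

theorem isRational_Wpart {q : ℂ} (hq : q ≠ 0) : IsRational q (Wpart.{u} (N := N) q) := by
  intro r I J _
  have h1 : (fun z : genericSet q r => (expansion.{u} q r).coeff (lab I J) z.1) ∈
      ratSubalgebra (genericSet q r) Subtype.val fun z => z.2 :=
    ⟨_, _, (expansion.{u} q r).den_ne _, fun z => rfl⟩
  have h2 := fProd_inv_mem_rat (q := q) (r := r) Sum.inl fun x hx => hx.2.2.2.1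
  have h3 := fProd_inv_mem_rat (q := q) (r := r) Sum.inr fun x hx => hx.2.2.2.2
  obtain ⟨P, Q, hQ, e⟩ := mul_mem (mul_mem h2 h3) h1
  refine ⟨P, Q, fun s t hst => ⟨hQ (pairPts s t) hst, ?_⟩⟩
  rw [Wpart_eq hq hst]
  exact e ⟨pairPts s t, hst⟩

lemma prod_ite_div {ι : Type*} [Fintype ι] [DecidableEq ι] (S : Finset ι) (a b : ι → ℂ)
    (hb : ∀ i, b i ≠ 0) :
    (∏ i, if i ∈ S then a i else b i) = (∏ i, b i) * ∏ i ∈ S, a i / b i := by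
  have : ∀ i, (if i ∈ S then a i else b i) = b i * if i ∈ S then a i / b i else 1 := by
    intro i
    split_ifs
    · rw [mul_div_cancel₀ _ (hb i)]
    · rw [mul_one]
  simp only [this, Finset.prod_mul_distrib, Finset.prod_ite_mem, Finset.univ_inter]

lemma prod_lam_lab {q : ℂ} {r : Fin N → ℕ} {H : Type u} [AddCommGroup H] [Module ℂ H]
    (M : Model (N + 1) q H) {s t : Params r} (hs : M.Admissible s) (ht : M.Admissible t)
    (I J : ∀ k, Finset (Fin (r k))) :
    ∏ p, M.lam (lab I J p) (pairPts s t p) =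
      (∏ k, ∏ j, M.lam k.succ (s k j)) * (∏ k, ∏ j, M.lam k.succ (t k j)) *
      ∏ k, ((∏ j ∈ I k, M.alpha k (s k j)) * ∏ j ∈ (J k)ᶜ, M.alpha k (t k j)) := by
  rw [Fintype.prod_sum_type, Fintype.prod_sigma, Fintype.prod_sigma, ← Finset.prod_mul_distrib,
    ← Finset.prod_mul_distrib, ← Finset.prod_mul_distrib]
  refine Finset.prod_congr rfl fun k _ => ?_
  have h1 := prod_ite_div (I k) (fun j => M.lam k.castSucc (s k j)) (fun j => M.lam k.succ (s k j))
    fun j => (hs k j).2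
  have h2 := prod_ite_div (J k)ᶜ (fun j => M.lam k.castSucc (t k j))
    (fun j => M.lam k.succ (t k j)) fun j => (ht k j).2
  rw [mul_mul_mul_comm]
  refine congrArg₂ (· * ·) (Eq.trans ?_ h1) (Eq.trans ?_ h2)
  · refine Finset.prod_congr rfl fun j _ => ?_
    simp only [lab, pairPts, Sum.elim_inl]
    split_ifs <;> rfl
  · refine Finset.prod_congr rfl fun j _ => ?_
    simp only [lab, pairPts, Sum.elim_inr, Finset.mem_compl]
    split_ifs <;> simp_all

/-- Only labels coming from partitions of equal cardinalities survive. For these, dividing by the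
`λ_{k+1}` in the normalization turns the monomial into the product of the `α_k`, and the factors
`fProd` are absorbed into `Wpart`. -/
theorem scalarProduct_eq_sum_Wpart {q : ℂ} (hq : q ≠ 0) {r : Fin N → ℕ} {H : Type u}
    [AddCommGroup H] [Module ℂ H] (M : Model (N + 1) q H) {s t : Params r} (hst : Generic q s t)
    (hs : M.Admissible s) (ht : M.Admissible t) :
    M.scalarProduct s t = ∑ I : (∀ k, Finset (Fin (r k))),
      ∑ J : (∀ k, Finset (Fin (r k))) with ∀ k, (I k).card = (J k).card,
        Wpart.{u} q (subsets s I) (subsets s fun k => (I k)ᶜ) (subsets t J)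
          (subsets t fun k => (J k)ᶜ) *
        ∏ k, ((∏ j ∈ I k, M.alpha k (s k j)) * ∏ j ∈ (J k)ᶜ, M.alpha k (t k j)) := by
  classical
  have hdom : ∀ p, pairPts s t p ∈ M.dom := by
    rintro (p | p)
    exacts [(hs p.1 p.2).1, (ht p.1 p.2).1]
  have hLs : (∏ k, ∏ j, M.lam k.succ (s k j)) ≠ 0 :=
    Finset.prod_ne_zero_iff.2 fun k _ => Finset.prod_ne_zero_iff.2 fun j _ => (hs k j).2
  have hLt : (∏ k, ∏ j, M.lam k.succ (t k j)) ≠ 0 :=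
    Finset.prod_ne_zero_iff.2 fun k _ => Finset.prod_ne_zero_iff.2 fun j _ => (ht k j).2
  set Y := expansion.{u} q r with hY
  have e1 : preScalar M s t = ∑ I, ∑ J with ∀ k, (I k).card = (J k).card,
      Y.coeff (lab I J) (pairPts s t) * ∏ p, M.lam (lab I J p) (pairPts s t p) := by
    have := Y.eq H M (pairPts s t) hst hdom
    refine this.trans ?_
    -- The sum over all labellings reduces to the image of `lab`: a label outside it violates the
    -- colour restriction, so its numerator is zero.
    rw [← Fintype.sum_of_injective _ lab_injective (fun P => Y.coeff (lab P.1 P.2) (pairPts s t) *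
      ∏ p, M.lam (lab P.1 P.2 p) (pairPts s t p)) _ (fun φ hφ => ?_) fun P => rfl,
      Fintype.sum_prod_type]
    · refine Finset.sum_congr rfl fun I _ => ?_
      refine (Finset.sum_filter_of_ne fun J _ hne => ?_).symm
      by_contra hcard
      refine hne ?_
      have h0 : Y.num (lab I J) = 0 := (exists_expansion q r).choose_spec _ fun hh =>
        hcard (card_eq_of_lab hh)
      rw [Expansion.coeff, h0, map_zero, zero_div, zero_mul]
    · have h0 : Y.num φ = 0 := by
        by_contra hne
        refine hφ ?_
        obtain ⟨I, J, e⟩ := exists_lab_eq (φ := φ)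
          (fun k j => by_contra fun hh => hne (Y.num_eq_zero_of_colour hq (Or.inr hh)))
          (fun k j => by_contra fun hh => hne (Y.num_eq_zero_of_colour hq (Or.inl hh)))
        exact ⟨(I, J), e⟩
      rw [h0, map_zero, zero_div, zero_mul]
  rw [scalarProduct_eq M s t hst.1, e1, Finset.mul_sum, Finset.mul_sum]
  refine Finset.sum_congr rfl fun I _ => ?_
  rw [Finset.mul_sum, Finset.mul_sum]
  refine Finset.sum_congr rfl fun J _ => ?_
  rw [Wpart_eq hq hst, weight, prod_lam_lab M hs ht, ← hY]
  change (_ * fProd q s)⁻¹ * ((_ * fProd q t)⁻¹ * _) = _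
  rw [mul_inv, mul_inv]
  field_simp

end weight

end BetheAnsatz

end

theorem mainTheorem3 (N : ℕ) (q : ℂ) (hq : q ≠ 0) :
    ∃ W : BetheAnsatz.ParamSets N → BetheAnsatz.ParamSets N →
        BetheAnsatz.ParamSets N → BetheAnsatz.ParamSets N → ℂ,
      BetheAnsatz.IsRational q W ∧
      ∀ (H : Type u) [AddCommGroup H] [Module ℂ H] (M : BetheAnsatz.Model (N + 1) q H)
        (r : Fin N → ℕ) (s t : BetheAnsatz.Params r),
        BetheAnsatz.Generic q s t → M.Admissible s → M.Admissible t →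
        M.scalarProduct s t =
          ∑ I : (∀ k, Finset (Fin (r k))),
            ∑ J : (∀ k, Finset (Fin (r k))) with ∀ k, (I k).card = (J k).card,
              W (BetheAnsatz.subsets s I) (BetheAnsatz.subsets s fun k => (I k)ᶜ)
                (BetheAnsatz.subsets t J) (BetheAnsatz.subsets t fun k => (J k)ᶜ) *
              ∏ k, ((∏ j ∈ I k, M.alpha k (s k j)) * ∏ j ∈ (J k)ᶜ, M.alpha k (t k j)) :=
  ⟨BetheAnsatz.Wpart.{u} q, BetheAnsatz.isRational_Wpart hq, fun _ _ _ M _ _ _ hst hs ht =>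
    BetheAnsatz.scalarProduct_eq_sum_Wpart hq M hst hs ht⟩
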